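/- A multidigraph $G=(V,A)$ is \emph{arc series-parallel} (ASP) with source $s$ and sink $t$ if it is obtained by the following recursion. Two nodes $s\neq t$ joined by a single arc from $s$ to $t$ form an ASP multidigraph. If $G_1$ (source $s_1$, sink $t_1$) and $G_2$ (source $s_2$, sink $t_2$) are disjoint ASP multidigraphs, then so are their parallel composition (identify $s_1$ with $s_2$ and $t_1$ with $t_2$; these become the source and the sink) and their series composition (identify $t_1$ with $s_2$; the source is $s_1$ and the sink is $t_2$). Let $\Phi$ be the set of simple $s$-$t$ paths of $G$, each identified with its set of arcs. For $X\in\Phi$ and an integer $k$ put $$\Phi^{\mathrm{incl}}(X,k)=\{Y\in\Phi: |Y\setminus X|\le k\},\quad \Phi^{\mathrm{excl}}(X,k)=\{Y\in\Phi: |X\setminus Y|\le k\},\quad \Phi^{\mathrm{sym}}(X,k)=\{Y\in\Phi: |(Y\setminus X)\cup(X\setminus Y)|\le k\}.$$ Given $G$, $s$, $t$, arc costs $C_e\ge 0$ and $\overline c_e\ge 0$ ($e\in A$) and an integer $k\ge 1$, the recoverable shortest path problem Rec SP with neighborhood $\Phi(X,k)$ asks for a pair of paths attaining $$\min_{X\in\Phi,\;Y\in\Phi(X,k)}\Big(\sum_{e\in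 X}C_e+\sum_{e\in Y}\overline c_e\Big).$$ \textbf{Theorem.} For each of the three neighborhoods $\Phi^{\mathrm{incl}}(X,k)$, $\Phi^{\mathrm{excl}}(X,k)$, $\Phi^{\mathrm{sym}}(X,k)$, Rec SP in arc series-parallel multidigraphs $G=(V,A)$ (with $s$ the source and $t$ the sink of $G$) can be solved in $O(|A|k^2)$ time. That is, there are a program and a constant $K$ such that for every such instance, given by the numbers $|V|$, $|A|$, $k$, $s$, $t$, the lists of tails and heads of the arcs, and the lists of the costs, the program outputs an optimal pair $(X,Y)$ and its cost after at most $K\,|A|\,k^2$ steps. The program runs on a unit-cost random access machine that can copy, increment, decrement and compare integers, copy, add and compare real numbers, and read and write arrays of integers and of reals at integer indices. -/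

import Mathlib

namespace RecSP

/-! ### Multidigraphs, simple paths, and the recoverable shortest path problem -/

/-- A multidigraph with node type `V` and arc type `A`. Distinct arcs may have the same end nodes. -/
structure Multidigraph (V A : Type) where
  tail : A → V
  head : A → V

/-- `G.IsWalk u l v`: the arcs in `l`, in this order, lead from `u` to `v`. -/
def Multidigraph.IsWalk {V A : Type} (G : Multidigraph V A) : V → List A → V → Prop
  | u, [], v => u = v
  | u, e :: l, v => G.tail e = u ∧ G.IsWalk (G.head e) l v

/-- The set `Φ` of all simple `s`-`t` paths (no node is visited twice), each path being identified
with its set of arcs. The visited nodes are `s` and the heads of the arcs. -/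
def Multidigraph.simplePaths {V A : Type} [DecidableEq A] (G : Multidigraph V A) (s t : V) :
    Set (Finset A) :=
  {X | ∃ l : List A, G.IsWalk s l t ∧ (s :: l.map G.head).Nodup ∧ l.toFinset = X}

/-- The three kinds of neighborhoods: arc inclusion, arc exclusion, arc symmetric difference. -/
inductive NeighborhoodKind where
  | incl
  | excl
  | sym

/-- The neighborhood `Φ(X, k)` of a path `X`. -/
def Multidigraph.neighborhood {V A : Type} [DecidableEq A] (G : Multidigraph V A) (s t : V) :
    NeighborhoodKind → Finset A → ℕ → Set (Finset A)
  | .incl, X, k => {Y | Y ∈ G.simplePaths s t ∧ (Y \ X).card ≤ k}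
  | .excl, X, k => {Y | Y ∈ G.simplePaths s t ∧ (X \ Y).card ≤ k}
  | .sym, X, k => {Y | Y ∈ G.simplePaths s t ∧ ((Y \ X) ∪ (X \ Y)).card ≤ k}

/-- An instance: a multidigraph with nodes `0, …, n - 1` and arcs `0, …, m - 1`, the starting node,
the destination node, the first-stage costs `C`, the (upper bounds on the) second-stage costs `c`,
and the recovery parameter `k`. -/
structure Instance where
  n : ℕ
  m : ℕ
  G : Multidigraph (Fin n) (Fin m)
  s : Fin n
  t : Fin n
  C : Fin m → ℝ
  c : Fin m → ℝ
  k : ℕ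

/-- The total cost of a pair of paths. -/
def Instance.cost (I : Instance) (X Y : Finset (Fin I.m)) : ℝ :=
  ∑ e ∈ X, I.C e + ∑ e ∈ Y, I.c e

/-- The feasible solutions: pairs of a path `X ∈ Φ` and a path `Y ∈ Φ(X, k)`. -/
def Instance.Feasible (I : Instance) (N : NeighborhoodKind) (X Y : Finset (Fin I.m)) : Prop :=
  X ∈ I.G.simplePaths I.s I.t ∧ Y ∈ I.G.neighborhood I.s I.t N X I.k

/-- The optimal solutions: feasible pairs of minimum total cost. -/
def Instance.Optimal (I : Instance) (N : NeighborhoodKind) (X Y : Finset (Fin I.m)) : Prop :=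
  I.Feasible N X Y ∧ ∀ X' Y', I.Feasible N X' Y' → I.cost X Y ≤ I.cost X' Y'

/-! ### Arc series-parallel multidigraphs -/

/-- `G` is obtained from disjoint copies of `G₁` and `G₂` by identifying exactly those pairs of
nodes `x` of `G₁` and `y` of `G₂` with `R x y`. The maps `φ₁`, `φ₂` send the nodes of `G₁`, `G₂`,
and `ψ` sends the arcs, to their copies in `G`. -/
structure IsGluing {V₁ A₁ V₂ A₂ V A : Type}
    (G₁ : Multidigraph V₁ A₁) (G₂ : Multidigraph V₂ A₂) (R : V₁ → V₂ → Prop)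
    (G : Multidigraph V A) (φ₁ : V₁ → V) (φ₂ : V₂ → V) (ψ : A₁ ⊕ A₂ ≃ A) : Prop where
  inj₁ : Function.Injective φ₁
  inj₂ : Function.Injective φ₂
  cover : ∀ v, (∃ x, φ₁ x = v) ∨ (∃ y, φ₂ y = v)
  identify : ∀ x y, φ₁ x = φ₂ y ↔ R x y
  tail₁ : ∀ a, G.tail (ψ (Sum.inl a)) = φ₁ (G₁.tail a)
  head₁ : ∀ a, G.head (ψ (Sum.inl a)) = φ₁ (G₁.head a)
  tail₂ : ∀ a, G.tail (ψ (Sum.inr a)) = φ₂ (G₂.tail a)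
  head₂ : ∀ a, G.head (ψ (Sum.inr a)) = φ₂ (G₂.head a)

/-- `IsASP G s t`: `G` is an arc series-parallel multidigraph with source `s` and sink `t`. -/
inductive IsASP : {V A : Type} → Multidigraph V A → V → V → Prop
  /-- Two nodes joined by a single arc. -/
  | arc {V A : Type} (G : Multidigraph V A) (s t : V) (e : A)
      (ne : s ≠ t) (nodes : ∀ v, v = s ∨ v = t) (arcs : ∀ a, a = e)
      (tail_eq : G.tail e = s) (head_eq : G.head e = t) : IsASP G s t
  /-- Parallel composition: identify the two sources, and identify the two sinks. -/
  | parallel {V₁ A₁ V₂ A₂ V A : Type}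
      (G₁ : Multidigraph V₁ A₁) (s₁ t₁ : V₁) (G₂ : Multidigraph V₂ A₂) (s₂ t₂ : V₂)
      (G : Multidigraph V A) (s t : V) (φ₁ : V₁ → V) (φ₂ : V₂ → V) (ψ : A₁ ⊕ A₂ ≃ A)
      (asp₁ : IsASP G₁ s₁ t₁) (asp₂ : IsASP G₂ s₂ t₂)
      (glue : IsGluing G₁ G₂ (fun x y => (x = s₁ ∧ y = s₂) ∨ (x = t₁ ∧ y = t₂)) G φ₁ φ₂ ψ)
      (source_eq : φ₁ s₁ = s) (sink_eq : φ₁ t₁ = t) : IsASP G s t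
  /-- Series composition: identify the sink of `G₁` with the source of `G₂`. -/
  | series {V₁ A₁ V₂ A₂ V A : Type}
      (G₁ : Multidigraph V₁ A₁) (s₁ t₁ : V₁) (G₂ : Multidigraph V₂ A₂) (s₂ t₂ : V₂)
      (G : Multidigraph V A) (s t : V) (φ₁ : V₁ → V) (φ₂ : V₂ → V) (ψ : A₁ ⊕ A₂ ≃ A)
      (asp₁ : IsASP G₁ s₁ t₁) (asp₂ : IsASP G₂ s₂ t₂)
      (glue : IsGluing G₁ G₂ (fun x y => x = t₁ ∧ y = s₂) G φ₁ φ₂ ψ)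
      (source_eq : φ₁ s₁ = s) (sink_eq : φ₂ t₂ = t) : IsASP G s t

/-! ### The machine model: a random access machine with unit costs

Integers serve as indices and counters and can only be set to a constant, copied, incremented,
decremented and compared, so that after `T` steps no integer exceeds the largest input number or
program constant by more than `T`. Real numbers can only be copied, added and compared. -/

/-- The memory: integer registers, integer arrays, real registers and real arrays. -/
structure Mem where
  ireg : ℕ → ℕ
  iarr : ℕ → ℕ → ℕ
  rreg : ℕ → ℝ
  rarr : ℕ → ℕ → ℝ

/-- The elementary instructions. Register names and array names are fixed in the program; the index
of an array access is read from an integer register. -/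
inductive Instr where
  /-- `ireg x := n` -/
  | iconst (x n : ℕ)
  /-- `ireg x := ireg y` -/
  | icopy (x y : ℕ)
  /-- `ireg x := ireg x + 1` -/
  | incr (x : ℕ)
  /-- `ireg x := ireg x - 1`, where `0 - 1 = 0` -/
  | decr (x : ℕ)
  /-- `ireg x := iarr a [ireg i]` -/
  | iload (x a i : ℕ)
  /-- `iarr a [ireg i] := ireg x` -/
  | istore (a i x : ℕ)
  /-- `rreg x := rreg y` -/
  | rcopy (x y : ℕ)
  /-- `rreg x := rreg y + rreg z` -/
  | radd (x y z : ℕ)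
  /-- `rreg x := rarr a [ireg i]` -/
  | rload (x a i : ℕ)
  /-- `rarr a [ireg i] := rreg x` -/
  | rstore (a i x : ℕ)

/-- The effect of an elementary instruction on the memory. -/
noncomputable def Instr.run : Instr → Mem → Mem
  | .iconst x n, M => { M with ireg := Function.update M.ireg x n }
  | .icopy x y, M => { M with ireg := Function.update M.ireg x (M.ireg y) }
  | .incr x, M => { M with ireg := Function.update M.ireg x (M.ireg x + 1) }
  | .decr x, M => { M with ireg := Function.update M.ireg x (M.ireg x - 1) }
  | .iload x a i, M => { M with ireg := Function.update M.ireg x (M.iarr a (M.ireg i)) }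
  | .istore a i x, M =>
      { M with
        iarr := Function.update M.iarr a (Function.update (M.iarr a) (M.ireg i) (M.ireg x)) }
  | .rcopy x y, M => { M with rreg := Function.update M.rreg x (M.rreg y) }
  | .radd x y z, M => { M with rreg := Function.update M.rreg x (M.rreg y + M.rreg z) }
  | .rload x a i, M => { M with rreg := Function.update M.rreg x (M.rarr a (M.ireg i)) }
  | .rstore a i x, M =>
      { M with
        rarr := Function.update M.rarr a (Function.update (M.rarr a) (M.ireg i) (M.rreg x)) }

/-- The elementary tests, on two integer registers or on two real registers. -/
inductive Test where
  | ieq (x y : ℕ)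
  | ine (x y : ℕ)
  | ilt (x y : ℕ)
  | rle (x y : ℕ)

/-- The outcome of a test. -/
def Test.Holds : Test → Mem → Prop
  | .ieq x y, M => M.ireg x = M.ireg y
  | .ine x y, M => M.ireg x ≠ M.ireg y
  | .ilt x y, M => M.ireg x < M.ireg y
  | .rle x y, M => M.rreg x ≤ M.rreg y

/-- Programs: `loop b p` repeats `p` as long as the test `b` holds. -/
inductive Prog where
  | skip
  | instr (i : Instr)
  | seq (p q : Prog)
  | ite (b : Test) (p q : Prog)
  | loop (b : Test) (p : Prog)

/-- `Exec p M T M'`: the program `p`, started in the memory `M`, halts with the memory `M'` after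
`T` steps. Each execution of an elementary instruction and each evaluation of a test is one step. -/
inductive Exec : Prog → Mem → ℕ → Mem → Prop
  | skip (M : Mem) : Exec .skip M 0 M
  | instr (i : Instr) (M : Mem) : Exec (.instr i) M 1 (i.run M)
  | seq {p q : Prog} {M M' M'' : Mem} {T T' : ℕ}
      (hp : Exec p M T M') (hq : Exec q M' T' M'') : Exec (.seq p q) M (T + T') M''
  | ite_true {b : Test} {p q : Prog} {M M' : Mem} {T : ℕ}
      (hb : b.Holds M) (hp : Exec p M T M') : Exec (.ite b p q) M (T + 1) M'
  | ite_false {b : Test} {p q : Prog} {M M' : Mem} {T : ℕ}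
      (hb : ¬ b.Holds M) (hq : Exec q M T M') : Exec (.ite b p q) M (T + 1) M'
  | loop_true {b : Test} {p : Prog} {M M' M'' : Mem} {T T' : ℕ}
      (hb : b.Holds M) (hp : Exec p M T M') (hw : Exec (.loop b p) M' T' M'') :
      Exec (.loop b p) M (T + T' + 1) M''
  | loop_false {b : Test} {p : Prog} {M : Mem}
      (hb : ¬ b.Holds M) : Exec (.loop b p) M 1 M

/-! ### Input and output conventions -/

/-- The array that holds `f 0, …, f (m - 1)`, followed by zeros. -/
def toArray {α : Type} [Zero α] {m : ℕ} (f : Fin m → α) (i : ℕ) : α :=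
  if h : i < m then f ⟨i, h⟩ else 0

/-- The initial memory: the integer registers `0, …, 4` hold `n, m, k, s, t`, the integer arrays `0`
and `1` hold the tails and the heads of the arcs, and the real arrays `0` and `1` hold the
first-stage and the second-stage costs of the arcs. All other memory cells are zero. -/
def Instance.input (I : Instance) : Mem where
  ireg
    | 0 => I.n
    | 1 => I.m
    | 2 => I.k
    | 3 => I.s
    | 4 => I.t
    | _ => 0
  iarr
    | 0 => toArray fun e => (I.G.tail e : ℕ)
    | 1 => toArray fun e => (I.G.head e : ℕ)
    | _ => fun _ => 0
  rreg := fun _ => 0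
  rarr
    | 0 => toArray I.C
    | 1 => toArray I.c
    | _ => fun _ => 0

/-- The memory `M` holds the answer: the integer arrays `2` and `3` hold the characteristic vectors
of the two paths of an optimal solution, and the real register `0` holds its cost. -/
def Instance.IsAnswer (I : Instance) (N : NeighborhoodKind) (M : Mem) : Prop :=
  ∃ X Y : Finset (Fin I.m), I.Optimal N X Y ∧
    (∀ e : Fin I.m, M.iarr 2 e = if e ∈ X then 1 else 0) ∧
    (∀ e : Fin I.m, M.iarr 3 e = if e ∈ Y then 1 else 0) ∧
    M.rreg 0 = I.cost X Y

end RecSP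

/-! An arc series-parallel multidigraph is described by a binary tree of series and parallel
compositions with the arcs as leaves (`IsASP.exists_tree`), and its simple paths from source to sink
are the arc sets generated by this tree (`Multidigraph.simplePaths_eq_lang`). All three
neighborhoods have the form p |X \ Y| + q |Y \ X| ≤ k with p, q ∈ {0, 1} (`Instance.feasible_iff`).
This weight and the cost are additive over arc-disjoint parts, which allows a dynamic program over
the tree.

For each tree node, each budget l ≤ k and each of four modes (neither path, only X, only Y, or both
run through the part) the table holds the least cost of a pair of weight at most l. In a series
composition both parts have the mode of the whole; in a parallel composition each path chooses one
part (`isSol_iff`). Each cell is a minimum over at most four rules and over the ways of splitting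
the budget, so a node costs O(k²), and there are 2m - 1 nodes. Table values are lower bounds for all
pairs (`Cells.Filled.le_cost`), and following the stored back pointers yields a pair attaining them
(`Cells.Filled.solution`).

The input lists only the arcs, so a decomposition must also be found, in time O(m). A depth-first
search from the source does this while contracting edges. It keeps a path of edges from s to the
current node v whose heads all have indegree one; other explored edges are pending at their heads.
An edge leaving v is merged with a parallel pending edge if there is one. Then it extends the path
if its head is not t and has indegree one; otherwise it waits at its head. When v ≠ s has no
unexplored arc left, exactly one edge leaves v, and it is contracted with the only edge into v. The
reason is structural: a node other than the sink has exactly one outgoing edge, or two parallel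
edges leave it, or an edge leaves it that is the only one into its head, a node other than the sink
(`SPTree.WF.reducible_or_unique`); the last two cases are ruled out by the search invariant
(`Search.not_reducible`). At s the same argument leaves a single edge. Every contraction preserves
the set of paths (`SPTree.WF.reduce_parallel`, `SPTree.WF.reduce_series`); the tree of the current
multidigraph occurs only in the proof, not in the memory. -/

namespace RecSP

/-! ### Series-parallel expressions and their terminals -/

/-- Binary series-parallel expressions over `E`. -/
inductive SPTree (E : Type) where
  | leaf (e : E)
  | ser (a b : SPTree E)
  | par (a b : SPTree E)

namespace SPTree

variable {E V α : Type}

/-- The leaves of an expression. -/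
def edges : SPTree E → Multiset E
  | leaf e => {e}
  | ser a b => a.edges + b.edges
  | par a b => a.edges + b.edges

/-- The source node, where `u` gives the tails of the leaves. -/
def src (u : E → V) : SPTree E → V
  | leaf e => u e
  | ser a _ => a.src u
  | par a _ => a.src u

/-- The sink node, where `w` gives the heads of the leaves. -/
def tgt (w : E → V) : SPTree E → V
  | leaf e => w e
  | ser _ b => b.tgt w
  | par a _ => a.tgt w

/-- `x` is an end node of a leaf of `t`. -/
def HasVert (u w : E → V) (t : SPTree E) (x : V) : Prop := ∃ e ∈ t.edges, u e = x ∨ w e = x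

/-- The expression describes a series-parallel multidigraph. -/
def WF (u w : E → V) : SPTree E → Prop
  | leaf e => u e ≠ w e
  | ser a b => a.WF u w ∧ b.WF u w ∧ a.tgt w = b.src u ∧
      ∀ x, a.HasVert u w x → b.HasVert u w x → x = a.tgt w
  | par a b => a.WF u w ∧ b.WF u w ∧ a.src u = b.src u ∧ a.tgt w = b.tgt w ∧
      ∀ x, a.HasVert u w x → b.HasVert u w x → x = a.src u ∨ x = a.tgt w

/-- The sets of arcs of the source-sink paths, if each leaf `e` stands for a subgraph with the
path sets `L e`. -/
def lang [DecidableEq α] (L : E → Set (Finset α)) : SPTree E → Set (Finset α)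
  | leaf e => L e
  | ser a b => Set.image2 (· ∪ ·) (a.lang L) (b.lang L)
  | par a b => a.lang L ∪ b.lang L

variable {u w : E → V}

theorem hasVert_tail {t : SPTree E} {e : E} (h : e ∈ t.edges) : t.HasVert u w (u e) :=
  ⟨e, h, .inl rfl⟩

theorem hasVert_head {t : SPTree E} {e : E} (h : e ∈ t.edges) : t.HasVert u w (w e) :=
  ⟨e, h, .inr rfl⟩

theorem exists_tail_src (u : E → V) (t : SPTree E) : ∃ e ∈ t.edges, u e = t.src u := by
  induction t with
  | leaf e => exact ⟨e, by simp [edges], rfl⟩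
  | ser a b iha _ => obtain ⟨e, he, h⟩ := iha; exact ⟨e, by simp [edges, he], h⟩
  | par a b iha _ => obtain ⟨e, he, h⟩ := iha; exact ⟨e, by simp [edges, he], h⟩

theorem exists_head_tgt (w : E → V) (t : SPTree E) : ∃ e ∈ t.edges, w e = t.tgt w := by
  induction t with
  | leaf e => exact ⟨e, by simp [edges], rfl⟩
  | ser a b _ ihb => obtain ⟨e, he, h⟩ := ihb; exact ⟨e, by simp [edges, he], h⟩
  | par a b iha _ => obtain ⟨e, he, h⟩ := iha; exact ⟨e, by simp [edges, he], h⟩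

theorem hasVert_src (t : SPTree E) : t.HasVert u w (t.src u) := by
  obtain ⟨e, he, h⟩ := t.exists_tail_src u
  exact ⟨e, he, .inl h⟩

theorem hasVert_tgt (t : SPTree E) : t.HasVert u w (t.tgt w) := by
  obtain ⟨e, he, h⟩ := t.exists_head_tgt w
  exact ⟨e, he, .inr h⟩

/-- If the ends of a series composition coincided, this node would be common to both parts and hence
be the join, so the first part would have equal terminals. -/
theorem WF.src_ne_tgt {t : SPTree E} (h : t.WF u w) : t.src u ≠ t.tgt w := by
  induction t with
  | leaf e => exact h
  | ser a b iha _ =>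
    obtain ⟨ha, hb, hm, hd⟩ := h
    intro heq
    have heq : a.src u = b.tgt w := heq
    exact iha ha (hd _ (hasVert_src a) (heq ▸ hasVert_tgt b))
  | par a b iha _ => exact iha h.1

/-- Together with `WF.tail_ne_tgt` this makes the terminals one-way, which is what excludes walks
that return to a part and misplaced pairs of edges in a composition. -/
theorem WF.head_ne_src {t : SPTree E} (h : t.WF u w) {e : E} (he : e ∈ t.edges) :
    w e ≠ t.src u := by
  induction t with
  | leaf e' =>
    simp only [edges, Multiset.mem_singleton] at he
    subst he
    exact fun h' => h h'.symm
  | ser a b iha _ =>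
    obtain ⟨ha, hb, hm, hd⟩ := h
    rcases Multiset.mem_add.1 he with he | he
    · exact iha ha he
    · intro heq
      have heq : w e = a.src u := heq
      exact ha.src_ne_tgt (hd _ (hasVert_src a) (heq ▸ hasVert_head he))
  | par a b iha ihb =>
    obtain ⟨ha, hb, hs, ht, hd⟩ := h
    rcases Multiset.mem_add.1 he with he | he
    · exact iha ha he
    · exact fun heq => ihb hb he (heq.trans hs)

theorem WF.tail_ne_tgt {t : SPTree E} (h : t.WF u w) {e : E} (he : e ∈ t.edges) :
    u e ≠ t.tgt w := by
  induction t with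
  | leaf e' =>
    simp only [edges, Multiset.mem_singleton] at he
    subst he
    exact h
  | ser a b _ ihb =>
    obtain ⟨ha, hb, hm, hd⟩ := h
    rcases Multiset.mem_add.1 he with he | he
    · intro heq
      have heq : u e = b.tgt w := heq
      have hv : a.HasVert u w (u e) := hasVert_tail he
      rw [heq] at hv
      exact hb.src_ne_tgt (hm ▸ (hd _ hv (hasVert_tgt b))).symm
    · exact ihb hb he
  | par a b iha ihb =>
    obtain ⟨ha, hb, hs, ht, hd⟩ := h
    rcases Multiset.mem_add.1 he with he | he
    · exact iha ha he
    · exact fun heq => ihb hb he (heq.trans ht)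

theorem WF.tail_ne_head {t : SPTree E} (h : t.WF u w) {e : E} (he : e ∈ t.edges) :
    u e ≠ w e := by
  induction t with
  | leaf e' =>
    simp only [edges, Multiset.mem_singleton] at he
    subst he
    exact h
  | ser a b iha ihb =>
    rcases Multiset.mem_add.1 he with he | he
    exacts [iha h.1 he, ihb h.2.1 he]
  | par a b iha ihb =>
    rcases Multiset.mem_add.1 he with he | he
    exacts [iha h.1 he, ihb h.2.1 he]

theorem HasVert.of_edges {t t' : SPTree E} (h : ∀ e ∈ t'.edges, t.HasVert u w (u e) ∧
    t.HasVert u w (w e)) {x : V} (hx : t'.HasVert u w x) : t.HasVert u w x := by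
  obtain ⟨e, he, rfl | rfl⟩ := hx
  exacts [(h e he).1, (h e he).2]

theorem HasVert.of_subset {t t' : SPTree E} (h : ∀ e ∈ t'.edges, e ∈ t.edges) {x : V}
    (hx : t'.HasVert u w x) : t.HasVert u w x := by
  obtain ⟨e, he, hx⟩ := hx
  exact ⟨e, h e he, hx⟩

/-! ### Splitting off edges -/

theorem add_eq_cons {x y R : Multiset E} {a : E} (h : x + y = a ::ₘ R) :
    (∃ R₁, x = a ::ₘ R₁ ∧ R = R₁ + y) ∨ (∃ R₁, y = a ::ₘ R₁ ∧ R = x + R₁) := by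
  have ha : a ∈ x + y := h ▸ Multiset.mem_cons_self a R
  rcases Multiset.mem_add.1 ha with ha | ha
  · obtain ⟨R₁, rfl⟩ := Multiset.exists_cons_of_mem ha
    rw [Multiset.cons_add, Multiset.cons_inj_right] at h
    exact .inl ⟨R₁, rfl, h.symm⟩
  · obtain ⟨R₁, rfl⟩ := Multiset.exists_cons_of_mem ha
    rw [Multiset.add_cons, Multiset.cons_inj_right] at h
    exact .inr ⟨R₁, rfl, h.symm⟩

/-- The case distinction for contracting two edges of a composition: they lie in the same part,
where induction applies, or in different parts. -/
theorem add_eq_cons_cons {x y R : Multiset E} {a b : E} (h : x + y = a ::ₘ b ::ₘ R) :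
    (∃ R₁, x = a ::ₘ b ::ₘ R₁ ∧ R = R₁ + y) ∨ (∃ R₁, y = a ::ₘ b ::ₘ R₁ ∧ R = x + R₁) ∨
    (∃ R₁ R₂, x = a ::ₘ R₁ ∧ y = b ::ₘ R₂ ∧ R = R₁ + R₂) ∨
    (∃ R₁ R₂, x = b ::ₘ R₁ ∧ y = a ::ₘ R₂ ∧ R = R₁ + R₂) := by
  rcases add_eq_cons h with ⟨R₁, rfl, h1⟩ | ⟨R₁, rfl, h1⟩
  · rcases add_eq_cons h1.symm with ⟨R₂, rfl, h2⟩ | ⟨R₂, rfl, h2⟩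
    · exact .inl ⟨R₂, rfl, h2⟩
    · exact .inr (.inr (.inl ⟨R₁, R₂, rfl, rfl, h2⟩))
  · rcases add_eq_cons h1.symm with ⟨R₂, rfl, h2⟩ | ⟨R₂, rfl, h2⟩
    · exact .inr (.inr (.inr ⟨R₂, R₁, rfl, rfl, h2⟩))
    · exact .inr (.inl ⟨R₂, rfl, h2⟩)

/-- An edge from the source to the sink can be split off in parallel. -/
theorem WF.extract_parallel {t : SPTree E} (h : t.WF u w) {e : E} {R : Multiset E}
    (hR : t.edges = e ::ₘ R) (hu : u e = t.src u) (hw : w e = t.tgt w) :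
    t = leaf e ∨ ∃ t' : SPTree E, t'.WF u w ∧ t'.src u = t.src u ∧ t'.tgt w = t.tgt w ∧
      t'.edges = R ∧ ∀ {α : Type} [DecidableEq α] (L : E → Set (Finset α)),
        t.lang L = L e ∪ t'.lang L := by
  induction t generalizing R with
  | leaf e' =>
    have : e ∈ (leaf e').edges := hR ▸ Multiset.mem_cons_self e R
    simp only [edges, Multiset.mem_singleton] at this
    exact .inl (by rw [this])
  | ser a b _ _ =>
    obtain ⟨ha, hb, hm, hd⟩ := h
    -- In a series composition the edge lies in one part but has an end at the far terminal of the
    -- other; this terminal is then shared, so it is the join, and the other part has equal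
    -- terminals.
    exfalso
    rcases add_eq_cons hR with ⟨R₁, h1, -⟩ | ⟨R₁, h1, -⟩
    · have he : e ∈ a.edges := h1 ▸ Multiset.mem_cons_self e R₁
      have := hd _ (hasVert_head he) (hw ▸ hasVert_tgt b)
      exact hb.src_ne_tgt (hm ▸ this.symm.trans hw)
    · have he : e ∈ b.edges := h1 ▸ Multiset.mem_cons_self e R₁
      have := hd _ (hu ▸ hasVert_src a) (hasVert_tail he)
      exact ha.src_ne_tgt (hu.symm.trans this)
  | par a b iha ihb =>
    obtain ⟨ha, hb, hs, ht, hd⟩ := h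
    right
    rcases add_eq_cons hR with ⟨R₁, h1, rfl⟩ | ⟨R₁, h1, rfl⟩
    · rcases iha ha h1 hu hw with rfl | ⟨a', h1', h2', h3', h4', h5'⟩
      · simp only [edges] at h1
        obtain rfl : R₁ = 0 := by simpa using h1
        exact ⟨b, hb, hs.symm, ht.symm, by simp, fun L => rfl⟩
      · refine ⟨par a' b, ⟨h1', hb, h2'.trans hs, h3'.trans ht, fun x hx hx' => ?_⟩, h2', h3',
          by simp [edges, h4'], fun L => ?_⟩
        · rw [h2', h3']
          refine hd x (hx.of_subset fun e he => ?_) hx'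
          rw [h1, ← h4']
          exact Multiset.mem_cons_of_mem he
        · simp only [lang, h5', Set.union_assoc]
    · rcases ihb hb h1 (hu.trans hs) (hw.trans ht) with rfl | ⟨b', h1', h2', h3', h4', h5'⟩
      · simp only [edges] at h1
        obtain rfl : R₁ = 0 := by simpa using h1
        exact ⟨a, ha, rfl, rfl, by simp, fun L => Set.union_comm _ _⟩
      · refine ⟨par a b', ⟨ha, h1', hs.trans h2'.symm, ht.trans h3'.symm, fun x hx hx' => ?_⟩,
          rfl, rfl, by simp [edges, h4'], fun L => ?_⟩
        · refine hd x hx (hx'.of_subset fun e he => ?_)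
          rw [h1, ← h4']
          exact Multiset.mem_cons_of_mem he
        · simp only [lang, h5', Set.union_left_comm]

/-- If only one edge enters the sink, it can be split off in series. -/
theorem WF.extract_last {t : SPTree E} (h : t.WF u w) {e : E} {R : Multiset E}
    (hR : t.edges = e ::ₘ R) (hw : w e = t.tgt w) (hu : ∀ x ∈ R, w x ≠ t.tgt w) :
    t = leaf e ∨ ∃ t' : SPTree E, t'.WF u w ∧ t'.src u = t.src u ∧ t'.tgt w = u e ∧
      t'.edges = R ∧ ∀ {α : Type} [DecidableEq α] (L : E → Set (Finset α)),
        t.lang L = Set.image2 (· ∪ ·) (t'.lang L) (L e) := by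
  induction t generalizing R with
  | leaf e' =>
    have : e ∈ (leaf e').edges := hR ▸ Multiset.mem_cons_self e R
    simp only [edges, Multiset.mem_singleton] at this
    exact .inl (by rw [this])
  | ser a b _ ihb =>
    obtain ⟨ha, hb, hm, hd⟩ := h
    right
    rcases add_eq_cons hR with ⟨R₁, h1, -⟩ | ⟨R₁, h1, rfl⟩
    · have he : e ∈ a.edges := h1 ▸ Multiset.mem_cons_self e R₁
      have := hd _ (hasVert_head he) (hw ▸ hasVert_tgt b)
      exact absurd (hm ▸ this.symm.trans hw) hb.src_ne_tgt
    · rcases ihb hb h1 hw fun x hx => hu x (Multiset.mem_add.2 (.inr hx)) with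
        rfl | ⟨b', h1', h2', h3', h4', h5'⟩
      · simp only [edges] at h1
        obtain rfl : R₁ = 0 := by simpa using h1
        exact ⟨a, ha, rfl, hm, by simp, fun L => rfl⟩
      · refine ⟨ser a b', ⟨ha, h1', hm.trans h2'.symm, fun x hx hx' => ?_⟩,
          rfl, h3', by simp [edges, h4'], fun L => ?_⟩
        · refine hd x hx (hx'.of_subset fun e he => ?_)
          rw [h1, ← h4']
          exact Multiset.mem_cons_of_mem he
        · simp only [lang, h5']
          exact (Set.image2_assoc Finset.union_assoc).symm
  | par a b _ _ =>
    obtain ⟨ha, hb, hs, ht, hd⟩ := h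
    -- Each of two parallel parts has its own edge into the sink, so `e` cannot be the only one.
    exfalso
    rcases add_eq_cons hR with ⟨R₁, h1, rfl⟩ | ⟨R₁, h1, rfl⟩
    · obtain ⟨e', he', h'⟩ := b.exists_head_tgt w
      exact hu e' (Multiset.mem_add.2 (.inr he')) (h'.trans ht.symm)
    · obtain ⟨e', he', h'⟩ := a.exists_head_tgt w
      exact hu e' (Multiset.mem_add.2 (.inl he')) h'

/-- If only one edge leaves the source, it can be split off in series. -/
theorem WF.extract_first {t : SPTree E} (h : t.WF u w) {e : E} {R : Multiset E}
    (hR : t.edges = e ::ₘ R) (hw : u e = t.src u) (hu : ∀ x ∈ R, u x ≠ t.src u) :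
    t = leaf e ∨ ∃ t' : SPTree E, t'.WF u w ∧ t'.tgt w = t.tgt w ∧ t'.src u = w e ∧
      t'.edges = R ∧ ∀ {α : Type} [DecidableEq α] (L : E → Set (Finset α)),
        t.lang L = Set.image2 (· ∪ ·) (L e) (t'.lang L) := by
  induction t generalizing R with
  | leaf e' =>
    have : e ∈ (leaf e').edges := hR ▸ Multiset.mem_cons_self e R
    simp only [edges, Multiset.mem_singleton] at this
    exact .inl (by rw [this])
  | ser a b iha _ =>
    obtain ⟨ha, hb, hm, hd⟩ := h
    right
    rcases add_eq_cons hR with ⟨R₁, h1, rfl⟩ | ⟨R₁, h1, -⟩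
    · rcases iha ha h1 hw fun x hx => hu x (Multiset.mem_add.2 (.inl hx)) with
        rfl | ⟨a', h1', h2', h3', h4', h5'⟩
      · simp only [edges] at h1
        obtain rfl : R₁ = 0 := by simpa using h1
        exact ⟨b, hb, rfl, hm.symm, by simp, fun L => rfl⟩
      · refine ⟨ser a' b, ⟨h1', hb, h2'.trans hm, fun x hx hx' => ?_⟩,
          rfl, h3', by simp [edges, h4'], fun L => ?_⟩
        · rw [h2']
          refine hd x (hx.of_subset fun e he => ?_) hx'
          rw [h1, ← h4']
          exact Multiset.mem_cons_of_mem he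
        · simp only [lang, h5']
          exact Set.image2_assoc Finset.union_assoc
    · have he : e ∈ b.edges := h1 ▸ Multiset.mem_cons_self e R₁
      have := hd _ (hw ▸ hasVert_src a) (hasVert_tail he)
      exact absurd (hw.symm.trans this) ha.src_ne_tgt
  | par a b _ _ =>
    obtain ⟨ha, hb, hs, ht, hd⟩ := h
    exfalso
    rcases add_eq_cons hR with ⟨R₁, h1, rfl⟩ | ⟨R₁, h1, rfl⟩
    · obtain ⟨e', he', h'⟩ := b.exists_tail_src u
      exact hu e' (Multiset.mem_add.2 (.inr he')) (h'.trans hs.symm)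
    · obtain ⟨e', he', h'⟩ := a.exists_tail_src u
      exact hu e' (Multiset.mem_add.2 (.inl he')) h'

/-! ### Contracting two edges into one -/

/-- `t'` arises from `t` by replacing some edges by an edge `c`, where `P L` says that the path
sets of `c` are those of the edges replaced. -/
def Reduces (u w : E → V) (t t' : SPTree E) (F : Multiset E)
    (P : ∀ {α : Type} [DecidableEq α], (E → Set (Finset α)) → Prop) : Prop :=
  t'.WF u w ∧ t'.src u = t.src u ∧ t'.tgt w = t.tgt w ∧ t'.edges = F ∧
    ∀ {α : Type} [DecidableEq α] (L : E → Set (Finset α)), P L → t'.lang L = t.lang L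

/-- Both ends of the two edges are common to both parts, so they are the terminals. Each edge can
therefore be split off in parallel, and reordering the parallel composition brings the two together.
-/
theorem WF.reduce_parallel_cross {x y : SPTree E} (h : (par x y).WF u w) {a b c : E}
    {R₁ R₂ : Multiset E} (hx : x.edges = a ::ₘ R₁) (hy : y.edges = b ::ₘ R₂)
    (hu : u a = u b) (hw : w a = w b) (hcu : u c = u a) (hcw : w c = w a) :
    ∃ t', Reduces u w (par x y) t' (c ::ₘ (R₁ + R₂)) fun L => L c = L a ∪ L b := by
  obtain ⟨h1, h2, hs, ht, hd⟩ := h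
  have ax : a ∈ x.edges := hx ▸ Multiset.mem_cons_self a R₁
  have bY : b ∈ y.edges := hy ▸ Multiset.mem_cons_self b R₂
  have hua : u a = x.src u :=
    (hd _ (hasVert_tail ax) (hu ▸ hasVert_tail bY)).resolve_right (h1.tail_ne_tgt ax)
  have hwa : w a = x.tgt w :=
    (hd _ (hasVert_head ax) (hw ▸ hasVert_head bY)).resolve_left (h1.head_ne_src ax)
  have hcne : u c ≠ w c := by rw [hcu, hcw]; exact h1.tail_ne_head ax
  have hc : (leaf c).WF u w := hcne
  have hcv : ∀ x, (leaf c).HasVert u w x → x = (leaf c).src u ∨ x = (leaf c).tgt w := by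
    rintro x ⟨e, he, h⟩
    simp only [edges, Multiset.mem_singleton] at he
    subst he
    exact h.imp Eq.symm Eq.symm
  have e1 : u c = x.src u := hcu.trans hua
  have e2 : w c = x.tgt w := hcw.trans hwa
  rcases h1.extract_parallel hx hua hwa with rfl | ⟨x', x1, x2, x3, x4, x5⟩
  · obtain rfl : R₁ = 0 := by simpa [edges] using hx
    rcases h2.extract_parallel hy (hu ▸ hua.trans hs) (hw ▸ hwa.trans ht) with
      rfl | ⟨y', y1, y2, y3, y4, y5⟩
    · obtain rfl : R₂ = 0 := by simpa [edges] using hy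
      exact ⟨leaf c, hc, e1, e2, by simp [edges], fun L hL => hL⟩
    · refine ⟨par (leaf c) y', ⟨hc, y1, e1.trans (hs.trans y2.symm), e2.trans (ht.trans y3.symm),
        fun x hx _ => hcv x hx⟩, e1, e2, ?_, fun L hL => ?_⟩
      · simp [edges, y4]
      · simp only [lang, hL, y5, Set.union_assoc]
  · rcases h2.extract_parallel hy (hu ▸ hua.trans hs) (hw ▸ hwa.trans ht) with
      rfl | ⟨y', y1, y2, y3, y4, y5⟩
    · obtain rfl : R₂ = 0 := by simpa [edges] using hy
      refine ⟨par (leaf c) x', ⟨hc, x1, e1.trans x2.symm, e2.trans x3.symm,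
        fun x hx _ => hcv x hx⟩, e1, e2, ?_, fun L hL => ?_⟩
      · simp [edges, x4]
      · simp only [lang, hL, x5]
        ext; simp only [Set.mem_union]; tauto
    · refine ⟨par (leaf c) (par x' y'), ⟨hc, ⟨x1, y1, x2.trans (hs.trans y2.symm),
        x3.trans (ht.trans y3.symm), fun z hz hz' => ?_⟩, e1.trans x2.symm, e2.trans x3.symm,
        fun x hx _ => hcv x hx⟩, e1, e2, ?_, fun L hL => ?_⟩
      · rw [x2, x3]
        refine hd z (hz.of_subset fun e he => ?_) (hz'.of_subset fun e he => ?_)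
        · rw [hx, ← x4]; exact Multiset.mem_cons_of_mem he
        · rw [hy, ← y4]; exact Multiset.mem_cons_of_mem he
      · simp [edges, x4, y4]
      · simp only [lang, hL, x5, y5]
        ext; simp only [Set.mem_union]; tauto

/-- A reduction inside a part does not create new nodes. -/
theorem HasVert.of_replace {t t' : SPTree E} {a b c : E} {R : Multiset E}
    (ht : t.edges = a ::ₘ b ::ₘ R) (ht' : t'.edges = c ::ₘ R)
    (hu : u c = u a) (hw : w c = w b ∨ w c = w a) {x : V} (hx : t'.HasVert u w x) :
    t.HasVert u w x := by
  refine hx.of_edges fun e he => ?_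
  rw [ht', Multiset.mem_cons] at he
  have ha : a ∈ t.edges := by simp [ht]
  have hb : b ∈ t.edges := by simp [ht]
  rcases he with rfl | he
  · exact ⟨hu ▸ hasVert_tail ha, hw.elim (fun h => h ▸ hasVert_head hb)
      fun h => h ▸ hasVert_head ha⟩
  · have he : e ∈ t.edges := by simp [ht, he]
    exact ⟨hasVert_tail he, hasVert_head he⟩

theorem Reduces.ser_left {x x' y : SPTree E} (h : (ser x y).WF u w) {F : Multiset E}
    {P : ∀ {α : Type} [DecidableEq α], (E → Set (Finset α)) → Prop}
    (hx : Reduces u w x x' F P) (hv : ∀ z, x'.HasVert u w z → x.HasVert u w z) :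
    Reduces u w (ser x y) (ser x' y) (F + y.edges) P := by
  obtain ⟨h1, h2, hm, hd⟩ := h
  obtain ⟨x1, x2, x3, x4, x5⟩ := hx
  refine ⟨⟨x1, h2, x3.trans hm, fun z hz hz' => x3 ▸ hd z (hv z hz) hz'⟩, x2, rfl,
    by simp [edges, x4], fun L hL => by simp only [lang, x5 L hL]⟩

theorem Reduces.ser_right {x y y' : SPTree E} (h : (ser x y).WF u w) {F : Multiset E}
    {P : ∀ {α : Type} [DecidableEq α], (E → Set (Finset α)) → Prop}
    (hy : Reduces u w y y' F P) (hv : ∀ z, y'.HasVert u w z → y.HasVert u w z) :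
    Reduces u w (ser x y) (ser x y') (x.edges + F) P := by
  obtain ⟨h1, h2, hm, hd⟩ := h
  obtain ⟨x1, x2, x3, x4, x5⟩ := hy
  refine ⟨⟨h1, x1, hm.trans x2.symm, fun z hz hz' => hd z hz (hv z hz')⟩, rfl, x3,
    by simp [edges, x4], fun L hL => by simp only [lang, x5 L hL]⟩

theorem Reduces.par_left {x x' y : SPTree E} (h : (par x y).WF u w) {F : Multiset E}
    {P : ∀ {α : Type} [DecidableEq α], (E → Set (Finset α)) → Prop}
    (hx : Reduces u w x x' F P) (hv : ∀ z, x'.HasVert u w z → x.HasVert u w z) :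
    Reduces u w (par x y) (par x' y) (F + y.edges) P := by
  obtain ⟨h1, h2, hs, ht, hd⟩ := h
  obtain ⟨x1, x2, x3, x4, x5⟩ := hx
  refine ⟨⟨x1, h2, x2.trans hs, x3.trans ht, fun z hz hz' => ?_⟩, x2, x3,
    by simp [edges, x4], fun L hL => by simp only [lang, x5 L hL]⟩
  rw [x2, x3]
  exact hd z (hv z hz) hz'

theorem Reduces.par_right {x y y' : SPTree E} (h : (par x y).WF u w) {F : Multiset E}
    {P : ∀ {α : Type} [DecidableEq α], (E → Set (Finset α)) → Prop}
    (hy : Reduces u w y y' F P) (hv : ∀ z, y'.HasVert u w z → y.HasVert u w z) :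
    Reduces u w (par x y) (par x y') (x.edges + F) P := by
  obtain ⟨h1, h2, hs, ht, hd⟩ := h
  obtain ⟨x1, x2, x3, x4, x5⟩ := hy
  exact ⟨⟨h1, x1, hs.trans x2.symm, ht.trans x3.symm, fun z hz hz' => hd z hz (hv z hz')⟩, rfl,
    rfl, by simp [edges, x4], fun L hL => by simp only [lang, x5 L hL]⟩

/-- Two parallel edges can be replaced by one edge. -/
theorem WF.reduce_parallel {t : SPTree E} (h : t.WF u w) {a b c : E} {R : Multiset E}
    (hR : t.edges = a ::ₘ b ::ₘ R) (hu : u a = u b) (hw : w a = w b) (hcu : u c = u a)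
    (hcw : w c = w a) :
    ∃ t', Reduces u w t t' (c ::ₘ R) fun L => L c = L a ∪ L b := by
  induction t generalizing R with
  | leaf e =>
    have := congrArg Multiset.card hR
    simp [edges] at this
  | ser x y ihx ihy =>
    rcases add_eq_cons_cons hR with ⟨R₁, h1, rfl⟩ | ⟨R₁, h1, rfl⟩ | ⟨R₁, R₂, h1, h2, rfl⟩ |
      ⟨R₁, R₂, h1, h2, rfl⟩
    · obtain ⟨x', hx'⟩ := ihx h.1 h1
      have := hx'.ser_left h fun z => .of_replace h1 hx'.2.2.2.1 hcu (.inr hcw)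
      exact ⟨_, by simpa using this⟩
    · obtain ⟨y', hy'⟩ := ihy h.2.1 h1
      have := hy'.ser_right h fun z => .of_replace h1 hy'.2.2.2.1 hcu (.inr hcw)
      exact ⟨_, by simpa using this⟩
    -- The common tail would be the join, that is, the sink of `x`, which no edge of `x` leaves.
    · exfalso
      have ha : a ∈ x.edges := by simp [h1]
      have hb : b ∈ y.edges := by simp [h2]
      exact h.1.tail_ne_tgt ha (h.2.2.2 _ (hasVert_tail ha) (hu ▸ hasVert_tail hb))
    · exfalso
      have hb : b ∈ x.edges := by simp [h1]
      have ha : a ∈ y.edges := by simp [h2]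
      exact h.1.tail_ne_tgt hb (h.2.2.2 _ (hasVert_tail hb) (hu ▸ hasVert_tail ha))
  | par x y ihx ihy =>
    rcases add_eq_cons_cons hR with ⟨R₁, h1, rfl⟩ | ⟨R₁, h1, rfl⟩ | ⟨R₁, R₂, h1, h2, rfl⟩ |
      ⟨R₁, R₂, h1, h2, rfl⟩
    · obtain ⟨x', hx'⟩ := ihx h.1 h1
      have := hx'.par_left h fun z => .of_replace h1 hx'.2.2.2.1 hcu (.inr hcw)
      exact ⟨_, by simpa using this⟩
    · obtain ⟨y', hy'⟩ := ihy h.2.1 h1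
      have := hy'.par_right h fun z => .of_replace h1 hy'.2.2.2.1 hcu (.inr hcw)
      exact ⟨_, by simpa using this⟩
    · exact h.reduce_parallel_cross h1 h2 hu hw hcu hcw
    · obtain ⟨t', h1, h2, h3, h4, h5⟩ :=
        h.reduce_parallel_cross h1 h2 hu.symm hw.symm (hcu.trans hu) (hcw.trans hw)
      exact ⟨t', h1, h2, h3, h4, fun L hL => h5 L (hL.trans (Set.union_comm _ _))⟩

/-- The shared node is the join, `a` is the only edge into the sink of `x`, and `b` the only edge
out of the source of `y`. So `x` ends with `a`, `y` starts with `b`, and associativity of series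
composition puts `c` between the two remainders. -/
theorem WF.reduce_series_cross {x y : SPTree E} (h : (ser x y).WF u w) {a b c : E}
    {R₁ R₂ : Multiset E} (hx : x.edges = a ::ₘ R₁) (hy : y.edges = b ::ₘ R₂)
    (hab : w a = u b) (hw : ∀ e ∈ R₁, w e ≠ w a) (hu : ∀ e ∈ R₂, u e ≠ u b)
    (hcu : u c = u a) (hcw : w c = w b) :
    ∃ t', Reduces u w (ser x y) t' (c ::ₘ (R₁ + R₂))
      fun L => L c = Set.image2 (· ∪ ·) (L a) (L b) := by
  obtain ⟨h1, h2, hm, hd⟩ := h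
  have ax : a ∈ x.edges := hx ▸ Multiset.mem_cons_self a R₁
  have bY : b ∈ y.edges := hy ▸ Multiset.mem_cons_self b R₂
  have hwa : w a = x.tgt w := hd _ (hasVert_head ax) (hab ▸ hasVert_tail bY)
  have hub : u b = y.src u := hab.symm.trans (hwa.trans hm)
  have hcv : ∀ x, (leaf c).HasVert u w x → x = u c ∨ x = w c := by
    rintro x ⟨e, he, h⟩
    simp only [edges, Multiset.mem_singleton] at he
    subst he
    exact h.imp Eq.symm Eq.symm
  have xy : ∀ z, x.HasVert u w z → y.HasVert u w z → z = w a := fun z hz hz' =>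
    (hd z hz hz').trans hwa.symm
  have cx : ¬ x.HasVert u w (w c) := fun hv => by
    have := xy _ hv (hcw ▸ hasVert_head bY)
    rw [hcw, hab] at this
    exact h2.tail_ne_head bY this.symm
  have cy : ¬ y.HasVert u w (u c) := fun hv => by
    have := xy _ (hcu ▸ hasVert_tail ax) hv
    rw [hcu] at this
    exact h1.tail_ne_head ax this
  have hc : (leaf c).WF u w := fun heq => cx (heq ▸ hcu ▸ hasVert_tail ax)
  rcases h1.extract_last hx hwa (hwa ▸ hw) with rfl | ⟨x', x1, x2, x3, x4, x5⟩
  · obtain rfl : R₁ = 0 := by simpa [edges] using hx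
    rcases h2.extract_first hy hub (hub ▸ hu) with rfl | ⟨y', y1, y2, y3, y4, y5⟩
    · obtain rfl : R₂ = 0 := by simpa [edges] using hy
      exact ⟨leaf c, hc, hcu, hcw, by simp [edges], fun L hL => hL⟩
    · refine ⟨ser (leaf c) y', ⟨hc, y1, hcw.trans y3.symm, fun z hz hz' => ?_⟩, hcu, y2, ?_,
        fun L hL => ?_⟩
      · refine (hcv z hz).resolve_left ?_
        rintro rfl
        refine cy (hz'.of_subset fun e he => ?_)
        rw [hy, ← y4]; exact Multiset.mem_cons_of_mem he
      · simp [edges, y4]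
      · simp only [lang, hL, y5]
        exact Set.image2_assoc Finset.union_assoc
  · have xx : ∀ z, x'.HasVert u w z → x.HasVert u w z := fun z hz => hz.of_subset fun e he => by
      rw [hx, ← x4]; exact Multiset.mem_cons_of_mem he
    -- The old join disappears with `a` and `b`. It was the only node that `x` and `y` shared, so
    -- the remainders are disjoint.
    have hmid : ¬ x'.HasVert u w (w a) := by
      rintro ⟨e, he, h | h⟩
      · refine h1.tail_ne_tgt ?_ (h.trans hwa)
        rw [hx, ← x4]; exact Multiset.mem_cons_of_mem he
      · exact hw e (x4 ▸ he) h
    rcases h2.extract_first hy hub (hub ▸ hu) with rfl | ⟨y', y1, y2, y3, y4, y5⟩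
    · obtain rfl : R₂ = 0 := by simpa [edges] using hy
      refine ⟨ser x' (leaf c), ⟨x1, hc, x3.trans hcu.symm, fun z hz hz' => ?_⟩, x2, hcw, ?_,
        fun L hL => ?_⟩
      · rw [x3, ← hcu]
        refine (hcv z hz').resolve_right ?_
        rintro rfl
        exact cx (xx _ hz)
      · rw [add_zero, edges, edges, x4, add_comm, Multiset.singleton_add]
      · simp only [lang, hL, x5]
        exact (Set.image2_assoc Finset.union_assoc).symm
    · have yy : ∀ z, y'.HasVert u w z → y.HasVert u w z := fun z hz =>
        hz.of_subset fun e he => by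
          rw [hy, ← y4]; exact Multiset.mem_cons_of_mem he
      refine ⟨ser x' (ser (leaf c) y'), ⟨x1, ⟨hc, y1, hcw.trans y3.symm, fun z hz hz' => ?_⟩,
        x3.trans hcu.symm, fun z hz hz' => ?_⟩, x2, y2, ?_, fun L hL => ?_⟩
      · refine (hcv z hz).resolve_left ?_
        rintro rfl
        exact cy (yy _ hz')
      · rw [x3, ← hcu]
        obtain ⟨e, he, hz'⟩ := hz'
        rcases Multiset.mem_add.1 he with he | he
        · refine (hcv z ⟨e, he, hz'⟩).resolve_right ?_
          rintro rfl
          exact cx (xx _ hz)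
        · have := xy z (xx z hz) (yy z ⟨e, he, hz'⟩)
          exact absurd (this ▸ hz) hmid
      · simp only [edges, x4, y4, Multiset.singleton_add, Multiset.add_cons]
      · simp only [lang, hL, x5, y5]
        rw [Set.image2_assoc Finset.union_assoc, Set.image2_assoc Finset.union_assoc]

/-- The only edge into a node and the only edge out of it can be replaced by one edge. -/
theorem WF.reduce_series {t : SPTree E} (h : t.WF u w) {a b c : E} {R : Multiset E}
    (hR : t.edges = a ::ₘ b ::ₘ R) (hab : w a = u b)
    (hw : ∀ e ∈ R, w e ≠ w a) (hu : ∀ e ∈ R, u e ≠ u b) (hcu : u c = u a) (hcw : w c = w b) :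
    ∃ t', Reduces u w t t' (c ::ₘ R) fun L => L c = Set.image2 (· ∪ ·) (L a) (L b) := by
  induction t generalizing R with
  | leaf e =>
    have := congrArg Multiset.card hR
    simp [edges] at this
  | ser x y ihx ihy =>
    rcases add_eq_cons_cons hR with ⟨R₁, h1, rfl⟩ | ⟨R₁, h1, rfl⟩ | ⟨R₁, R₂, h1, h2, rfl⟩ |
      ⟨R₁, R₂, h1, h2, rfl⟩
    · obtain ⟨x', hx'⟩ := ihx h.1 h1 (fun e he => hw e (by simp [he]))
        (fun e he => hu e (by simp [he]))
      have := hx'.ser_left h fun z => .of_replace h1 hx'.2.2.2.1 hcu (.inl hcw)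
      exact ⟨_, by simpa using this⟩
    · obtain ⟨y', hy'⟩ := ihy h.2.1 h1 (fun e he => hw e (by simp [he]))
        (fun e he => hu e (by simp [he]))
      have := hy'.ser_right h fun z => .of_replace h1 hy'.2.2.2.1 hcu (.inl hcw)
      exact ⟨_, by simpa using this⟩
    · exact h.reduce_series_cross h1 h2 hab (fun e he => hw e (by simp [he]))
        (fun e he => hu e (by simp [he])) hcu hcw
    · exfalso
      have hb : b ∈ x.edges := by simp [h1]
      have ha : a ∈ y.edges := by simp [h2]
      exact h.1.tail_ne_tgt hb (h.2.2.2 _ (hasVert_tail hb) (hab ▸ hasVert_head ha))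
  | par x y ihx ihy =>
    rcases add_eq_cons_cons hR with ⟨R₁, h1, rfl⟩ | ⟨R₁, h1, rfl⟩ | ⟨R₁, R₂, h1, h2, rfl⟩ |
      ⟨R₁, R₂, h1, h2, rfl⟩
    · obtain ⟨x', hx'⟩ := ihx h.1 h1 (fun e he => hw e (by simp [he]))
        (fun e he => hu e (by simp [he]))
      have := hx'.par_left h fun z => .of_replace h1 hx'.2.2.2.1 hcu (.inl hcw)
      exact ⟨_, by simpa using this⟩
    · obtain ⟨y', hy'⟩ := ihy h.2.1 h1 (fun e he => hw e (by simp [he]))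
        (fun e he => hu e (by simp [he]))
      have := hy'.par_right h fun z => .of_replace h1 hy'.2.2.2.1 hcu (.inl hcw)
      exact ⟨_, by simpa using this⟩
    -- A node shared by parallel parts is a terminal, but `a` enters this node and `b` leaves it.
    · exfalso
      obtain ⟨g1, g2, hs, ht, hd⟩ := h
      have ha : a ∈ x.edges := by simp [h1]
      have hb : b ∈ y.edges := by simp [h2]
      rcases hd _ (hasVert_head ha) (hab ▸ hasVert_tail hb) with h' | h'
      · exact g1.head_ne_src ha h'
      · exact g2.tail_ne_tgt hb (hab ▸ h'.trans ht)
    · exfalso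
      obtain ⟨g1, g2, hs, ht, hd⟩ := h
      have hb : b ∈ x.edges := by simp [h1]
      have ha : a ∈ y.edges := by simp [h2]
      rcases hd _ (hasVert_tail hb) (hab ▸ hasVert_head ha) with h' | h'
      · exact g2.head_ne_src ha (hab.trans (h'.trans hs))
      · exact g1.tail_ne_tgt hb h'

/-! ### Where a contraction is possible -/

/-- Two parallel edges leave `v`, or an edge leaves `v` that is the only edge into its head, and
this head is not the sink. -/
def Reducible (u w : E → V) (t : SPTree E) (v : V) : Prop :=
  (∃ a b R, t.edges = a ::ₘ b ::ₘ R ∧ u a = v ∧ u b = v ∧ w a = w b) ∨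
  (∃ a R, t.edges = a ::ₘ R ∧ u a = v ∧ w a ≠ t.tgt w ∧ ∀ x ∈ R, w x ≠ w a)

/-- Parallel edges stay parallel in a larger graph. The other kind of reducibility survives because
the added edges `F` do not enter nodes of the part other than its terminals. -/
theorem Reducible.lift {t t' : SPTree E} {F : Multiset E} {v : V} (h : t'.edges = t.edges + F)
    (ht : ∀ a ∈ t.edges, w a ≠ t.tgt w → w a ≠ t'.tgt w ∧ ∀ x ∈ F, w x ≠ w a)
    (hr : t.Reducible u w v) : t'.Reducible u w v := by
  rcases hr with ⟨a, b, R, h1, h2⟩ | ⟨a, R, h1, h2, h3, h4⟩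
  · exact .inl ⟨a, b, R + F, by simp [h, h1], h2⟩
  · have := ht a (by simp [h1]) h3
    refine .inr ⟨a, R + F, by simp [h, h1], h2, this.1, fun x hx => ?_⟩
    rcases Multiset.mem_add.1 hx with hx | hx
    exacts [h4 x hx, this.2 x hx]

theorem Reducible.ser_left {x y : SPTree E} (h : (ser x y).WF u w) {v : V}
    (hr : x.Reducible u w v) : (ser x y).Reducible u w v := by
  obtain ⟨h1, h2, hm, hd⟩ := h
  refine hr.lift rfl fun a ha hne => ⟨fun heq => hne ?_, fun e he heq => hne ?_⟩
  · exact hd _ (hasVert_head ha) (heq ▸ hasVert_tgt y)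
  · exact hd _ (hasVert_head ha) (heq ▸ hasVert_head he)

theorem Reducible.ser_right {x y : SPTree E} (h : (ser x y).WF u w) {v : V}
    (hr : y.Reducible u w v) : (ser x y).Reducible u w v := by
  obtain ⟨h1, h2, hm, hd⟩ := h
  refine hr.lift (add_comm _ _) fun a ha hne => ⟨hne, fun e he heq => ?_⟩
  exact h2.head_ne_src ha (hm ▸ hd _ (heq ▸ hasVert_head he) (hasVert_head ha))

theorem Reducible.par_left {x y : SPTree E} (h : (par x y).WF u w) {v : V}
    (hr : x.Reducible u w v) : (par x y).Reducible u w v := by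
  obtain ⟨h1, h2, hs, ht, hd⟩ := h
  refine hr.lift rfl fun a ha hne => ⟨hne, fun e he heq => ?_⟩
  rcases hd _ (hasVert_head ha) (heq ▸ hasVert_head he) with h' | h'
  exacts [h1.head_ne_src ha h', hne h']

theorem Reducible.par_right {x y : SPTree E} (h : (par x y).WF u w) {v : V}
    (hr : y.Reducible u w v) : (par x y).Reducible u w v := by
  obtain ⟨h1, h2, hs, ht, hd⟩ := h
  refine hr.lift (add_comm _ _) fun a ha hne => ⟨fun heq => hne (heq.trans ht), fun e he heq => ?_⟩
  rcases hd _ (hasVert_head he) (heq ▸ hasVert_head ha) with h' | h'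
  exacts [h1.head_ne_src he h', hne ((heq.symm.trans h').trans ht)]

/-- Descending along first parts ends at a single edge. In series, this edge is the only one into
the join; in parallel, either the other part is reducible at the source or it is a second parallel
edge. -/
theorem WF.reducible_src {t : SPTree E} (h : t.WF u w) :
    (∃ a, t = leaf a) ∨ t.Reducible u w (t.src u) := by
  induction t with
  | leaf e => exact .inl ⟨e, rfl⟩
  | ser x y ihx _ =>
    right
    rcases ihx h.1 with ⟨a, rfl⟩ | hx
    · obtain ⟨h1, h2, hm, hd⟩ := h
      refine .inr ⟨a, y.edges, by simp [edges], rfl, fun heq => ?_, fun e he heq => ?_⟩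
      · exact h2.src_ne_tgt (hm.symm.trans heq)
      · exact h2.head_ne_src he (heq.trans hm)
    · exact hx.ser_left h
  | par x y ihx ihy =>
    right
    rcases ihx h.1 with ⟨a, rfl⟩ | hx
    · rcases ihy h.2.1 with ⟨b, rfl⟩ | hy
      · obtain ⟨h1, h2, hs, ht, hd⟩ := h
        exact .inl ⟨a, b, 0, rfl, rfl, hs.symm, ht⟩
      · have := hy.par_right h
        rwa [← h.2.2.1] at this
    · exact hx.par_left h

/-- A node other than the sink has exactly one outgoing edge, or the graph is reducible there. -/
theorem WF.reducible_or_unique {t : SPTree E} (h : t.WF u w) {v : V} (hv : t.HasVert u w v)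
    (hvt : v ≠ t.tgt w) :
    (∃ a R, t.edges = a ::ₘ R ∧ u a = v ∧ ∀ x ∈ R, u x ≠ v) ∨ t.Reducible u w v := by
  by_cases hvs : v = t.src u
  · rcases h.reducible_src with ⟨a, rfl⟩ | h'
    · exact .inl ⟨a, 0, rfl, hvs.symm, by simp⟩
    · exact .inr (hvs ▸ h')
  induction t with
  | leaf e =>
    obtain ⟨e', he', h'⟩ := hv
    simp only [edges, Multiset.mem_singleton] at he'
    subst he'
    exact (h'.elim (fun h => hvs h.symm) fun h => hvt h.symm).elim
  | ser x y ihx ihy =>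
    have h' := h
    obtain ⟨h1, h2, hm, hd⟩ := h
    -- The join is treated as a node of `y`. It is the source of `y`, where `reducible_src` applies,
    -- and no edge of `x` leaves it.
    by_cases hvy : y.HasVert u w v
    · have key : (∃ a R, y.edges = a ::ₘ R ∧ u a = v ∧ ∀ x ∈ R, u x ≠ v) ∨
          y.Reducible u w v := by
        by_cases hys : v = y.src u
        · rcases h2.reducible_src with ⟨a, rfl⟩ | h'
          · exact .inl ⟨a, 0, rfl, hys.symm, by simp⟩
          · exact .inr (hys ▸ h')
        · exact ihy h2 hvy hvt hys
      refine key.imp ?_ fun hr => hr.ser_right h'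
      rintro ⟨a, R, e1, e2, e3⟩
      refine ⟨a, x.edges + R, by simp [edges, e1], e2, fun e he heq => ?_⟩
      rcases Multiset.mem_add.1 he with he | he
      · exact h1.tail_ne_tgt he (heq.trans (hd v (heq ▸ hasVert_tail he) hvy))
      · exact e3 e he heq
    · have hvx : x.HasVert u w v := by
        obtain ⟨e, he, h⟩ := hv
        rcases Multiset.mem_add.1 he with he | he
        exacts [⟨e, he, h⟩, absurd ⟨e, he, h⟩ hvy]
      refine (ihx h1 hvx (fun heq => hvy (heq ▸ hm ▸ hasVert_src y)) hvs).imp ?_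
        fun hr => hr.ser_left h'
      rintro ⟨a, R, e1, e2, e3⟩
      refine ⟨a, R + y.edges, by simp [edges, e1], e2, fun e he heq => ?_⟩
      rcases Multiset.mem_add.1 he with he | he
      · exact e3 e he heq
      · exact hvy (heq ▸ hasVert_tail he)
  | par x y ihx ihy =>
    have h' := h
    obtain ⟨h1, h2, hs, ht, hd⟩ := h
    by_cases hvy : y.HasVert u w v
    · refine (ihy h2 hvy (fun heq => hvt (heq.trans ht.symm))
        (fun heq => hvs (heq.trans hs.symm))).imp ?_ fun hr => hr.par_right h'
      rintro ⟨a, R, e1, e2, e3⟩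
      refine ⟨a, x.edges + R, by simp [edges, e1], e2, fun e he heq => ?_⟩
      rcases Multiset.mem_add.1 he with he | he
      · exact (hd v (heq ▸ hasVert_tail he) hvy).elim hvs hvt
      · exact e3 e he heq
    · have hvx : x.HasVert u w v := by
        obtain ⟨e, he, h⟩ := hv
        rcases Multiset.mem_add.1 he with he | he
        exacts [⟨e, he, h⟩, absurd ⟨e, he, h⟩ hvy]
      refine (ihx h1 hvx hvt hvs).imp ?_ fun hr => hr.par_left h'
      rintro ⟨a, R, e1, e2, e3⟩
      refine ⟨a, R + y.edges, by simp [edges, e1], e2, fun e he heq => ?_⟩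
      rcases Multiset.mem_add.1 he with he | he
      · exact e3 e he heq
      · exact hvy (heq ▸ hasVert_tail he)

end SPTree
end RecSP

/-! ### Renaming leaves; decompositions of arc series-parallel multidigraphs -/

namespace RecSP

namespace SPTree

variable {E E' V V' α : Type}

/-- Rename the leaves. -/
def map (f : E → E') : SPTree E → SPTree E'
  | leaf e => leaf (f e)
  | ser a b => ser (a.map f) (b.map f)
  | par a b => par (a.map f) (b.map f)

theorem edges_map (f : E → E') (t : SPTree E) : (t.map f).edges = t.edges.map f := by
  induction t with
  | leaf e => rfl
  | ser a b iha ihb => simp [map, edges, iha, ihb]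
  | par a b iha ihb => simp [map, edges, iha, ihb]

variable {u w : E → V} {u' w' : E' → V'} {f : E → E'} {φ : V → V'}

theorem src_map (hu : ∀ e, u' (f e) = φ (u e)) (t : SPTree E) :
    (t.map f).src u' = φ (t.src u) := by
  induction t with
  | leaf e => exact hu e
  | ser a b iha _ => exact iha
  | par a b iha _ => exact iha

theorem tgt_map (hw : ∀ e, w' (f e) = φ (w e)) (t : SPTree E) :
    (t.map f).tgt w' = φ (t.tgt w) := by
  induction t with
  | leaf e => exact hw e
  | ser a b _ ihb => exact ihb
  | par a b iha _ => exact iha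

theorem hasVert_map (hu : ∀ e, u' (f e) = φ (u e)) (hw : ∀ e, w' (f e) = φ (w e))
    (t : SPTree E) (x : V') : (t.map f).HasVert u' w' x ↔ ∃ y, t.HasVert u w y ∧ φ y = x := by
  simp only [HasVert, edges_map, Multiset.mem_map]
  constructor
  · rintro ⟨_, ⟨e, he, rfl⟩, h | h⟩
    · exact ⟨u e, ⟨e, he, .inl rfl⟩, (hu e).symm.trans h⟩
    · exact ⟨w e, ⟨e, he, .inr rfl⟩, (hw e).symm.trans h⟩
  · rintro ⟨y, ⟨e, he, rfl | rfl⟩, rfl⟩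
    · exact ⟨_, ⟨e, he, rfl⟩, .inl (hu e)⟩
    · exact ⟨_, ⟨e, he, rfl⟩, .inr (hw e)⟩

theorem WF.map (hu : ∀ e, u' (f e) = φ (u e)) (hw : ∀ e, w' (f e) = φ (w e))
    (hφ : Function.Injective φ) {t : SPTree E} (h : t.WF u w) : (t.map f).WF u' w' := by
  induction t with
  | leaf e =>
    intro heq
    rw [hu, hw] at heq
    exact h (hφ heq)
  | ser a b iha ihb =>
    obtain ⟨h1, h2, hm, hd⟩ := h
    refine ⟨iha h1, ihb h2, by rw [src_map hu, tgt_map hw, hm], fun x hx hx' => ?_⟩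
    obtain ⟨y, hy, rfl⟩ := (hasVert_map hu hw _ _).1 hx
    obtain ⟨z, hz, hzy⟩ := (hasVert_map hu hw _ _).1 hx'
    obtain rfl := hφ hzy
    rw [tgt_map hw, hd z hy hz]
  | par a b iha ihb =>
    obtain ⟨h1, h2, hs, ht, hd⟩ := h
    refine ⟨iha h1, ihb h2, by rw [src_map hu, src_map hu, hs], by rw [tgt_map hw, tgt_map hw, ht],
      fun x hx hx' => ?_⟩
    obtain ⟨y, hy, rfl⟩ := (hasVert_map hu hw _ _).1 hx
    obtain ⟨z, hz, hzy⟩ := (hasVert_map hu hw _ _).1 hx'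
    obtain rfl := hφ hzy
    rw [tgt_map hw, src_map hu]
    exact (hd z hy hz).imp (congrArg φ) (congrArg φ)

theorem lang_map [DecidableEq α] (L : E' → Set (Finset α)) (t : SPTree E) :
    (t.map f).lang L = t.lang fun e => L (f e) := by
  induction t with
  | leaf e => rfl
  | ser a b iha ihb => simp only [map, lang, iha, ihb]
  | par a b iha ihb => simp only [map, lang, iha, ihb]

/-- Carries path sets along the embedding of `Fin m` into `ℕ`, since the search and the table work
with arc numbers. -/
theorem lang_image {β : Type} [DecidableEq α] [DecidableEq β] (g : α ↪ β)
    (L : E → Set (Finset α)) (t : SPTree E) :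
    t.lang (fun e => (Finset.map g) '' L e) = (Finset.map g) '' t.lang L := by
  induction t with
  | leaf e => rfl
  | ser a b iha ihb =>
    simp only [lang, iha, ihb]
    rw [Set.image_image2, Set.image2_image_left, Set.image2_image_right]
    simp only [Finset.map_union]
  | par a b iha ihb => simp only [lang, iha, ihb, Set.image_union]

end SPTree

theorem IsGluing.nodup {V₁ A₁ V₂ A₂ V A : Type} {G₁ : Multidigraph V₁ A₁}
    {G₂ : Multidigraph V₂ A₂} {R : V₁ → V₂ → Prop} {G : Multidigraph V A} {φ₁ : V₁ → V}
    {φ₂ : V₂ → V} {ψ : A₁ ⊕ A₂ ≃ A} (_ : IsGluing G₁ G₂ R G φ₁ φ₂ ψ) {F₁ : Multiset A₁}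
    {F₂ : Multiset A₂} (h₁ : F₁.Nodup) (h₂ : F₂.Nodup) :
    (F₁.map (fun a => ψ (Sum.inl a)) + F₂.map fun a => ψ (Sum.inr a)).Nodup := by
  refine Multiset.Nodup.add_iff (h₁.map fun a b h => Sum.inl_injective (ψ.injective h))
    (h₂.map fun a b h => Sum.inr_injective (ψ.injective h)) |>.2 ?_
  rw [Multiset.disjoint_left]
  intro x hx hx'
  obtain ⟨a, -, rfl⟩ := Multiset.mem_map.1 hx
  obtain ⟨b, -, hb⟩ := Multiset.mem_map.1 hx'
  simpa using ψ.injective hb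

/-- A series-parallel multidigraph has a decomposition. -/
theorem IsASP.exists_tree {V A : Type} {G : Multidigraph V A} {s t : V} (h : IsASP G s t) :
    ∃ T : SPTree A, T.WF G.tail G.head ∧ T.src G.tail = s ∧ T.tgt G.head = t ∧
      T.edges.Nodup ∧ ∀ a, a ∈ T.edges := by
  induction h with
  | arc G s t e ne nodes arcs tail_eq head_eq =>
    refine ⟨.leaf e, ?_, tail_eq, head_eq, by simp [SPTree.edges], fun a => by
      simp [SPTree.edges, arcs a]⟩
    simp only [SPTree.WF, tail_eq, head_eq]
    exact ne
  | parallel G₁ s₁ t₁ G₂ s₂ t₂ G s t φ₁ φ₂ ψ _ _ glue source_eq sink_eq ih₁ ih₂ =>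
    obtain ⟨T₁, w1, rfl, rfl, n1, a1⟩ := ih₁
    obtain ⟨T₂, w2, rfl, rfl, n2, a2⟩ := ih₂
    have id₁ := (glue.identify (T₁.src G₁.tail) (T₂.src G₂.tail)).2 (.inl ⟨rfl, rfl⟩)
    have id₂ := (glue.identify (T₁.tgt G₁.head) (T₂.tgt G₂.head)).2 (.inr ⟨rfl, rfl⟩)
    have e1 := SPTree.src_map (f := fun a => ψ (Sum.inl a)) glue.tail₁ T₁
    have e2 := SPTree.src_map (f := fun a => ψ (Sum.inr a)) glue.tail₂ T₂
    have e3 := SPTree.tgt_map (f := fun a => ψ (Sum.inl a)) glue.head₁ T₁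
    have e4 := SPTree.tgt_map (f := fun a => ψ (Sum.inr a)) glue.head₂ T₂
    refine ⟨.par (T₁.map fun a => ψ (Sum.inl a)) (T₂.map fun a => ψ (Sum.inr a)),
      ⟨w1.map glue.tail₁ glue.head₁ glue.inj₁, w2.map glue.tail₂ glue.head₂ glue.inj₂, ?_, ?_,
        fun x hx hx' => ?_⟩, ?_, ?_, ?_, fun a => ?_⟩
    · rw [e1, e2, id₁]
    · rw [e3, e4, id₂]
    · obtain ⟨y, hy, rfl⟩ := (SPTree.hasVert_map glue.tail₁ glue.head₁ _ _).1 hx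
      obtain ⟨z, hz, hzy⟩ := (SPTree.hasVert_map glue.tail₂ glue.head₂ _ _).1 hx'
      rw [e1, e3]
      rcases (glue.identify y z).1 hzy.symm with ⟨rfl, -⟩ | ⟨rfl, -⟩
      exacts [.inl rfl, .inr rfl]
    · exact e1.trans source_eq
    · exact e3.trans sink_eq
    · rw [SPTree.edges, SPTree.edges_map, SPTree.edges_map]
      exact glue.nodup n1 n2
    · obtain ⟨a | a, rfl⟩ := ψ.surjective a
      · simp [SPTree.edges, SPTree.edges_map, a1]
      · simp [SPTree.edges, SPTree.edges_map, a2]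
  | series G₁ s₁ t₁ G₂ s₂ t₂ G s t φ₁ φ₂ ψ _ _ glue source_eq sink_eq ih₁ ih₂ =>
    obtain ⟨T₁, w1, rfl, rfl, n1, a1⟩ := ih₁
    obtain ⟨T₂, w2, rfl, rfl, n2, a2⟩ := ih₂
    have id₁ := (glue.identify (T₁.tgt G₁.head) (T₂.src G₂.tail)).2 ⟨rfl, rfl⟩
    have e1 := SPTree.src_map (f := fun a => ψ (Sum.inl a)) glue.tail₁ T₁
    have e2 := SPTree.src_map (f := fun a => ψ (Sum.inr a)) glue.tail₂ T₂
    have e3 := SPTree.tgt_map (f := fun a => ψ (Sum.inl a)) glue.head₁ T₁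
    have e4 := SPTree.tgt_map (f := fun a => ψ (Sum.inr a)) glue.head₂ T₂
    refine ⟨.ser (T₁.map fun a => ψ (Sum.inl a)) (T₂.map fun a => ψ (Sum.inr a)),
      ⟨w1.map glue.tail₁ glue.head₁ glue.inj₁, w2.map glue.tail₂ glue.head₂ glue.inj₂, ?_,
        fun x hx hx' => ?_⟩, ?_, ?_, ?_, fun a => ?_⟩
    · rw [e3, e2, id₁]
    · obtain ⟨y, hy, rfl⟩ := (SPTree.hasVert_map glue.tail₁ glue.head₁ _ _).1 hx
      obtain ⟨z, hz, hzy⟩ := (SPTree.hasVert_map glue.tail₂ glue.head₂ _ _).1 hx'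
      rw [e3, ((glue.identify y z).1 hzy.symm).1]
    · exact e1.trans source_eq
    · exact e4.trans sink_eq
    · rw [SPTree.edges, SPTree.edges_map, SPTree.edges_map]
      exact glue.nodup n1 n2
    · obtain ⟨a | a, rfl⟩ := ψ.surjective a
      · simp [SPTree.edges, SPTree.edges_map, a1]
      · simp [SPTree.edges, SPTree.edges_map, a2]

/-! ### Paths of a series-parallel multidigraph -/

namespace Multidigraph

variable {V A : Type} {G : Multidigraph V A}

theorem IsWalk.append {u v x : V} {l₁ l₂ : List A} (h₁ : G.IsWalk u l₁ v) (h₂ : G.IsWalk v l₂ x) :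
    G.IsWalk u (l₁ ++ l₂) x := by
  induction l₁ generalizing u with
  | nil => obtain rfl : u = v := h₁; exact h₂
  | cons e l ih => exact ⟨h₁.1, ih h₁.2⟩

open SPTree

/-- An edge of `a` could only be taken from the join, but that is the sink of `a`. -/
theorem IsWalk.stays_ser {a b : SPTree A} (h : (ser a b).WF G.tail G.head) {y z : V} {l : List A}
    (hl : G.IsWalk y l z) (hy : b.HasVert G.tail G.head y) (he : ∀ e ∈ l, e ∈ (ser a b).edges) :
    ∀ e ∈ l, e ∈ b.edges := by
  induction l generalizing y with
  | nil => simp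
  | cons e l ih =>
    obtain ⟨rfl, h2⟩ := hl
    have heb : e ∈ b.edges := by
      rcases Multiset.mem_add.1 (he e (by simp)) with h' | h'
      · exact absurd (h.2.2.2 _ (hasVert_tail h') hy) (h.1.tail_ne_tgt h')
      · exact h'
    have := ih h2 (hasVert_head heb) fun e he' => he e (by simp [he'])
    simpa [heb] using this

theorem IsWalk.split_ser {a b : SPTree A} (h : (ser a b).WF G.tail G.head) {y : V} {l : List A}
    (hl : G.IsWalk y l (b.tgt G.head)) (hy : a.HasVert G.tail G.head y)
    (he : ∀ e ∈ l, e ∈ (ser a b).edges) :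
    ∃ l₁ l₂, l = l₁ ++ l₂ ∧ G.IsWalk y l₁ (a.tgt G.head) ∧ (∀ e ∈ l₁, e ∈ a.edges) ∧
      G.IsWalk (a.tgt G.head) l₂ (b.tgt G.head) ∧ ∀ e ∈ l₂, e ∈ b.edges := by
  induction l generalizing y with
  | nil =>
    obtain rfl : y = b.tgt G.head := hl
    have := h.2.2.2 _ hy (hasVert_tgt b)
    exact ⟨[], [], rfl, this, by simp, this.symm, by simp⟩
  | cons e l ih =>
    have hl' := hl
    obtain ⟨rfl, h2⟩ := hl
    rcases Multiset.mem_add.1 (he e (by simp)) with h' | h'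
    · obtain ⟨l₁, l₂, rfl, i1, i2, i3, i4⟩ := ih h2 (hasVert_head h') fun e he' =>
        he e (by simp [he'])
      exact ⟨e :: l₁, l₂, rfl, ⟨rfl, i1⟩, by simpa [h'] using i2, i3, i4⟩
    · have heq := h.2.2.2 _ hy (hasVert_tail h')
      exact ⟨[], e :: l, rfl, heq, by simp, heq ▸ hl', hl'.stays_ser h (hasVert_tail h') he⟩

/-- Away from the source the only node shared with `b` is the common sink, and no edge of `b` leaves
it. -/
theorem IsWalk.stays_par {a b : SPTree A} (ha : a.WF G.tail G.head) (hb : b.WF G.tail G.head)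
    (ht : a.tgt G.head = b.tgt G.head)
    (hd : ∀ x, a.HasVert G.tail G.head x → b.HasVert G.tail G.head x →
      x = a.src G.tail ∨ x = a.tgt G.head) {y z : V} {l : List A}
    (hl : G.IsWalk y l z) (hy : a.HasVert G.tail G.head y) (hne : y ≠ a.src G.tail)
    (he : ∀ e ∈ l, e ∈ a.edges ∨ e ∈ b.edges) : ∀ e ∈ l, e ∈ a.edges := by
  induction l generalizing y with
  | nil => simp
  | cons e l ih =>
    obtain ⟨rfl, h2⟩ := hl
    have heb : e ∈ a.edges := by
      refine (he e (by simp)).resolve_right fun h' => ?_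
      exact hb.tail_ne_tgt h' (((hd _ hy (hasVert_tail h')).resolve_left hne).trans ht)
    have := ih h2 (hasVert_head heb) (ha.head_ne_src heb) fun e he' => he e (by simp [he'])
    simpa [heb] using this

/-- A walk from source to sink crosses the join of a series composition only once, and its first
edge fixes the part of a parallel composition. Hence every such walk, simple or not, has an arc set
of the language. -/
theorem IsWalk.mem_lang [DecidableEq A] {T : SPTree A} (h : T.WF G.tail G.head) {l : List A}
    (hl : G.IsWalk (T.src G.tail) l (T.tgt G.head)) (he : ∀ e ∈ l, e ∈ T.edges) :
    l.toFinset ∈ T.lang fun e => {{e}} := by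
  induction T generalizing l with
  | leaf e =>
    simp only [edges, Multiset.mem_singleton] at he
    match l, hl, he with
    | [], hl, _ => exact absurd hl h
    | [e'], _, he => simp [lang, he e' (by simp)]
    | e₁ :: e₂ :: l, hl, he =>
      obtain rfl := he e₁ (by simp)
      obtain rfl := he e₂ (by simp)
      exact absurd hl.2.1 h
  | ser a b iha ihb =>
    obtain ⟨l₁, l₂, rfl, i1, i2, i3, i4⟩ := hl.split_ser h (hasVert_src a) he
    obtain ⟨h1, h2, hm, hd⟩ := h
    refine ⟨_, iha h1 i1 i2, _, ihb h2 (hm ▸ i3) i4, ?_⟩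
    simp
  | par a b iha ihb =>
    have hne := h.src_ne_tgt
    obtain ⟨h1, h2, hs, ht, hd⟩ := h
    match l, hl, he with
    | [], hl, _ => exact absurd hl hne
    | e :: l, hl, he =>
      have hl' := hl
      have he' : ∀ e ∈ l, e ∈ a.edges ∨ e ∈ b.edges := fun e h' =>
        Multiset.mem_add.1 (he e (by simp [h']))
      obtain ⟨h3, h4⟩ := hl
      rcases Multiset.mem_add.1 (he e (by simp)) with h' | h'
      · have := h4.stays_par h1 h2 ht hd (hasVert_head h') (h1.head_ne_src h') he'
        exact .inl (iha h1 hl' (by simpa [h'] using this))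
      · have := h4.stays_par h2 h1 ht.symm (fun x hx hx' => by rw [← hs, ← ht]; exact hd x hx' hx)
          (hasVert_head h') (h2.head_ne_src h') fun e h => (he' e h).symm
        refine .inr (ihb h2 ?_ (by simpa [h'] using this))
        rw [← hs, ← ht]
        exact hl'

theorem exists_walk_of_mem_lang [DecidableEq A] {T : SPTree A} (h : T.WF G.tail G.head)
    {X : Finset A} (hX : X ∈ T.lang fun e => {{e}}) :
    ∃ l : List A, G.IsWalk (T.src G.tail) l (T.tgt G.head) ∧ (∀ e ∈ l, e ∈ T.edges) ∧
      (T.src G.tail :: l.map G.head).Nodup ∧ l.toFinset = X := by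
  induction T generalizing X with
  | leaf e =>
    have hne : G.tail e ≠ G.head e := h
    refine ⟨[e], ⟨rfl, rfl⟩, by simp [edges], by simpa [src] using hne, ?_⟩
    simpa [lang] using Eq.symm hX
  | ser a b iha ihb =>
    have hsrc := h
    obtain ⟨h1, h2, hm, hd⟩ := h
    obtain ⟨X₁, hX₁, X₂, hX₂, rfl⟩ := hX
    obtain ⟨l₁, a1, a2, a3, rfl⟩ := iha h1 hX₁
    obtain ⟨l₂, b1, b2, b3, rfl⟩ := ihb h2 hX₂
    refine ⟨l₁ ++ l₂, a1.append (hm ▸ b1), fun e he => ?_, ?_, by simp⟩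
    · rcases List.mem_append.1 he with he | he
      · exact Multiset.mem_add.2 (.inl (a2 e he))
      · exact Multiset.mem_add.2 (.inr (b2 e he))
    · rw [List.map_append, ← List.cons_append]
      refine List.Nodup.append a3 (List.nodup_cons.1 b3).2 ?_
      -- A node repeated in the second half would lie in both parts, so it would be the join, which
      -- is the source of `b` and has no entering edge there.
      intro x hx hx'
      obtain ⟨e, he, rfl⟩ := List.mem_map.1 hx'
      have hv : a.HasVert G.tail G.head (G.head e) := by
        rcases List.mem_cons.1 hx with hx | hx
        · rw [hx]; exact hasVert_src a
        · obtain ⟨e', he', h'⟩ := List.mem_map.1 hx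
          exact h' ▸ hasVert_head (a2 e' he')
      exact h2.head_ne_src (b2 e he) ((hd _ hv (hasVert_head (b2 e he))).trans hm)
  | par a b iha ihb =>
    obtain ⟨h1, h2, hs, ht, hd⟩ := h
    rcases hX with hX | hX
    · obtain ⟨l, a1, a2, a3, a4⟩ := iha h1 hX
      exact ⟨l, a1, fun e he => Multiset.mem_add.2 (.inl (a2 e he)), a3, a4⟩
    · obtain ⟨l, a1, a2, a3, a4⟩ := ihb h2 hX
      refine ⟨l, ?_, fun e he => Multiset.mem_add.2 (.inr (a2 e he)), ?_, a4⟩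
      · simp only [src, tgt, hs, ht]
        exact a1
      · simp only [src, hs]
        exact a3

/-- The simple paths of a decomposed multidigraph are given by the decomposition. -/
theorem simplePaths_eq_lang [DecidableEq A] {T : SPTree A} (h : T.WF G.tail G.head)
    (hall : ∀ e, e ∈ T.edges) :
    G.simplePaths (T.src G.tail) (T.tgt G.head) = T.lang fun e => {{e}} := by
  ext X
  constructor
  · rintro ⟨l, hl, -, rfl⟩
    exact hl.mem_lang h fun e _ => hall e
  · intro hX
    obtain ⟨l, h1, -, h2, h3⟩ := exists_walk_of_mem_lang h hX
    exact ⟨l, h1, h2, h3⟩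

end Multidigraph
end RecSP

namespace RecSP

/-! ### Program logic -/

/-- Started in `M`, the program `p` halts after at most `n` steps, in a memory with `Q`. -/
def Runs (p : Prog) (M : Mem) (n : ℕ) (Q : Mem → Prop) : Prop :=
  ∃ T M', Exec p M T M' ∧ T ≤ n ∧ Q M'

namespace Runs

variable {p q : Prog} {M : Mem} {n n₁ n₂ : ℕ} {Q R : Mem → Prop}

theorem mono (h : Runs p M n₁ Q) (hn : n₁ ≤ n) (hQ : ∀ M', Q M' → R M') : Runs p M n R := by
  obtain ⟨T, M', h1, h2, h3⟩ := h
  exact ⟨T, M', h1, h2.trans hn, hQ M' h3⟩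

theorem skip (h : Q M) : Runs .skip M n Q := ⟨0, M, .skip M, Nat.zero_le n, h⟩

theorem instr {i : Instr} (h : Q (i.run M)) : Runs (.instr i) M (n + 1) Q :=
  ⟨1, _, .instr i M, by omega, h⟩

theorem seq (hp : Runs p M n₁ R) (hq : ∀ M', R M' → Runs q M' n₂ Q) (hn : n₁ + n₂ ≤ n) :
    Runs (.seq p q) M n Q := by
  obtain ⟨T, M', h1, h2, h3⟩ := hp
  obtain ⟨T', M'', h4, h5, h6⟩ := hq M' h3
  exact ⟨_, M'', .seq h1 h4, by omega, h6⟩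

theorem ite {b : Test} (hp : b.Holds M → Runs p M n Q) (hq : ¬ b.Holds M → Runs q M n Q) :
    Runs (.ite b p q) M (n + 1) Q := by
  by_cases hb : b.Holds M
  · obtain ⟨T, M', h1, h2, h3⟩ := hp hb
    exact ⟨_, M', .ite_true hb h1, by omega, h3⟩
  · obtain ⟨T, M', h1, h2, h3⟩ := hq hb
    exact ⟨_, M', .ite_false hb h1, by omega, h3⟩

/-- A loop with an invariant whose first argument decreases. -/
theorem loop {b : Test} {c : ℕ} (Inv : ℕ → Mem → Prop)
    (h : ∀ j M, Inv j M → b.Holds M → Runs p M c fun M' => ∃ j' < j, Inv j' M') {j : ℕ}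
    (h0 : Inv j M) :
    Runs (.loop b p) M ((c + 1) * j + 1) fun M' => (∃ j', Inv j' M') ∧ ¬ b.Holds M' := by
  induction j using Nat.strong_induction_on generalizing M with
  | _ j ih =>
    by_cases hb : b.Holds M
    · obtain ⟨T, M', h1, h2, j', hj, h3⟩ := h j M h0 hb
      obtain ⟨T', M'', h4, h5, h6⟩ := ih j' hj h3
      refine ⟨_, M'', .loop_true hb h1 h4, ?_, h6⟩
      have : (c + 1) * (j' + 1) ≤ (c + 1) * j := Nat.mul_le_mul_left _ hj
      have : (c + 1) * (j' + 1) = (c + 1) * j' + (c + 1) := by ring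
      omega
    · exact ⟨1, M, .loop_false hb, by omega, ⟨j, h0⟩, hb⟩

/-- A counting loop. -/
theorem count {x y c : ℕ} (Inv : ℕ → Mem → Prop) {N : ℕ}
    (hx : ∀ i M, Inv i M → M.ireg x = i ∧ M.ireg y = N)
    (h : ∀ i M, i < N → Inv i M → Runs p M c (Inv (i + 1))) {i : ℕ} (hi : i ≤ N)
    (h0 : Inv i M) :
    Runs (.loop (.ilt x y) p) M ((c + 1) * (N - i) + 1) (Inv N) := by
  refine (loop (c := c) (j := N - i) (fun j M => j ≤ N ∧ Inv (N - j) M) ?_ ?_).mono le_rfl ?_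
  · rintro j M ⟨hj, hI⟩ hb
    obtain ⟨e1, e2⟩ := hx _ _ hI
    simp only [Test.Holds, e1, e2] at hb
    refine (h _ M hb hI).mono le_rfl fun M' hM' => ⟨j - 1, by omega, by omega, ?_⟩
    rwa [show N - (j - 1) = N - j + 1 by omega]
  · exact ⟨by omega, by rwa [show N - (N - i) = i by omega]⟩
  · rintro M' ⟨⟨j', hj, hI⟩, hb⟩
    obtain ⟨e1, e2⟩ := hx _ _ hI
    simp only [Test.Holds, e1, e2] at hb
    rwa [show N - j' = N by omega] at hI

end Runs

/-- A sequence of elementary instructions. -/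
def Prog.block : List Instr → Prog
  | [] => .skip
  | i :: l => .seq (.instr i) (.block l)

theorem Runs.block {l : List Instr} {M : Mem} {n : ℕ} {Q : Mem → Prop} (hn : l.length ≤ n)
    (h : Q (l.foldl (fun M i => i.run M) M)) : Runs (.block l) M n Q := by
  induction l generalizing M n with
  | nil => exact .skip h
  | cons i l ih =>
    obtain ⟨k, rfl⟩ : ∃ k, n = k + 1 := ⟨n - 1, by simp at hn; omega⟩
    refine .seq (R := fun M' => M' = i.run M) (.instr (n := 0) rfl) ?_ (n₂ := k) (by omega)
    rintro _ rfl
    exact ih (by simpa using hn) h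

/-! ### What a program may write -/

def Instr.iregs : Instr → List ℕ
  | .iconst x _ | .icopy x _ | .incr x | .decr x | .iload x _ _ => [x]
  | _ => []

def Instr.iarrs : Instr → List ℕ
  | .istore a _ _ => [a]
  | _ => []

def Instr.rregs : Instr → List ℕ
  | .rcopy x _ | .radd x _ _ | .rload x _ _ => [x]
  | _ => []

def Instr.rarrs : Instr → List ℕ
  | .rstore a _ _ => [a]
  | _ => []

/-- All entries that the function `f` lists for the instructions of a program. -/
def Prog.collect (f : Instr → List ℕ) : Prog → List ℕ
  | .skip => []
  | .instr i => f i
  | .seq p q => p.collect f ++ q.collect f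
  | .ite _ p q => p.collect f ++ q.collect f
  | .loop _ p => p.collect f

/-- `M'` agrees with `M` wherever `p` does not write. -/
structure Frame (p : Prog) (M M' : Mem) : Prop where
  ireg : ∀ x, x ∉ p.collect Instr.iregs → M'.ireg x = M.ireg x
  iarr : ∀ x, x ∉ p.collect Instr.iarrs → M'.iarr x = M.iarr x
  rreg : ∀ x, x ∉ p.collect Instr.rregs → M'.rreg x = M.rreg x
  rarr : ∀ x, x ∉ p.collect Instr.rarrs → M'.rarr x = M.rarr x

/-- The cells a program may write are read off its text, so that preservation of a given register or
array becomes a membership question about explicit lists. -/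
theorem Exec.frame {p : Prog} {M M' : Mem} {T : ℕ} (h : Exec p M T M') : Frame p M M' := by
  induction h with
  | skip M => exact ⟨fun _ _ => rfl, fun _ _ => rfl, fun _ _ => rfl, fun _ _ => rfl⟩
  | instr i M =>
    constructor <;> intro x hx <;> cases i <;>
      first
      | rfl
      | (simp only [Prog.collect, Instr.iregs, Instr.iarrs, Instr.rregs, Instr.rarrs,
          List.mem_singleton] at hx
         simp [Instr.run, hx])
  | seq _ _ ih1 ih2 =>
    constructor <;> intro x hx <;> simp only [Prog.collect, List.mem_append, not_or] at hx
    · exact (ih2.1 x hx.2).trans (ih1.1 x hx.1)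
    · exact (ih2.2 x hx.2).trans (ih1.2 x hx.1)
    · exact (ih2.3 x hx.2).trans (ih1.3 x hx.1)
    · exact (ih2.4 x hx.2).trans (ih1.4 x hx.1)
  | ite_true _ _ ih =>
    constructor <;> intro x hx <;> simp only [Prog.collect, List.mem_append, not_or] at hx
    exacts [ih.1 x hx.1, ih.2 x hx.1, ih.3 x hx.1, ih.4 x hx.1]
  | ite_false _ _ ih =>
    constructor <;> intro x hx <;> simp only [Prog.collect, List.mem_append, not_or] at hx
    exacts [ih.1 x hx.2, ih.2 x hx.2, ih.3 x hx.2, ih.4 x hx.2]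
  | loop_true _ _ _ ih1 ih2 =>
    constructor <;> intro x hx
    · exact (ih2.1 x hx).trans (ih1.1 x hx)
    · exact (ih2.2 x hx).trans (ih1.2 x hx)
    · exact (ih2.3 x hx).trans (ih1.3 x hx)
    · exact (ih2.4 x hx).trans (ih1.4 x hx)
  | loop_false _ => exact ⟨fun _ _ => rfl, fun _ _ => rfl, fun _ _ => rfl, fun _ _ => rfl⟩

theorem Runs.frame {p : Prog} {M : Mem} {n : ℕ} {Q : Mem → Prop} (h : Runs p M n Q) :
    Runs p M n fun M' => Q M' ∧ Frame p M M' := by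
  obtain ⟨T, M', h1, h2, h3⟩ := h
  exact ⟨T, M', h1, h2, h3, h1.frame⟩

/-! ### Linked lists -/

/-- The links `nxt` lead from the pointer `p` through the items of the list, where the pointer `0`
is the end and `x + 1` points to `x`. -/
def IsList (nxt : ℕ → ℕ) : ℕ → List ℕ → Prop
  | p, [] => p = 0
  | p, x :: l => p = x + 1 ∧ IsList nxt (nxt x) l

theorem IsList.congr {nxt nxt' : ℕ → ℕ} {p : ℕ} {l : List ℕ} (h : IsList nxt p l)
    (heq : ∀ x ∈ l, nxt' x = nxt x) : IsList nxt' p l := by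
  induction l generalizing p with
  | nil => exact h
  | cons x l ih =>
    refine ⟨h.1, ?_⟩
    rw [heq x (by simp)]
    exact ih h.2 fun y hy => heq y (by simp [hy])

theorem IsList.update {nxt : ℕ → ℕ} {p : ℕ} {l : List ℕ} (h : IsList nxt p l) {x y : ℕ}
    (hx : x ∉ l) : IsList (Function.update nxt x y) p l :=
  h.congr fun _ hz => Function.update_of_ne (ne_of_mem_of_not_mem hz hx) _ _

/-! ### The adjacency lists -/

/-- The integer arrays `4` and `5` become the linked lists of the arcs leaving each node, and the
integer array `6` the indegrees. -/
def adjacency : Prog :=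
  .loop (.ilt 6 1) <| .block
    [.iload 7 0 6, .iload 8 4 7, .istore 5 6 8, .iload 9 1 6, .iload 10 6 9, .incr 10,
      .istore 6 9 10, .incr 6, .istore 4 7 6]

structure AdjInv (tl hd : ℕ → ℕ) (m J : ℕ) (M : Mem) : Prop where
  tail : M.iarr 0 = tl
  head : M.iarr 1 = hd
  pos : M.ireg 6 = J
  bound : M.ireg 1 = m
  out : ∀ v, ∃ l : List ℕ, IsList (M.iarr 5) (M.iarr 4 v) l ∧
    (l : Multiset ℕ) = (Multiset.range J).filter fun e => tl e = v
  deg : ∀ v, M.iarr 6 v = ((Multiset.range J).filter fun e => hd e = v).card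

theorem adjacency_runs {tl hd : ℕ → ℕ} {m : ℕ} {M : Mem} (h : AdjInv tl hd m 0 M) :
    Runs adjacency M (10 * m + 1) (AdjInv tl hd m m) := by
  refine (Runs.count (c := 9) (N := m) (AdjInv tl hd m) (fun i M h => ⟨h.pos, h.bound⟩) ?_
    (Nat.zero_le m) h).mono (by omega) fun _ h => h
  intro J M hJ h
  refine .block (by simp) ?_
  simp only [List.foldl, Instr.run]
  constructor
  · simp [h.tail]
  · simp [h.head]
  · simp [h.pos]
  · simp [h.bound]
  · intro v
    obtain ⟨l, hl, hl'⟩ := h.out v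
    have hJl : J ∉ l := fun hJ => by
      have : J ∈ (l : Multiset ℕ) := hJ
      simp [hl'] at this
    by_cases hv : v = tl J
    · subst hv
      refine ⟨J :: l, ⟨?_, ?_⟩, ?_⟩
      · simp [h.tail, h.pos]
      · simpa [h.tail, h.pos] using hl.update hJl
      · rw [← Multiset.cons_coe, hl', Multiset.range_succ, Multiset.filter_cons]
        simp
    · refine ⟨l, ?_, ?_⟩
      · simpa [h.tail, h.pos, hv] using hl.update hJl
      · rw [hl', Multiset.range_succ, Multiset.filter_cons]
        simp [Ne.symm hv]
  · intro v
    have := h.deg v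
    rw [Multiset.range_succ, Multiset.filter_cons]
    by_cases hv : v = hd J
    · subst hv
      simp [h.head, h.pos, this, add_comm]
    · simp [h.head, h.pos, this, hv, Ne.symm hv]

end RecSP

namespace RecSP

/-! ### The combinatorics of the depth-first decomposition -/

/-- An edge of the current multidigraph: the arc that stands for the part `ex` of the input. -/
structure Edge where
  id : ℕ
  ex : SPTree ℕ
  u : ℕ
  w : ℕ

/-- The edge of an arc of the input. -/
def Edge.arc (tl hd : ℕ → ℕ) (e : ℕ) : Edge := ⟨e, .leaf e, tl e, hd e⟩

/-- The path sets of an edge. -/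
def Edge.paths (e : Edge) : Set (Finset ℕ) := e.ex.lang fun a => {{a}}

/-- The number of edges into `x`. -/
def indeg (F : Multiset Edge) (x : ℕ) : ℕ := F.countP fun e => e.w = x

theorem indeg_cons (e : Edge) (F : Multiset Edge) (x : ℕ) :
    indeg (e ::ₘ F) x = indeg F x + if e.w = x then 1 else 0 := by
  simp only [indeg, Multiset.countP_cons]

theorem indeg_eq_zero {F : Multiset Edge} {x : ℕ} (h : indeg F x = 0) : ∀ e ∈ F, e.w ≠ x :=
  Multiset.countP_eq_zero.1 h

theorem indeg_pos {F : Multiset Edge} {e : Edge} (h : e ∈ F) : 0 < indeg F e.w :=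
  Multiset.countP_pos.2 ⟨e, h, rfl⟩

/-- The edges in the list, from the last to the first, lead from `s` to `v`. -/
def Chain (s : ℕ) : ℕ → List Edge → Prop
  | v, [] => v = s
  | v, d :: l => d.w = v ∧ Chain s d.u l

theorem Chain.mem {s v : ℕ} {l : List Edge} (h : Chain s v l) {x : ℕ} (hx : x ∈ v :: l.map Edge.u) :
    x = s ∨ ∃ d ∈ l, d.w = x := by
  induction l generalizing v with
  | nil =>
    simp only [List.map_nil, List.mem_singleton] at hx
    exact .inl (hx.trans h)
  | cons d l ih =>
    rcases List.mem_cons.1 hx with rfl | hx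
    · exact .inr ⟨d, by simp, h.1⟩
    · exact (ih h.2 hx).imp_right fun ⟨d', h1, h2⟩ => ⟨d', by simp [h1], h2⟩

/-- The state of the decomposition. The edges of the current multidigraph, which has the
decomposition `T`, are: the edge in `K`, which is being inserted; the edges in `U`, which are arcs
not yet explored; the edges in `P`, which are pending at their heads; and the edges in `stk`, which
form the path from `s` to the node `v` under exploration. The pending edges at `x` are listed in
`pl x`, in the order of their tails on the path. -/
structure Search (s t : ℕ) (Φ : Set (Finset ℕ)) (T : SPTree Edge) (K U P : Multiset Edge)
    (stk : List Edge) (v : ℕ) (pl : ℕ → List Edge) : Prop where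
  wf : T.WF Edge.u Edge.w
  src : T.src Edge.u = s
  tgt : T.tgt Edge.w = t
  edges : T.edges = K + (U + P + (stk : Multiset Edge))
  lang : T.lang Edge.paths = Φ
  chain : Chain s v stk
  nodup : (v :: stk.map Edge.u).Nodup
  sink : t ∉ v :: stk.map Edge.u
  stk_deg : ∀ d ∈ stk, indeg T.edges d.w = 1
  pend_deg : ∀ p ∈ P, p.w ≠ t → 2 ≤ indeg T.edges p.w
  pend : ∀ x, P.filter (fun e => e.w = x) = ↑(pl x)
  sub : ∀ x, ((pl x).map Edge.u).Sublist (v :: stk.map Edge.u)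

theorem pend_pop {P : Multiset Edge} {pl : ℕ → List Edge}
    (h : ∀ x, P.filter (fun e => e.w = x) = ↑(pl x)) {x : ℕ} {p : Edge} {l : List Edge}
    (hx : pl x = p :: l) : ∃ P', P = p ::ₘ P' ∧ p.w = x ∧
      ∀ y, P'.filter (fun e => e.w = y) = ↑(Function.update pl x l y) := by
  have hp : p ∈ P.filter fun e => e.w = x := by rw [h, hx]; simp
  rw [Multiset.mem_filter] at hp
  obtain ⟨P', rfl⟩ := Multiset.exists_cons_of_mem hp.1
  refine ⟨P', rfl, hp.2, fun y => ?_⟩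
  have := h y
  by_cases hy : y = x
  · subst hy
    rw [Multiset.filter_cons, if_pos hp.2, hx, ← Multiset.cons_coe, Multiset.singleton_add,
      Multiset.cons_inj_right] at this
    rw [this, Function.update_self]
  · rw [Multiset.filter_cons_of_neg _ (by rw [hp.2]; exact Ne.symm hy)] at this
    rw [this, Function.update_of_ne hy]

theorem pend_push {P : Multiset Edge} {pl : ℕ → List Edge}
    (h : ∀ x, P.filter (fun e => e.w = x) = ↑(pl x)) (c : Edge) (y : ℕ) :
      (c ::ₘ P).filter (fun e => e.w = y) = ↑(Function.update pl c.w (c :: pl c.w) y) := by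
  by_cases hy : y = c.w
  · subst hy
    rw [Multiset.filter_cons, if_pos rfl, h, Function.update_self, Multiset.singleton_add,
      Multiset.cons_coe]
  · rw [Multiset.filter_cons, if_neg (Ne.symm hy), h, Function.update_of_ne hy, zero_add]

namespace Search

variable {s t : ℕ} {Φ : Set (Finset ℕ)} {T : SPTree Edge} {K U P : Multiset Edge}
  {stk : List Edge} {v : ℕ} {pl : ℕ → List Edge}

theorem tail_stk (h : Search s t Φ T K U P stk v pl) {d : Edge} (hd : d ∈ stk) : d.u ≠ v :=
  fun heq => (List.nodup_cons.1 h.nodup).1 (heq ▸ List.mem_map_of_mem hd)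

theorem mem_pend (h : Search s t Φ T 0 U P stk v pl) (hU : U.filter (fun e => e.u = v) = 0)
    {e : Edge} (he : e ∈ T.edges) (hv : e.u = v) : e ∈ P := by
  rw [h.edges, zero_add, Multiset.mem_add, Multiset.mem_add] at he
  rcases he with (he | he) | he
  · exact absurd hv (Multiset.filter_eq_nil.1 hU e he)
  · exact he
  · exact absurd hv (h.tail_stk he)

/-- With no unexplored arc at `v`, all edges leaving `v` are pending, since path edges start
elsewhere. The pending edges at one head have distinct tails, so no two parallel edges leave `v`;
and a pending edge not ending at the sink has a head of indegree at least two. -/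
theorem not_reducible (h : Search s t Φ T 0 U P stk v pl)
    (hU : U.filter (fun e => e.u = v) = 0) : ¬ T.Reducible Edge.u Edge.w v := by
  rintro (⟨a, b, R, h1, h2, h3, h4⟩ | ⟨a, R, h1, h2, h3, h4⟩)
  · have c1 : 2 ≤ T.edges.countP fun e => e.u = v ∧ e.w = a.w := by
      rw [h1, Multiset.countP_cons, Multiset.countP_cons]
      simp [h2, h3, h4]
    have c2 : T.edges.countP (fun e => e.u = v ∧ e.w = a.w) ≤ 1 := by
      rw [h.edges, Multiset.countP_add, Multiset.countP_add, Multiset.countP_add]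
      have e1 : U.countP (fun e => e.u = v ∧ e.w = a.w) = 0 :=
        Multiset.countP_eq_zero.2 fun e he he' => Multiset.filter_eq_nil.1 hU e he he'.1
      have e2 : (stk : Multiset Edge).countP (fun e => e.u = v ∧ e.w = a.w) = 0 :=
        Multiset.countP_eq_zero.2 fun e he he' => h.tail_stk he he'.1
      have e3 : P.countP (fun e => e.u = v ∧ e.w = a.w) ≤ 1 := by
        rw [← Multiset.countP_filter, h.pend, Multiset.coe_countP]
        have := List.nodup_iff_count_le_one.1 ((h.sub a.w).nodup h.nodup) v
        rwa [List.count, List.countP_map] at this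
      rw [e1, e2]
      simpa using e3
    omega
  · have ha : a ∈ P := h.mem_pend hU (by simp [h1]) h2
    have := h.pend_deg a ha (h.tgt ▸ h3)
    rw [h1, indeg_cons, if_pos rfl] at this
    have h0 : indeg R a.w = 0 := Multiset.countP_eq_zero.2 h4
    omega

/-- The exploration of an arc. -/
theorem explore {e : Edge} (h : Search s t Φ T 0 (e ::ₘ U) P stk v pl) :
    Search s t Φ T {e} U P stk v pl :=
  { h with edges := by rw [h.edges]; simp }

/-- The return from the node `v` when all arcs leaving it are explored. -/
theorem pop (h : Search s t Φ T 0 U P stk v pl) (hU : U.filter (fun e => e.u = v) = 0)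
    (hv : v ≠ s) {x : ℕ} {p : Edge} {l : List Edge} (hx : pl x = p :: l) (hp : p.u = v) :
    ∃ d rest P' R, stk = d :: rest ∧ d.w = v ∧ P = p ::ₘ P' ∧ p.w = x ∧
      T.edges = d ::ₘ p ::ₘ R ∧ indeg T.edges v = 1 ∧ ∀ c : Edge, c.u = d.u → c.w = x →
        c.ex = .ser d.ex p.ex → ∃ T', T'.edges = c ::ₘ R ∧
          Search s t Φ T' {c} U P' rest d.u (Function.update pl x l) := by
  obtain ⟨P', rfl, rfl, hP'⟩ := pend_pop h.pend hx
  match stk, h with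
  | [], h => exact absurd h.chain hv
  | d :: rest, h =>
    have hd : d.w = v := h.chain.1
    have heq : T.edges = d ::ₘ p ::ₘ (U + P' + (rest : Multiset Edge)) := by
      rw [h.edges, ← Multiset.cons_coe, zero_add, Multiset.add_cons, Multiset.add_cons,
        Multiset.cons_add]
    have hdeg := h.stk_deg d (by simp)
    rw [hd] at hdeg
    refine ⟨d, rest, P', _, rfl, hd, rfl, rfl, heq, hdeg, fun c hcu hcw hce => ?_⟩
    have hpv : p.w ≠ v := by
      rw [← hp]
      exact (h.wf.tail_ne_head (by simp [heq])).symm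
    have hin : ∀ e ∈ U + P' + (rest : Multiset Edge), e.w ≠ d.w := by
      refine indeg_eq_zero ?_
      rw [heq, indeg_cons, indeg_cons, if_pos hd, if_neg hpv] at hdeg
      rw [hd]
      omega
    -- The structural dichotomy at `v`: reducibility is excluded, so `p` is the only edge leaving
    -- `v`.
    have hout : ∀ e ∈ U + P' + (rest : Multiset Edge), e.u ≠ p.u := by
      have hvs : T.HasVert Edge.u Edge.w v := ⟨d, by simp [heq], .inr hd⟩
      have hvt : v ≠ T.tgt Edge.w := fun h' => h.sink (by simp [← h.tgt, ← h'])
      obtain ⟨a, R, e1, e2, e3⟩ :=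
        (h.wf.reducible_or_unique hvs hvt).resolve_right (h.not_reducible hU)
      have hpa : p = a := by
        have : p ∈ T.edges := by simp [heq]
        rw [e1, Multiset.mem_cons] at this
        exact this.resolve_right fun h' => e3 p h' hp
      subst hpa
      rw [heq, Multiset.cons_swap, Multiset.cons_inj_right] at e1
      intro e he
      rw [hp]
      exact e3 e (e1 ▸ Multiset.mem_cons_of_mem he)
    obtain ⟨T', r1, r2, r3, r4, r5⟩ := h.wf.reduce_series heq (hd.trans hp.symm) hin hout hcu hcw
    have hdeg' : ∀ y, y ≠ v → indeg T'.edges y = indeg T.edges y := by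
      intro y hy
      rw [heq, r4, indeg_cons, indeg_cons, indeg_cons, hcw, hd, if_neg (Ne.symm hy), add_zero]
    refine ⟨T', r4, r1, r2.trans h.src, r3.trans h.tgt, by rw [r4, Multiset.singleton_add], ?_,
      h.chain.2, (List.nodup_cons.1 h.nodup).2, fun h' => h.sink (List.mem_cons_of_mem _ h'),
      fun e he => ?_, fun e he ht => ?_, hP', fun y => ?_⟩
    · rw [r5 _ ?_, h.lang]
      simp only [Edge.paths, hce, SPTree.lang]
    · have := hin e (by simp [he])
      rw [hdeg' _ (hd ▸ this)]
      exact h.stk_deg e (by simp [he])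
    · have := hin e (by simp [he])
      rw [hdeg' _ (hd ▸ this)]
      exact h.pend_deg e (by simp [he]) ht
    · have hs := h.sub y
      by_cases hy : y = p.w
      · subst hy
        rw [Function.update_self]
        rw [hx, List.map_cons, hp] at hs
        exact List.cons_sublist_cons.1 hs
      · rw [Function.update_of_ne hy]
        -- At heads other than that of `p` no pending edge starts at `v`, so removing `v` from the
        -- path keeps the order of tails.
        refine (List.sublist_cons_iff.1 hs).resolve_right ?_
        rintro ⟨r, hr, -⟩
        have hvm : v ∈ (pl y).map Edge.u := by rw [hr]; simp
        obtain ⟨e, he, hev⟩ := List.mem_map.1 hvm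
        have he' : e ∈ (p ::ₘ P').filter fun e => e.w = y := by rw [h.pend]; exact he
        rw [Multiset.mem_filter, Multiset.mem_cons] at he'
        rcases he'.1 with rfl | he''
        · exact hy he'.2.symm
        · exact hout e (by simp [he'']) (hev.trans hp.symm)

/-- The edge to be inserted is merged with a parallel pending edge. -/
theorem merge {c : Edge} (h : Search s t Φ T {c} U P stk v pl) {p : Edge} {l : List Edge}
    (hx : pl c.w = p :: l) (hp : p.u = v) (hc : c.u = v) :
    ∃ P' R, P = p ::ₘ P' ∧ p.w = c.w ∧ T.edges = p ::ₘ c ::ₘ R ∧ (∀ q ∈ l, q.u ≠ v) ∧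
      ∀ c' : Edge, c'.u = v → c'.w = c.w → c'.ex = .par p.ex c.ex → ∃ T', T'.edges = c' ::ₘ R ∧
        Search s t Φ T' {c'} U P' stk v (Function.update pl c.w l) := by
  obtain ⟨P', rfl, hpw, hP'⟩ := pend_pop h.pend hx
  have heq : T.edges = p ::ₘ c ::ₘ (U + P' + (stk : Multiset Edge)) := by
    rw [h.edges, Multiset.add_cons, Multiset.cons_add, Multiset.singleton_add, Multiset.cons_swap]
  have hs := h.sub c.w
  rw [hx, List.map_cons, hp] at hs
  have hs' := List.cons_sublist_cons.1 hs
  refine ⟨P', _, rfl, hpw, heq, fun q hq hqv => ?_, fun c' hcu hcw hce => ?_⟩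
  · exact (List.nodup_cons.1 h.nodup).1 (hqv ▸ hs'.subset (List.mem_map_of_mem hq))
  obtain ⟨T', r1, r2, r3, r4, r5⟩ :=
    h.wf.reduce_parallel heq (hp.trans hc.symm) hpw (hcu.trans hp.symm) (hcw.trans hpw.symm)
  have hdeg : ∀ y, y ≠ c.w → indeg T'.edges y = indeg T.edges y := by
    intro y hy
    rw [heq, r4, indeg_cons, indeg_cons, indeg_cons, hpw, hcw, if_neg (Ne.symm hy)]
  refine ⟨T', r4, r1, r2.trans h.src, r3.trans h.tgt, by rw [r4, Multiset.singleton_add], ?_,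
    h.chain, h.nodup, h.sink, fun d hd => ?_, fun q hq ht => ?_, hP', fun y => ?_⟩
  · rw [r5 _ ?_, h.lang]
    simp only [Edge.paths, hce, SPTree.lang]
  · rw [hdeg, h.stk_deg d hd]
    -- The head of the merged edges has indegree at least two before the merge, so it is not the
    -- head of a path edge.
    intro hdw
    have := h.stk_deg d hd
    rw [hdw, heq, indeg_cons, indeg_cons, if_pos rfl, if_pos hpw] at this
    omega
  · by_cases hqw : q.w = c.w
    · have hq' : q ∈ U + P' + (stk : Multiset Edge) := by simp [hq]
      have := indeg_pos hq'
      rw [r4, indeg_cons, if_pos (hcw.trans hqw.symm)]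
      omega
    · rw [hdeg _ hqw]
      exact h.pend_deg q (by simp [hq]) ht
  · by_cases hy : y = c.w
    · subst hy
      rw [Function.update_self]
      exact hs'.trans (List.sublist_cons_self _ _)
    · rw [Function.update_of_ne hy]
      exact h.sub y

/-- The exploration proceeds to a node with only one incoming edge. -/
theorem push {c : Edge} (h : Search s t Φ T {c} U P stk v pl) (hc : c.u = v) (ht : c.w ≠ t)
    (hdeg : indeg T.edges c.w = 1) :
    Search s t Φ T 0 U P (c :: stk) c.w pl ∧ U.filter (fun e => e.u = c.w) ≠ 0 := by
  have heq : T.edges = c ::ₘ (U + P + (stk : Multiset Edge)) := by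
    rw [h.edges, Multiset.singleton_add]
  -- The head is new to the path: no edge enters `s`, and any other path node already has a path
  -- edge as its only incoming edge.
  have hnot : c.w ∉ v :: stk.map Edge.u := by
    intro hmem
    rcases h.chain.mem hmem with hs | ⟨d, hd, hdw⟩
    · exact h.wf.head_ne_src (e := c) (by simp [heq]) (hs.trans h.src.symm)
    · have hd' : d ∈ U + P + (stk : Multiset Edge) := by simp [hd]
      have := indeg_pos hd'
      rw [heq, indeg_cons, if_pos rfl, ← hdw] at hdeg
      omega
  refine ⟨⟨h.wf, h.src, h.tgt, ?_, h.lang, ⟨rfl, hc ▸ h.chain⟩, ?_, ?_, fun d hd => ?_,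
    h.pend_deg, h.pend, fun y => ?_⟩, fun hU => ?_⟩
  · rw [heq, ← Multiset.cons_coe, zero_add, Multiset.add_cons]
  · rw [List.map_cons, hc]
    exact List.nodup_cons.2 ⟨hnot, h.nodup⟩
  · rw [List.map_cons, hc, List.mem_cons, not_or]
    exact ⟨ht.symm, h.sink⟩
  · rcases List.mem_cons.1 hd with rfl | hd
    exacts [hdeg, h.stk_deg d hd]
  · rw [List.map_cons, hc]
    exact (h.sub y).trans (List.sublist_cons_self _ _)
  -- Some edge leaves the new top, as it is not the sink. Path edges, pending edges and `c` itself
  -- have their tails on the old path, so this edge is unexplored.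
  · have hv : T.HasVert Edge.u Edge.w c.w := ⟨c, by simp [heq], .inr rfl⟩
    have : ∃ e ∈ T.edges, e.u = c.w := by
      rcases h.wf.reducible_or_unique hv (h.tgt ▸ ht) with
        ⟨a, R, e1, e2, -⟩ | ⟨a, b, R, e1, e2, -⟩ | ⟨a, R, e1, e2, -⟩
      all_goals exact ⟨a, by simp [e1], e2⟩
    obtain ⟨e, he, hew⟩ := this
    rw [heq, Multiset.mem_cons, Multiset.mem_add, Multiset.mem_add] at he
    rcases he with rfl | (he | he) | he
    · exact h.wf.tail_ne_head (by simp [heq]) hew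
    · exact Multiset.filter_eq_nil.1 hU e he hew
    · have he' : e ∈ P.filter fun x => x.w = e.w := Multiset.mem_filter.2 ⟨he, rfl⟩
      rw [h.pend] at he'
      exact hnot (hew ▸ (h.sub e.w).subset (List.mem_map_of_mem he'))
    · exact hnot (hew ▸ List.mem_cons_of_mem _ (List.mem_map_of_mem he))

/-- The edge to be inserted becomes a pending edge. -/
theorem wait {c : Edge} (h : Search s t Φ T {c} U P stk v pl) (hc : c.u = v)
    (hdeg : c.w ≠ t → indeg T.edges c.w ≠ 1) (hne : ∀ p l, pl c.w = p :: l → p.u ≠ v) :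
    Search s t Φ T 0 U (c ::ₘ P) stk v (Function.update pl c.w (c :: pl c.w)) := by
  have heq : T.edges = c ::ₘ (U + P + (stk : Multiset Edge)) := by
    rw [h.edges, Multiset.singleton_add]
  refine ⟨h.wf, h.src, h.tgt, ?_, h.lang, h.chain, h.nodup, h.sink, h.stk_deg, fun p hp ht => ?_,
    pend_push h.pend c, fun y => ?_⟩
  · rw [heq, zero_add, Multiset.add_cons, Multiset.cons_add]
  · rcases Multiset.mem_cons.1 hp with rfl | hp
    · have := hdeg ht
      have : 0 < indeg T.edges p.w := indeg_pos (by simp [heq])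
      omega
    · exact h.pend_deg p hp ht
  · by_cases hy : y = c.w
    · subst hy
      rw [Function.update_self, List.map_cons, hc]
      -- The node `v` comes first on the path, so it could only be the tail of the first pending
      -- edge in the list, and `hne` excludes this. For the same reason looking at the first list
      -- item suffices to find a parallel edge.
      refine List.cons_sublist_cons.2 ((List.sublist_cons_iff.1 (h.sub c.w)).resolve_right ?_)
      rintro ⟨r, hr, -⟩
      obtain ⟨p, l, hpl, hp, -⟩ := List.map_eq_cons_iff.1 hr
      exact hne p l hpl hp
    · rw [Function.update_of_ne hy]
      exact h.sub y

/-- When all arcs leaving the source are explored, a single pending edge at the sink is left. -/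
theorem final (h : Search s t Φ T 0 U P stk v pl) (hv : v = s)
    (hU : U.filter (fun e => e.u = v) = 0) : ∃ a, T = .leaf a ∧ pl t = [a] := by
  subst hv
  have hsrc := h.src
  -- The source of anything larger than a single edge is reducible.
  obtain ⟨a, rfl⟩ := h.wf.reducible_src.resolve_right (hsrc.symm ▸ h.not_reducible hU)
  have haP := h.mem_pend hU (Multiset.mem_singleton_self a) hsrc
  have h1 := h.edges
  obtain ⟨P', rfl⟩ := Multiset.exists_cons_of_mem haP
  obtain rfl : P' = 0 := by
    have := congrArg Multiset.card h1
    simp only [SPTree.edges, Multiset.card_singleton, Multiset.card_add, Multiset.card_cons] at this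
    exact Multiset.card_eq_zero.1 (by omega)
  refine ⟨a, rfl, ?_⟩
  have := h.pend t
  rw [Multiset.filter_cons, if_pos (show a.w = t from h.tgt), Multiset.filter_zero,
    add_zero] at this
  exact Multiset.coe_eq_singleton.1 this.symm

end Search
end RecSP

/-! ### The decomposition as numbered nodes, and the search as machine code -/

namespace RecSP

/-- The nodes `0, …, next - 1` of the decomposition. The nodes `e < m` are the arcs, and a later
node `j` joins the earlier nodes `L j` and `R j`, in series if `ty j = 0` and in parallel
otherwise. Each node belongs to at most one later node, and the edges in `F` are those nodes that
belong to no later node. -/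
structure Ops (m next : ℕ) (D : ℕ → SPTree ℕ) (L R ty : ℕ → ℕ) (F : Multiset Edge) : Prop where
  le : m ≤ next
  card : next + F.card = 2 * m
  ids : (F.map Edge.id).Nodup
  lt : ∀ e ∈ F, e.id < next
  ex : ∀ e ∈ F, D e.id = e.ex
  arcs : F.bind (fun e => e.ex.edges) = Multiset.range m
  leaf : ∀ e < m, D e = .leaf e
  node : ∀ j, m ≤ j → j < next → L j < j ∧ R j < j ∧
    D j = if ty j = 0 then .ser (D (L j)) (D (R j)) else .par (D (L j)) (D (R j))
  injL : ∀ i j, m ≤ i → i < next → m ≤ j → j < next → L i = L j → i = j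
  injR : ∀ i j, m ≤ i → i < next → m ≤ j → j < next → R i = R j → i = j
  disj : ∀ i j, m ≤ i → i < next → m ≤ j → j < next → L i ≠ R j
  used : ∀ j, m ≤ j → j < next → ∀ e ∈ F, L j ≠ e.id ∧ R j ≠ e.id
  nodup : ∀ j < next, (D j).edges.Nodup

theorem Ops.init (m : ℕ) (tl hd L R ty : ℕ → ℕ) :
    Ops m m .leaf L R ty ((Multiset.range m).map (Edge.arc tl hd)) := by
  refine ⟨le_rfl, by simp [two_mul], ?_, ?_, ?_, ?_, fun _ _ => rfl, fun j h h' => by omega,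
    fun i j h h' => by omega, fun i j h h' => by omega, fun i j h h' => by omega,
    fun j h h' => by omega, fun j _ => by simp [SPTree.edges]⟩
  · rw [Multiset.map_map]
    simpa [Edge.arc, Function.comp_def] using Multiset.nodup_range m
  · simp [Edge.arc]
  · simp [Edge.arc]
  · rw [Multiset.bind_map]
    exact (Multiset.bind_singleton _ _).trans (Multiset.map_id _)

/-- Two edges become one new node. -/
theorem Ops.combine {m next : ℕ} {D : ℕ → SPTree ℕ} {L R ty : ℕ → ℕ} {F : Multiset Edge}
    {a b c : Edge} (h : Ops m next D L R ty (a ::ₘ b ::ₘ F)) (hc : c.id = next) {y : ℕ}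
    (hex : c.ex = if y = 0 then .ser a.ex b.ex else .par a.ex b.ex) :
    Ops m (next + 1) (Function.update D next c.ex) (Function.update L next a.id)
      (Function.update R next b.id) (Function.update ty next y) (c ::ₘ F) := by
  have ha := h.lt a (by simp)
  have hb := h.lt b (by simp)
  have hids := h.ids
  rw [Multiset.map_cons, Multiset.map_cons, Multiset.nodup_cons, Multiset.nodup_cons] at hids
  obtain ⟨ha', hb', hF⟩ := hids
  have hcard := h.card
  rw [Multiset.card_cons, Multiset.card_cons] at hcard
  have hce : c.ex.edges = a.ex.edges + b.ex.edges := by rw [hex]; split_ifs <;> rfl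
  have hlt : ∀ e ∈ F, e.id < next := fun e he => h.lt e (by simp [he])
  have harcs := h.arcs
  rw [Multiset.cons_bind, Multiset.cons_bind, ← add_assoc, ← hce] at harcs
  have hle := h.le
  refine ⟨by omega, by rw [Multiset.card_cons]; omega, ?_, fun e he => ?_, fun e he => ?_,
    by rw [Multiset.cons_bind, harcs], fun e he => ?_, fun j hj hj' => ?_,
    fun i j hi hi' hj hj' => ?_, fun i j hi hi' hj hj' => ?_, fun i j hi hi' hj hj' => ?_,
    fun j hj hj' e he => ?_, fun j hj => ?_⟩
  · rw [Multiset.map_cons, Multiset.nodup_cons]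
    refine ⟨fun hmem => ?_, hF⟩
    obtain ⟨e, he, hec⟩ := Multiset.mem_map.1 hmem
    have := hlt e he
    omega
  · rcases Multiset.mem_cons.1 he with rfl | he
    · omega
    · have := hlt e he
      omega
  · rcases Multiset.mem_cons.1 he with rfl | he
    · rw [hc, Function.update_self]
    · rw [Function.update_of_ne (hlt e he).ne]
      exact h.ex e (by simp [he])
  · rw [Function.update_of_ne (by omega)]
    exact h.leaf e he
  · rcases Nat.lt_succ_iff_lt_or_eq.1 hj' with hj' | rfl
    · obtain ⟨h1, h2, h3⟩ := h.node j hj hj'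
      simp only [Function.update_apply, if_neg hj'.ne, if_neg (h1.trans hj').ne,
        if_neg (h2.trans hj').ne]
      exact ⟨h1, h2, h3⟩
    · simp only [Function.update_apply, if_true, if_neg ha.ne, if_neg hb.ne]
      refine ⟨ha, hb, ?_⟩
      rw [h.ex a (by simp), h.ex b (by simp), hex]
  · simp only [Function.update_apply]
    have h1 := fun hin => h.used i hi hin a (by simp)
    have h2 := fun hjn => h.used j hj hjn a (by simp)
    split_ifs with hi'' hj''
    · intro _; omega
    · intro heq; exact absurd heq.symm (h2 (by omega)).1
    · intro heq; exact absurd heq (h1 (by omega)).1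
    · exact h.injL i j hi (by omega) hj (by omega)
  · simp only [Function.update_apply]
    have h1 := fun hin => h.used i hi hin b (by simp)
    have h2 := fun hjn => h.used j hj hjn b (by simp)
    split_ifs with hi'' hj''
    · intro _; omega
    · intro heq; exact absurd heq.symm (h2 (by omega)).2
    · intro heq; exact absurd heq (h1 (by omega)).2
    · exact h.injR i j hi (by omega) hj (by omega)
  · simp only [Function.update_apply]
    have h1 := fun hin => h.used i hi hin b (by simp)
    have h2 := fun hjn => h.used j hj hjn a (by simp)
    split_ifs with hi'' hj''
    · exact fun heq => ha' (by simp [heq])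
    · exact fun heq => (h2 (by omega)).2 heq.symm
    · exact (h1 (by omega)).1
    · exact h.disj i j hi (by omega) hj (by omega)
  · simp only [Function.update_apply]
    rcases Multiset.mem_cons.1 he with rfl | he
    · split_ifs with hj''
      · omega
      · have := h.node j hj (by omega)
        omega
    · split_ifs with hj''
      · constructor
        · exact fun heq => ha' (Multiset.mem_cons.2 (.inr (Multiset.mem_map.2 ⟨e, he, heq.symm⟩)))
        · exact fun heq => hb' (Multiset.mem_map.2 ⟨e, he, heq.symm⟩)
      · exact h.used j hj (by omega) e (by simp [he])
  · rcases Nat.lt_succ_iff_lt_or_eq.1 hj with hj | rfl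
    · rw [Function.update_of_ne hj.ne]
      exact h.nodup j hj
    · rw [Function.update_self]
      -- The expressions of the current edges partition the arc numbers, so no arc occurs in both
      -- joined parts.
      have : (c.ex.edges + F.bind fun e => e.ex.edges).Nodup := harcs ▸ Multiset.nodup_range m
      exact (Multiset.nodup_add.1 this).1

/-! ### The machine code of the decomposition -/

/-- Register `22` holds the edge to be inserted, register `23` its head. -/
def arrive : Prog :=
  .seq (.block [.iload 7 7 23]) <|
  .seq (.ite (.ine 7 5)
    (.seq (.block [.decr 7, .iload 8 9 7]) <|
      .ite (.ieq 8 20)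
        (.block [.iload 9 8 7, .istore 7 23 9, .istore 13 21 7, .istore 14 21 22, .istore 15 21 24,
          .icopy 22 21, .incr 21, .iload 9 6 23, .decr 9, .istore 6 23 9])
        .skip)
    .skip) <|
  .seq (.block [.iload 8 6 23]) <|
  .ite (.ine 23 4)
    (.ite (.ieq 8 24)
      (.block [.istore 10 23 20, .istore 11 23 22, .icopy 20 23])
      (.block [.istore 9 22 20, .iload 9 7 23, .istore 8 22 9, .icopy 9 22, .incr 9,
        .istore 7 23 9, .istore 12 20 23]))
    (.block [.istore 9 22 20, .iload 9 7 23, .istore 8 22 9, .icopy 9 22, .incr 9,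
      .istore 7 23 9, .istore 12 20 23])

/-- The depth-first search. Register `20` holds the node under exploration, and register `21` the
number of nodes of the decomposition. -/
def explorePaths : Prog :=
  .loop (.ine 20 0) <|
    .seq (.block [.iload 6 4 20]) <|
    .ite (.ine 6 5)
      (.seq (.block [.decr 6, .icopy 22 6, .iload 23 1 22, .iload 7 5 22, .istore 4 20 7]) arrive)
      (.ite (.ieq 20 3) (.block [.icopy 20 0])
        (.seq (.block [.iload 23 12 20, .iload 7 7 23, .decr 7, .iload 8 8 7, .istore 7 23 8,
          .iload 9 11 20, .istore 13 21 9, .istore 14 21 7, .istore 15 21 5, .icopy 22 21,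
          .incr 21, .iload 20 10 20]) arrive))

/-- The integer arrays `13`, `14`, `15` become the decomposition. -/
def decompose : Prog :=
  .seq (.block [.icopy 20 3, .icopy 21 1, .iconst 24 1]) explorePaths

structure DfsParams where
  n : ℕ
  m : ℕ
  s : ℕ
  t : ℕ
  tl : ℕ → ℕ
  hd : ℕ → ℕ
  Φ : Set (Finset ℕ)

/-- Data of the correctness argument that the memory only represents: besides the search state, `ul
x` lists the unexplored arcs leaving `x`, `next` counts the nodes of the decomposition made so far,
and `D` gives their expressions. -/
structure DfsGhost where
  T : SPTree Edge
  U : Multiset Edge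
  P : Multiset Edge
  stk : List Edge
  v : ℕ
  pl : ℕ → List Edge
  ul : ℕ → List ℕ
  next : ℕ
  D : ℕ → SPTree ℕ

/-- The memory represents the state of the decomposition. -/
structure DfsState (p : DfsParams) (K : Multiset Edge) (g : DfsGhost) (M : Mem) : Prop where
  search : Search p.s p.t p.Φ g.T K g.U g.P g.stk g.v g.pl
  ops : Ops p.m g.next g.D (M.iarr 13) (M.iarr 14) (M.iarr 15) g.T.edges
  lt : ∀ e ∈ g.T.edges, e.u < p.n ∧ e.w < p.n
  head : M.iarr 1 = p.hd
  arcs : ∀ x, IsList (M.iarr 5) (M.iarr 4 x) (g.ul x)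
  out : ∀ x, g.U.filter (fun e => e.u = x) = ↑((g.ul x).map (Edge.arc p.tl p.hd))
  pend : ∀ x, IsList (M.iarr 8) (M.iarr 7 x) ((g.pl x).map Edge.id)
  tail : ∀ q ∈ g.P, M.iarr 9 q.id = q.u
  parent : ∀ d ∈ g.stk, M.iarr 10 d.w = d.u
  din : ∀ d ∈ g.stk, M.iarr 11 d.w = d.id
  -- Restricted to nodes with an incoming edge: a series contraction removes a node without clearing
  -- its stored indegree.
  deg : ∀ x, indeg g.T.edges x ≠ 0 → M.iarr 6 x = indeg g.T.edges x
  r0 : M.ireg 0 = p.n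
  r1 : M.ireg 1 = p.m
  r3 : M.ireg 3 = p.s
  r4 : M.ireg 4 = p.t
  r5 : M.ireg 5 = 0
  r20 : M.ireg 20 = g.v
  r21 : M.ireg 21 = g.next
  r24 : M.ireg 24 = 1

/-- The edge `c` is to be inserted. -/
structure DfsCarry (p : DfsParams) (c : Edge) (g : DfsGhost) (M : Mem) : Prop
    extends DfsState p {c} g M where
  tail_eq : c.u = g.v
  r22 : M.ireg 22 = c.id
  r23 : M.ireg 23 = c.w

/-- Between two rounds, an unexplored arc leaves the top of the path, or the node in the integer
array `12` has a pending edge from there. -/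
structure DfsReady (p : DfsParams) (g : DfsGhost) (M : Mem) : Prop
    extends DfsState p 0 g M where
  ready : g.U.filter (fun e => e.u = g.v) ≠ 0 ∨ ∃ q l, g.pl (M.iarr 12 g.v) = q :: l ∧ q.u = g.v

theorem DfsCarry.edges_eq {p : DfsParams} {c : Edge} {g : DfsGhost} {M : Mem}
    (h : DfsCarry p c g M) : g.T.edges = c ::ₘ (g.U + g.P + (g.stk : Multiset Edge)) := by
  rw [h.search.edges, Multiset.singleton_add]

theorem DfsCarry.id_ne {p : DfsParams} {c : Edge} {g : DfsGhost} {M : Mem}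
    (h : DfsCarry p c g M) {q : Edge} (hq : q ∈ g.P) : q.id ≠ c.id := by
  have := h.ops.ids
  rw [h.edges_eq, Multiset.map_cons, Multiset.nodup_cons] at this
  exact fun heq => this.1 (Multiset.mem_map.2 ⟨q, by simp [hq], heq⟩)

theorem DfsState.mem_pl {p : DfsParams} {K : Multiset Edge} {g : DfsGhost} {M : Mem}
    (h : DfsState p K g M) {x : ℕ} {q : Edge} (hq : q ∈ g.pl x) : q ∈ g.P ∧ q.w = x := by
  have : q ∈ (g.pl x : Multiset Edge) := hq
  rw [← h.search.pend, Multiset.mem_filter] at this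
  exact this

theorem DfsCarry.wait {p : DfsParams} {c : Edge} {g : DfsGhost} {M : Mem}
    (h : DfsCarry p c g M) (hdeg : c.w ≠ p.t → indeg g.T.edges c.w ≠ 1)
    (hne : ∀ q l, g.pl c.w = q :: l → q.u ≠ g.v) :
    Runs (.block [.istore 9 22 20, .iload 9 7 23, .istore 8 22 9, .icopy 9 22, .incr 9,
      .istore 7 23 9, .istore 12 20 23]) M 7 fun M' => ∃ g', DfsReady p g' M' ∧ g'.U = g.U ∧
        g'.T.edges.card ≤ g.T.edges.card := by
  refine .block (by simp) ?_
  simp only [List.foldl, Instr.run]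
  refine ⟨{ g with P := c ::ₘ g.P, pl := Function.update g.pl c.w (c :: g.pl c.w) }, ?_, rfl,
    le_rfl⟩
  have hs := h.search.wait h.tail_eq hdeg hne
  have h22 := h.r22
  have h23 := h.r23
  have h20 := h.r20
  constructor
  · constructor
    · exact hs
    · simpa using h.ops
    · exact h.lt
    · simpa using h.head
    · simpa using h.arcs
    · exact h.out
    · intro x
      have hmem : ∀ x, c.id ∉ (g.pl x).map Edge.id := by
        intro x hx
        obtain ⟨q, hq, hqc⟩ := List.mem_map.1 hx
        exact h.id_ne (h.mem_pl hq).1 hqc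
      by_cases hx : x = c.w
      · subst hx
        simp only [Function.update_self, List.map_cons, h22, h23, h20]
        refine ⟨?_, ?_⟩
        · simp [h22, h23]
        · simpa [h22, h23] using (h.pend c.w).update (hmem c.w)
      · simpa [h22, h23, h20, hx] using (h.pend x).update (hmem x)
    · intro q hq
      rcases Multiset.mem_cons.1 hq with rfl | hq
      · simp [h22, h20, h.tail_eq]
      · simp [h22, h.id_ne hq, h.tail q hq]
    · simpa using h.parent
    · simpa using h.din
    · simpa using h.deg
    · simpa using h.r0
    · simpa using h.r1
    · simpa using h.r3
    · simpa using h.r4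
    · simpa using h.r5
    · simpa using h.r20
    · simpa using h.r21
    · simpa using h.r24
  · right
    simp [h20, h23, h.tail_eq]

theorem DfsCarry.push {p : DfsParams} {c : Edge} {g : DfsGhost} {M : Mem}
    (h : DfsCarry p c g M) (ht : c.w ≠ p.t) (hdeg : indeg g.T.edges c.w = 1) :
    Runs (.block [.istore 10 23 20, .istore 11 23 22, .icopy 20 23]) M 7 fun M' =>
      ∃ g', DfsReady p g' M' ∧ g'.U = g.U ∧ g'.T.edges.card ≤ g.T.edges.card := by
  refine .block (by simp) ?_
  simp only [List.foldl, Instr.run]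
  refine ⟨{ g with stk := c :: g.stk, v := c.w }, ?_, rfl, le_rfl⟩
  obtain ⟨hs, hU⟩ := h.search.push h.tail_eq ht hdeg
  have h22 := h.r22
  have h23 := h.r23
  have h20 := h.r20
  have hw : ∀ d ∈ g.stk, d.w ≠ c.w := by
    intro d hd
    refine indeg_eq_zero (F := g.U + g.P + (g.stk : Multiset Edge)) ?_ d (by simp [hd])
    rw [h.edges_eq, indeg_cons, if_pos rfl] at hdeg
    omega
  refine ⟨?_, .inl hU⟩
  constructor
  · exact hs
  · simpa using h.ops
  · exact h.lt
  · simpa using h.head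
  · simpa using h.arcs
  · exact h.out
  · simpa using h.pend
  · simpa using h.tail
  · intro d hd
    rcases List.mem_cons.1 hd with rfl | hd
    · simp [h23, h20, h.tail_eq]
    · simp [h23, hw d hd, h.parent d hd]
  · intro d hd
    rcases List.mem_cons.1 hd with rfl | hd
    · simp [h23, h22]
    · simp [h23, hw d hd, h.din d hd]
  · simpa using h.deg
  · simpa using h.r0
  · simpa using h.r1
  · simpa using h.r3
  · simpa using h.r4
  · simpa using h.r5
  · simpa using h.r23
  · simpa using h.r21
  · simpa using h.r24

theorem DfsCarry.merge {p : DfsParams} {c : Edge} {g : DfsGhost} {M : Mem}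
    (h : DfsCarry p c g M) {q : Edge} {l : List Edge} (hq : g.pl c.w = q :: l) (hqv : q.u = g.v)
    (h7 : M.ireg 7 = q.id) :
    Runs (.block [.iload 9 8 7, .istore 7 23 9, .istore 13 21 7, .istore 14 21 22, .istore 15 21 24,
          .icopy 22 21, .incr 21, .iload 9 6 23, .decr 9, .istore 6 23 9]) M 10 fun M' =>
      ∃ c' g', DfsCarry p c' g' M' ∧ g'.U = g.U ∧ g'.T.edges.card ≤ g.T.edges.card ∧
        ∀ q l, g'.pl c'.w = q :: l → q.u ≠ g'.v := by
  refine .block (by simp) ?_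
  simp only [List.foldl, Instr.run]
  obtain ⟨P', R, hP, hqw, hE, hl, hT⟩ := h.search.merge hq hqv h.tail_eq
  obtain ⟨T', hE', hs⟩ := hT ⟨g.next, .par q.ex c.ex, g.v, c.w⟩ rfl rfl rfl
  refine ⟨⟨g.next, .par q.ex c.ex, g.v, c.w⟩,
    { g with
      T := T', P := P', pl := Function.update g.pl c.w l, next := g.next + 1,
      D := Function.update g.D g.next (.par q.ex c.ex) }, ?_, rfl, by simp [hE, hE'], ?_⟩
  swap
  · intro q' l' hql
    simp only [Function.update_self] at hql
    exact hl q' (by simp [hql])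
  have h22 := h.r22
  have h23 := h.r23
  have h20 := h.r20
  have h21 := h.r21
  have h24 := h.r24
  refine ⟨?_, rfl, by simpa using h21, by simpa using h23⟩
  constructor
  · exact hs
  · have := (hE ▸ h.ops).combine (c := ⟨g.next, .par q.ex c.ex, g.v, c.w⟩) (y := 1) rfl rfl
    rw [← hE'] at this
    simpa [h22, h21, h24, h7] using this
  · intro e he
    simp only [hE', Multiset.mem_cons] at he
    rcases he with rfl | he
    · have := h.lt c (by simp [hE])
      exact ⟨h.tail_eq ▸ this.1, this.2⟩
    · exact h.lt e (by simp [hE, he])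
  · simpa using h.head
  · simpa using h.arcs
  · exact h.out
  · intro x
    by_cases hx : x = c.w
    · subst hx
      have := h.pend c.w
      rw [hq] at this
      simpa [h23, h7] using this.2
    · simpa [h23, hx] using h.pend x
  · intro q' hq'
    simpa using h.tail q' (by simp [hP, hq'])
  · simpa using h.parent
  · simpa using h.din
  · intro x hx
    have := h.deg x
    simp only [hE, hE', indeg_cons, hqw] at hx this ⊢
    by_cases hxw : x = c.w
    · subst hxw
      simp [h23, this]
    · simp only [h23, Function.update_apply]
      simp [hxw, Ne.symm hxw] at hx this ⊢
      exact this hx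
  · simpa using h.r0
  · simpa using h.r1
  · simpa using h.r3
  · simpa using h.r4
  · simpa using h.r5
  · simpa using h.r20
  · simpa using h.r21
  · simpa using h.r24

/-- Registers 6 to 9 are scratch registers that represent no part of the state. -/
theorem DfsState.congr {p : DfsParams} {K : Multiset Edge} {g : DfsGhost} {M M' : Mem}
    (h : DfsState p K g M) (hi : M'.iarr = M.iarr)
    (hr : ∀ x, x ∉ [6, 7, 8, 9] → M'.ireg x = M.ireg x) : DfsState p K g M' := by
  obtain ⟨h1, h2, h3, h4, h5, h6, h7, h8, h9, h10, h11, h12, h13, h14, h15, h16, h17, h18, h19⟩ := h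
  constructor <;> first | (rw [hr _ (by decide)]; assumption) | (rw [hi]; assumption) | assumption

theorem DfsCarry.congr {p : DfsParams} {c : Edge} {g : DfsGhost} {M M' : Mem}
    (h : DfsCarry p c g M) (hi : M'.iarr = M.iarr)
    (hr : ∀ x, x ∉ [6, 7, 8, 9] → M'.ireg x = M.ireg x) : DfsCarry p c g M' :=
  ⟨h.toDfsState.congr hi hr, h.tail_eq, (hr _ (by decide)).trans h.r22,
    (hr _ (by decide)).trans h.r23⟩

/-- One merge is enough: the pending edges at this head had distinct tails, so after a merge none of
those left starts at the current node. This makes an insertion a constant number of steps. -/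
theorem DfsCarry.arrive {p : DfsParams} {c : Edge} {g : DfsGhost} {M : Mem}
    (h : DfsCarry p c g M) : Runs arrive M 30 fun M' =>
      ∃ g', DfsReady p g' M' ∧ g'.U = g.U ∧ g'.T.edges.card ≤ g.T.edges.card := by
  refine .seq (n₁ := 1) (n₂ := 29)
    (R := fun M' => DfsCarry p c g M' ∧ M'.ireg 7 = M'.iarr 7 c.w) ?_ ?_ le_rfl
  · refine .block (by simp) ?_
    simp only [List.foldl, Instr.run]
    refine ⟨h.congr rfl fun x hx => ?_, by simp [h.r23]⟩
    simp only [List.mem_cons, not_or] at hx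
    simp [hx]
  clear h M
  rintro M ⟨h, h7⟩
  refine .seq (n₁ := 14) (n₂ := 15)
    (R := fun M' => ∃ c' g', DfsCarry p c' g' M' ∧ g'.U = g.U ∧
      g'.T.edges.card ≤ g.T.edges.card ∧ ∀ q l, g'.pl c'.w = q :: l → q.u ≠ g'.v) ?_ ?_ le_rfl
  · have hpend := h.pend c.w
    rw [← h7] at hpend
    refine .ite (n := 13) (fun hb => ?_) fun hb => .skip ⟨c, g, h, rfl, le_rfl, fun q l hql => ?_⟩
    · simp only [Test.Holds, h.r5] at hb
      match hql : g.pl c.w with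
      | [] =>
        rw [hql] at hpend
        exact absurd hpend hb
      | q :: l =>
        rw [hql] at hpend
        have h7' : M.ireg 7 = q.id + 1 := hpend.1
        have hqP : q ∈ g.P := (h.mem_pl (x := c.w) (by simp [hql])).1
        refine .seq (n₁ := 2) (n₂ := 11)
          (R := fun M' => DfsCarry p c g M' ∧ M'.ireg 7 = q.id ∧ M'.ireg 8 = q.u) ?_ ?_ le_rfl
        · refine .block (by simp) ?_
          simp only [List.foldl, Instr.run]
          refine ⟨h.congr rfl fun x hx => ?_, by simp [h7'], by simp [h7', h.tail q hqP]⟩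
          simp only [List.mem_cons, not_or] at hx
          simp [hx]
        rintro M' ⟨h', h7'', h8⟩
        refine .ite (n := 10) (fun hb => ?_) fun hb =>
          .skip ⟨c, g, h', rfl, le_rfl, fun q' l' hql' => ?_⟩
        · simp only [Test.Holds, h8, h'.r20] at hb
          exact h'.merge hql hb h7''
        · simp only [Test.Holds, h8, h'.r20] at hb
          rw [hql, List.cons.injEq] at hql'
          exact hql'.1 ▸ hb
    · simp only [Test.Holds, h.r5, not_not] at hb
      rw [hql, hb] at hpend
      exact absurd hpend.1.symm (Nat.succ_ne_zero _)
  rintro M' ⟨c', g', h', hU, hcard, hne⟩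
  refine .seq (n₁ := 1) (n₂ := 9)
    (R := fun M'' => DfsCarry p c' g' M'' ∧ M''.ireg 8 = M''.iarr 6 c'.w) ?_ ?_ (by omega)
  · refine .block (by simp) ?_
    simp only [List.foldl, Instr.run]
    refine ⟨h'.congr rfl fun x hx => ?_, by simp [h'.r23]⟩
    simp only [List.mem_cons, not_or] at hx
    simp [hx]
  rintro M'' ⟨h'', h8⟩
  have hfin : ∀ M, (∃ g'', DfsReady p g'' M ∧ g''.U = g'.U ∧
      g''.T.edges.card ≤ g'.T.edges.card) → ∃ g', DfsReady p g' M ∧ g'.U = g.U ∧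
      g'.T.edges.card ≤ g.T.edges.card := by
    rintro M ⟨g'', e1, e2, e3⟩
    exact ⟨g'', e1, e2.trans hU, e3.trans hcard⟩
  have hdeg : M''.ireg 8 = indeg g'.T.edges c'.w := by
    rw [h8]
    refine h''.deg _ (indeg_pos ?_).ne'
    simp [h''.edges_eq]
  refine .ite (n := 8) (fun hb => .ite (n := 7) (fun hb' => ?_) fun hb' => ?_) fun hb => ?_
  · simp only [Test.Holds, h''.r23, h''.r4, hdeg, h''.r24] at hb hb'
    exact (h''.push hb hb').mono le_rfl hfin
  · simp only [Test.Holds, h''.r23, h''.r4, hdeg, h''.r24] at hb hb'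
    exact (h''.wait (fun _ => hb') hne).mono le_rfl hfin
  · simp only [Test.Holds, h''.r23, h''.r4, not_not] at hb
    exact (h''.wait (fun hc => absurd hb hc) hne).mono (by omega) hfin

/-- The node `root` of the decomposition stands for the whole input. -/
structure Decomposed (p : DfsParams) (next root : ℕ) (D : ℕ → SPTree ℕ) (M : Mem) : Prop where
  ops : Ops p.m next D (M.iarr 13) (M.iarr 14) (M.iarr 15)
    {⟨root, D root, p.s, p.t⟩}
  paths : (D root).lang (fun a => {{a}}) = p.Φ
  top : M.iarr 7 p.t = root + 1
  r4 : M.ireg 4 = p.t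
  r21 : M.ireg 21 = next
  r24 : M.ireg 24 = 1

theorem DfsReady.explore {p : DfsParams} {g : DfsGhost} {M : Mem} (h : DfsReady p g M)
    (h6 : M.ireg 6 = M.iarr 4 g.v) (hne : M.ireg 6 ≠ 0) :
    Runs (.block [.decr 6, .icopy 22 6, .iload 23 1 22, .iload 7 5 22, .istore 4 20 7]) M 5
      fun M' => ∃ c g', DfsCarry p c g' M' ∧ g'.U.card < g.U.card ∧ g'.T = g.T := by
  have harcs := h.arcs g.v
  rw [← h6] at harcs
  match hul : g.ul g.v with
  | [] =>
    rw [hul] at harcs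
    exact absurd harcs hne
  | e :: l =>
    rw [hul] at harcs
    have h6' : M.ireg 6 = e + 1 := harcs.1
    have hout := h.out g.v
    have he : Edge.arc p.tl p.hd e ∈ g.U.filter fun e => e.u = g.v := by rw [hout, hul]; simp
    rw [Multiset.mem_filter] at he
    obtain ⟨U', hU'⟩ := Multiset.exists_cons_of_mem he.1
    refine .block (by simp) ?_
    simp only [List.foldl, Instr.run]
    refine ⟨Edge.arc p.tl p.hd e, { g with U := U', ul := Function.update g.ul g.v l }, ?_,
      by simp [hU'], rfl⟩
    have h20 := h.r20
    refine ⟨?_, he.2, by simp [h6', Edge.arc], by simp [h6', h.head, Edge.arc]⟩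
    constructor
    · exact (hU' ▸ h.search).explore
    · simpa using h.ops
    · exact h.lt
    · simpa using h.head
    · intro x
      by_cases hx : x = g.v
      · subst hx
        simpa [h20, h6'] using harcs.2
      · simpa [h20, hx] using h.arcs x
    · intro x
      have := h.out x
      rw [hU', Multiset.filter_cons] at this
      by_cases hx : x = g.v
      · subst hx
        rw [if_pos he.2, hul, List.map_cons, ← Multiset.cons_coe, Multiset.singleton_add,
          Multiset.cons_inj_right] at this
        simpa using this
      · rw [if_neg (he.2 ▸ Ne.symm hx), zero_add] at this
        simpa [hx] using this
    · simpa using h.pend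
    · simpa using h.tail
    · simpa using h.parent
    · simpa using h.din
    · simpa using h.deg
    · simpa using h.r0
    · simpa using h.r1
    · simpa using h.r3
    · simpa using h.r4
    · simpa using h.r5
    · simpa using h.r20
    · simpa using h.r21
    · simpa using h.r24

/-- Array 12 tells at which head an edge from the current node is first in the list, and arrays 10
and 11 give the tail and the number of the path edge into this node; no search is needed. -/
theorem DfsReady.pop {p : DfsParams} {g : DfsGhost} {M : Mem} (h : DfsReady p g M)
    (hU : g.U.filter (fun e => e.u = g.v) = 0) (hv : g.v ≠ p.s) :
    Runs (.block [.iload 23 12 20, .iload 7 7 23, .decr 7, .iload 8 8 7, .istore 7 23 8,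
          .iload 9 11 20, .istore 13 21 9, .istore 14 21 7, .istore 15 21 5, .icopy 22 21,
          .incr 21, .iload 20 10 20]) M 12
      fun M' => ∃ c g', DfsCarry p c g' M' ∧ g'.U = g.U ∧
        g'.T.edges.card < g.T.edges.card := by
  obtain ⟨q, l, hql, hqv⟩ := h.ready.resolve_left (not_not.2 hU)
  obtain ⟨d, rest, P', R, hstk, hdw, hP, hqw, hE, hdeg, hT⟩ := h.search.pop hU hv hql hqv
  obtain ⟨T', hE', hs⟩ := hT ⟨g.next, .ser d.ex q.ex, d.u, M.iarr 12 g.v⟩ rfl rfl rfl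
  refine .block (by simp) ?_
  simp only [List.foldl, Instr.run]
  refine ⟨⟨g.next, .ser d.ex q.ex, d.u, M.iarr 12 g.v⟩,
    { g with
      T := T', P := P', stk := rest, v := d.u, pl := Function.update g.pl (M.iarr 12 g.v) l,
      next := g.next + 1, D := Function.update g.D g.next (.ser d.ex q.ex) }, ?_, rfl,
      by simp [hE, hE']⟩
  have h20 := h.r20
  have h21 := h.r21
  have h5 := h.r5
  have hpend := h.pend (M.iarr 12 g.v)
  rw [hql] at hpend
  have htop : M.iarr 7 (M.iarr 12 g.v) = q.id + 1 := hpend.1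
  have hdin := h.din d (by simp [hstk])
  have hpar := h.parent d (by simp [hstk])
  rw [hdw] at hdin hpar
  refine ⟨?_, rfl, by simp [h21], by simp [h20]⟩
  constructor
  · exact hs
  · have := (hE ▸ h.ops).combine (c := ⟨g.next, .ser d.ex q.ex, d.u, M.iarr 12 g.v⟩) (y := 0)
      rfl rfl
    rw [← hE'] at this
    simpa [h20, h21, htop, hdin, h5] using this
  · intro e he
    simp only [hE', Multiset.mem_cons] at he
    rcases he with rfl | he
    · exact ⟨(h.lt d (by simp [hE])).1, hqw ▸ (h.lt q (by simp [hE])).2⟩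
    · exact h.lt e (by simp [hE, he])
  · simpa using h.head
  · simpa using h.arcs
  · exact h.out
  · intro x
    by_cases hx : x = M.iarr 12 g.v
    · subst hx
      simpa [h20, htop] using hpend.2
    · simpa [h20, hx] using h.pend x
  · intro q' hq'
    simpa using h.tail q' (by simp [hP, hq'])
  · intro d' hd'
    simpa using h.parent d' (by simp [hstk, hd'])
  · intro d' hd'
    simpa using h.din d' (by simp [hstk, hd'])
  · intro x hx
    have := h.deg x
    simp only [hE, hE', indeg_cons, hqw, hdw] at hx this hdeg ⊢
    by_cases hxv : g.v = x
    · subst hxv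
      simp only [if_true] at hdeg
      omega
    · simp only [hxv, if_false, add_zero] at this
      simpa using this hx
  · simpa using h.r0
  · simpa using h.r1
  · simpa using h.r3
  · simpa using h.r4
  · simpa using h.r5
  · simpa [h20] using hpar
  · simpa using h.r21
  · simpa using h.r24

theorem DfsReady.final {p : DfsParams} {g : DfsGhost} {M : Mem} (h : DfsReady p g M)
    (hU : g.U.filter (fun e => e.u = g.v) = 0) (hv : g.v = p.s) :
    ∃ root, Decomposed p g.next root g.D M := by
  obtain ⟨a, hT, hpl⟩ := h.search.final hv hU
  have hex : g.D a.id = a.ex := h.ops.ex a (by simp [hT, SPTree.edges])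
  have hsrc := h.search.src
  have htgt := h.search.tgt
  rw [hT] at hsrc htgt
  have hlang := h.search.lang
  rw [hT] at hlang
  refine ⟨a.id, ?_, ?_, ?_, h.r4, h.r21, h.r24⟩
  · have := h.ops
    rw [hT] at this
    rw [hex, ← hsrc, ← htgt]
    exact this
  · rw [hex]
    exact hlang
  · have := h.pend p.t
    rw [hpl] at this
    exact this.1

theorem explorePaths_runs {p : DfsParams} {g : DfsGhost} {M : Mem} (h : DfsReady p g M) :
    Runs explorePaths M (60 * (g.U.card + g.T.edges.card + 1) + 1)
      fun M' => ∃ next root D, Decomposed p next root D M' := by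
  -- Exploring consumes an unexplored arc, returning contracts two edges into one, and insertion
  -- increases neither count. The additional 1 lets the final round drop to 0; it sets register 20
  -- to `n` as an exit mark.
  refine (Runs.loop (c := 59) (fun j M =>
    (∃ g, DfsReady p g M ∧ j = g.U.card + g.T.edges.card + 1) ∨
    (M.ireg 20 = M.ireg 0 ∧ ∃ next root D, Decomposed p next root D M)) ?_
    (.inl ⟨g, h, rfl⟩)).mono le_rfl ?_
  · rintro j M (⟨g, h, rfl⟩ | ⟨h, -⟩) hb
    swap
    · exact absurd h hb
    refine .seq (n₁ := 1) (n₂ := 58) (R := fun M' => DfsReady p g M' ∧ M'.ireg 6 = M'.iarr 4 g.v)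
      ?_ ?_ le_rfl
    · refine .block (by simp) ?_
      simp only [List.foldl, Instr.run]
      refine ⟨⟨h.toDfsState.congr rfl fun x hx => ?_, h.ready⟩, by simp [h.r20]⟩
      simp only [List.mem_cons, not_or] at hx
      simp [hx]
    clear h hb M
    rintro M ⟨h, h6⟩
    refine .ite (n := 57) (fun hb => ?_) fun hb => ?_
    · simp only [Test.Holds, h.r5] at hb
      refine .seq (h.explore h6 hb) ?_ (n₂ := 30) (by omega)
      rintro M' ⟨c, g', h', e1, e2⟩
      refine h'.arrive.mono le_rfl ?_
      rintro M'' ⟨g'', h'', e3, e4⟩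
      refine ⟨_, ?_, .inl ⟨g'', h'', rfl⟩⟩
      rw [e3]
      rw [e2] at e4
      omega
    · simp only [Test.Holds, h.r5, not_not] at hb
      have hU : g.U.filter (fun e => e.u = g.v) = 0 := by
        have := h.arcs g.v
        rw [← h6, hb] at this
        rw [h.out]
        match hul : g.ul g.v with
        | [] => rfl
        | e :: l =>
          rw [hul] at this
          exact absurd this.1.symm (Nat.succ_ne_zero _)
      refine .ite (n := 56) (fun hb => ?_) fun hb => ?_
      · simp only [Test.Holds, h.r20, h.r3] at hb
        refine .block (by simp) ?_
        simp only [List.foldl, Instr.run]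
        obtain ⟨root, hroot⟩ := h.final hU hb
        refine ⟨0, by omega, .inr ⟨by simp, g.next, root, g.D, ?_⟩⟩
        exact ⟨hroot.ops, hroot.paths, hroot.top, by simpa using hroot.r4,
          by simpa using hroot.r21, by simpa using hroot.r24⟩
      · simp only [Test.Holds, h.r20, h.r3] at hb
        refine .seq (h.pop hU hb) ?_ (n₂ := 30) (by omega)
        rintro M' ⟨c, g', h', e1, e2⟩
        refine h'.arrive.mono le_rfl ?_
        rintro M'' ⟨g'', h'', e3, e4⟩
        refine ⟨_, ?_, .inl ⟨g'', h'', rfl⟩⟩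
        rw [e3, e1]
        omega
  · rintro M' ⟨⟨j, ⟨g, h, -⟩ | ⟨-, h⟩⟩, hb⟩
    · refine absurd ?_ hb
      simp only [Test.Holds, h.r20, h.r0]
      -- Actual nodes are smaller than `n`, so the loop cannot stop before the exit mark is set.
      have hv : g.v < p.n := by
        rcases h.search.chain.mem (x := g.v) (by simp) with hvs | ⟨d, hd, hdv⟩
        · obtain ⟨e, he, hes⟩ := g.T.exists_tail_src Edge.u
          rw [hvs, ← h.search.src, ← hes]
          exact (h.lt e he).1
        · rw [← hdv]
          refine (h.lt d ?_).2
          rw [h.search.edges]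
          simp [hd]
      exact hv.ne
    · exact h

theorem decompose_runs {p : DfsParams} {M : Mem} {T : SPTree ℕ} (hM : AdjInv p.tl p.hd p.m p.m M)
    (wf : T.WF p.tl p.hd) (src : T.src p.tl = p.s) (tgt : T.tgt p.hd = p.t)
    (edges : T.edges = Multiset.range p.m) (paths : T.lang (fun a => {{a}}) = p.Φ)
    (lt : ∀ e < p.m, p.tl e < p.n ∧ p.hd e < p.n) (r0 : M.ireg 0 = p.n) (r3 : M.ireg 3 = p.s)
    (r4 : M.ireg 4 = p.t) (r5 : M.ireg 5 = 0) (hpend : ∀ x, M.iarr 7 x = 0) :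
    Runs decompose M (120 * p.m + 64) fun M' => ∃ next root D, Decomposed p next root D M' := by
  choose ul hul hul' using hM.out
  have hE : (T.map (Edge.arc p.tl p.hd)).edges = (Multiset.range p.m).map (Edge.arc p.tl p.hd) := by
    rw [SPTree.edges_map, edges]
  refine .seq (n₁ := 3) (n₂ := 60 * (p.m + p.m + 1) + 1) (R := fun M' => DfsReady p
    { T := T.map (Edge.arc p.tl p.hd), U := (Multiset.range p.m).map (Edge.arc p.tl p.hd), P := 0,
      stk := [], v := p.s, pl := fun _ => [], ul := ul, next := p.m, D := .leaf } M') ?_ ?_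
    (by omega)
  · refine .block (by simp) ?_
    simp only [List.foldl, Instr.run]
    have hsrc : (T.map (Edge.arc p.tl p.hd)).src Edge.u = p.s :=
      (SPTree.src_map (φ := id) (u := p.tl) (u' := Edge.u) (f := Edge.arc p.tl p.hd)
        (fun _ => rfl) T).trans src
    have htgt : (T.map (Edge.arc p.tl p.hd)).tgt Edge.w = p.t :=
      (SPTree.tgt_map (φ := id) (w := p.hd) (w' := Edge.w) (f := Edge.arc p.tl p.hd)
        (fun _ => rfl) T).trans tgt
    have hwf : (T.map (Edge.arc p.tl p.hd)).WF Edge.u Edge.w :=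
      wf.map (φ := id) (u' := Edge.u) (w' := Edge.w) (f := Edge.arc p.tl p.hd) (fun _ => rfl)
        (fun _ => rfl) Function.injective_id
    refine ⟨⟨⟨hwf, hsrc, htgt, ?_, ?_, rfl, by simp, ?_, by simp, by simp, by simp, by simp⟩, ?_,
      ?_, ?_, ?_, ?_, ?_, by simp, by simp, by simp, ?_, ?_, ?_, ?_, ?_, ?_, ?_, ?_, ?_⟩, ?_⟩
    · simp [hE]
    · rw [SPTree.lang_map]
      exact paths
    · rw [← hsrc, ← htgt]
      simpa using hwf.src_ne_tgt.symm
    · rw [hE]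
      exact Ops.init ..
    · simpa [hE, Edge.arc] using lt
    · exact hM.head
    · exact hul
    · intro x
      rw [Multiset.filter_map, ← Multiset.map_coe, hul']
      rfl
    · intro x
      exact hpend x
    · intro x _
      have := hM.deg x
      simp only [hE, indeg]
      rw [Multiset.countP_map]
      exact this
    · simpa using r0
    · simpa using hM.bound
    · simpa using r3
    · simpa using r4
    · simpa using r5
    · simpa using r3
    · simpa using hM.bound
    · simp
    -- Some arc leaves the source, and at the beginning every arc is unexplored.
    · left
      obtain ⟨e, he, hes⟩ := T.exists_tail_src p.tl
      intro h0
      refine Multiset.filter_eq_nil.1 h0 (Edge.arc p.tl p.hd e) ?_ (hes.trans src)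
      exact Multiset.mem_map_of_mem _ (edges ▸ he)
  · intro M' h
    refine (explorePaths_runs h).mono ?_ fun _ h => h
    simp [hE]

end RecSP

namespace RecSP

/-! ### The dynamic program -/

/-- The weighted size of the difference of two paths. -/
def pairWeight (p q : ℕ) (X Y : Finset ℕ) : ℕ := p * (X \ Y).card + q * (Y \ X).card

/-- The cost of a pair of paths. -/
noncomputable def pairCost (C c : ℕ → ℝ) (X Y : Finset ℕ) : ℝ := ∑ e ∈ X, C e + ∑ e ∈ Y, c e

/-- `X` is a path of `D` if `β = 1`, and empty otherwise. -/
def IsPart (D : SPTree ℕ) (β : ℕ) (X : Finset ℕ) : Prop :=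
  if β = 1 then X ∈ D.lang fun a => {{a}} else X = ∅

/-- The pairs sought in the mode `α`: the bits of `α` tell which of the two paths are needed. -/
def IsSol (D : SPTree ℕ) (α : ℕ) (X Y : Finset ℕ) : Prop :=
  IsPart D (α % 2) X ∧ IsPart D (α / 2) Y

/-- The triples `(α, α₁, α₂)` such that a pair of mode `α` in a series composition may consist of
pairs of modes `α₁`, `α₂` in the two parts. -/
def serRules : List (ℕ × ℕ × ℕ) := [(0, 0, 0), (1, 1, 1), (2, 2, 2), (3, 3, 3)]

/-- The triples `(α, α₁, α₂)` such that a pair of mode `α` in a parallel composition may consist of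
pairs of modes `α₁`, `α₂` in the two parts. -/
def parRules : List (ℕ × ℕ × ℕ) :=
  [(0, 0, 0), (1, 1, 0), (1, 0, 1), (2, 2, 0), (2, 0, 2), (3, 3, 0), (3, 0, 3), (3, 1, 2),
    (3, 2, 1)]

def rulesOf (y : ℕ) : List (ℕ × ℕ × ℕ) := if y = 0 then serRules else parRules

theorem rulesOf_lt {y : ℕ} : ∀ r ∈ rulesOf y, r.1 < 4 ∧ r.2.1 < 4 ∧ r.2.2 < 4 := by
  unfold rulesOf
  split_ifs <;> decide

theorem SPTree.subset_of_mem_lang {D : SPTree ℕ} {X : Finset ℕ} (h : X ∈ D.lang fun a => {{a}}) :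
    X ⊆ D.edges.toFinset := by
  induction D generalizing X with
  | leaf e => obtain rfl : X = {e} := h; simp [edges]
  | ser a b iha ihb =>
    obtain ⟨X₁, h₁, X₂, h₂, rfl⟩ := h
    rw [edges, Multiset.toFinset_add]
    exact Finset.union_subset_union (iha h₁) (ihb h₂)
  | par a b iha ihb =>
    rw [edges, Multiset.toFinset_add]
    rcases h with h | h
    · exact (iha h).trans Finset.subset_union_left
    · exact (ihb h).trans Finset.subset_union_right

theorem SPTree.lang_nonempty (D : SPTree ℕ) : ∃ X, X ∈ D.lang fun a => {{a}} := by
  induction D with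
  | leaf e => exact ⟨{e}, rfl⟩
  | ser a b iha ihb =>
    obtain ⟨X, hX⟩ := iha
    obtain ⟨Y, hY⟩ := ihb
    exact ⟨X ∪ Y, X, hX, Y, hY, rfl⟩
  | par a b iha _ =>
    obtain ⟨X, hX⟩ := iha
    exact ⟨X, .inl hX⟩

theorem IsPart.subset {D : SPTree ℕ} {β : ℕ} {X : Finset ℕ} (h : IsPart D β X) :
    X ⊆ D.edges.toFinset := by
  unfold IsPart at h
  split_ifs at h
  · exact SPTree.subset_of_mem_lang h
  · simp [h]

theorem isPart_ser {a b : SPTree ℕ} {β : ℕ} {X : Finset ℕ} :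
    IsPart (.ser a b) β X ↔ ∃ X₁ X₂, IsPart a β X₁ ∧ IsPart b β X₂ ∧ X₁ ∪ X₂ = X := by
  unfold IsPart
  split_ifs
  · constructor
    · rintro ⟨X₁, h₁, X₂, h₂, rfl⟩
      exact ⟨X₁, X₂, h₁, h₂, rfl⟩
    · rintro ⟨X₁, X₂, h₁, h₂, rfl⟩
      exact ⟨X₁, h₁, X₂, h₂, rfl⟩
  · constructor
    · rintro rfl
      exact ⟨∅, ∅, rfl, rfl, rfl⟩
    · rintro ⟨X₁, X₂, rfl, rfl, rfl⟩
      rfl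

theorem isPart_par {a b : SPTree ℕ} {β : ℕ} (hβ : β < 2) {X : Finset ℕ} :
    IsPart (.par a b) β X ↔ ∃ β₁ β₂, β₁ + β₂ = β ∧
      ∃ X₁ X₂, IsPart a β₁ X₁ ∧ IsPart b β₂ X₂ ∧ X₁ ∪ X₂ = X := by
  constructor
  · intro h
    interval_cases β
    · obtain rfl : X = ∅ := h
      exact ⟨0, 0, rfl, ∅, ∅, rfl, rfl, rfl⟩
    · rcases h with h | h
      · exact ⟨1, 0, rfl, X, ∅, h, rfl, by simp⟩
      · exact ⟨0, 1, rfl, ∅, X, rfl, h, by simp⟩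
  · rintro ⟨β₁, β₂, rfl, X₁, X₂, h₁, h₂, rfl⟩
    obtain ⟨rfl, rfl⟩ | ⟨rfl, rfl⟩ | ⟨rfl, rfl⟩ :
        (β₁ = 0 ∧ β₂ = 0) ∨ (β₁ = 1 ∧ β₂ = 0) ∨ (β₁ = 0 ∧ β₂ = 1) := by omega
    · obtain rfl : X₁ = ∅ := h₁
      obtain rfl : X₂ = ∅ := h₂
      rfl
    · obtain rfl : X₂ = ∅ := h₂
      rw [Finset.union_empty]
      exact .inl h₁
    · obtain rfl : X₁ = ∅ := h₁
      rw [Finset.empty_union]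
      exact .inr h₂

/-- The pairs in a composition are composed of pairs in the parts. -/
theorem isSol_iff {a b : SPTree ℕ} {y α : ℕ} (hα : α < 4) {X Y : Finset ℕ} :
    IsSol (if y = 0 then .ser a b else .par a b) α X Y ↔
      ∃ α₁ α₂, (α, α₁, α₂) ∈ rulesOf y ∧ ∃ X₁ X₂ Y₁ Y₂, IsSol a α₁ X₁ Y₁ ∧ IsSol b α₂ X₂ Y₂ ∧
        X₁ ∪ X₂ = X ∧ Y₁ ∪ Y₂ = Y := by
  unfold rulesOf
  split_ifs
  · constructor
    · rintro ⟨hX, hY⟩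
      obtain ⟨X₁, X₂, a1, a2, a3⟩ := isPart_ser.1 hX
      obtain ⟨Y₁, Y₂, b1, b2, b3⟩ := isPart_ser.1 hY
      refine ⟨α, α, ?_, X₁, X₂, Y₁, Y₂, ⟨a1, b1⟩, ⟨a2, b2⟩, a3, b3⟩
      interval_cases α <;> decide
    · rintro ⟨α₁, α₂, hr, X₁, X₂, Y₁, Y₂, ⟨a1, b1⟩, ⟨a2, b2⟩, a3, b3⟩
      have : ∀ r ∈ serRules, r.2.1 = r.1 ∧ r.2.2 = r.1 := by decide
      obtain ⟨rfl, rfl⟩ : α₁ = α ∧ α₂ = α := this _ hr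
      exact ⟨isPart_ser.2 ⟨X₁, X₂, a1, a2, a3⟩, isPart_ser.2 ⟨Y₁, Y₂, b1, b2, b3⟩⟩
  · constructor
    · rintro ⟨hX, hY⟩
      obtain ⟨β₁, β₂, hβ, X₁, X₂, a1, a2, a3⟩ := (isPart_par (by omega)).1 hX
      obtain ⟨γ₁, γ₂, hγ, Y₁, Y₂, b1, b2, b3⟩ := (isPart_par (by omega)).1 hY
      -- A mode is β + 2γ with a bit β for X and a bit γ for Y, and in a parallel composition the
      -- bits of the parts add up without carry.
      refine ⟨β₁ + 2 * γ₁, β₂ + 2 * γ₂, ?_, X₁, X₂, Y₁, Y₂, ⟨?_, ?_⟩, ⟨?_, ?_⟩, a3, b3⟩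
      · obtain rfl : α = β₁ + β₂ + 2 * (γ₁ + γ₂) := by omega
        have hβ₁ : β₁ < 2 := by omega
        have hβ₂ : β₂ < 2 := by omega
        have hγ₁ : γ₁ < 2 := by omega
        have hγ₂ : γ₂ < 2 := by omega
        interval_cases β₁ <;> interval_cases β₂ <;> interval_cases γ₁ <;> interval_cases γ₂ <;>
          first | decide | omega
      · rwa [show (β₁ + 2 * γ₁) % 2 = β₁ by omega]
      · rwa [show (β₁ + 2 * γ₁) / 2 = γ₁ by omega]
      · rwa [show (β₂ + 2 * γ₂) % 2 = β₂ by omega]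
      · rwa [show (β₂ + 2 * γ₂) / 2 = γ₂ by omega]
    · rintro ⟨α₁, α₂, hr, X₁, X₂, Y₁, Y₂, ⟨a1, b1⟩, ⟨a2, b2⟩, a3, b3⟩
      have : ∀ r ∈ parRules, r.2.1 % 2 + r.2.2 % 2 = r.1 % 2 ∧
        r.2.1 / 2 + r.2.2 / 2 = r.1 / 2 := by decide
      obtain ⟨h1, h2⟩ := this _ hr
      exact ⟨(isPart_par (by omega)).2 ⟨_, _, h1, X₁, X₂, a1, a2, a3⟩,
        (isPart_par (by omega)).2 ⟨_, _, h2, Y₁, Y₂, b1, b2, b3⟩⟩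

section

variable {A B X₁ X₂ Y₁ Y₂ : Finset ℕ}

/-- Parts over disjoint arc sets cannot cancel each other's arcs; this is the source of additivity
of the weight. -/
theorem union_sdiff_union (h : Disjoint A B) (hX₁ : X₁ ⊆ A) (hX₂ : X₂ ⊆ B) (hY₁ : Y₁ ⊆ A)
    (hY₂ : Y₂ ⊆ B) : ((X₁ ∪ X₂) \ (Y₁ ∪ Y₂)).card = (X₁ \ Y₁).card + (X₂ \ Y₂).card := by
  rw [← Finset.card_union_of_disjoint]
  · congr 1
    ext x
    simp only [Finset.mem_sdiff, Finset.mem_union]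
    have h1 := @hX₁ x
    have h2 := @hX₂ x
    have h3 := @hY₁ x
    have h4 := @hY₂ x
    have h5 : x ∈ A → x ∉ B := fun ha hb => Finset.disjoint_left.1 h ha hb
    tauto
  · exact (h.mono hX₁ hX₂).mono Finset.sdiff_subset Finset.sdiff_subset

theorem pairWeight_union (h : Disjoint A B) (hX₁ : X₁ ⊆ A) (hX₂ : X₂ ⊆ B) (hY₁ : Y₁ ⊆ A)
    (hY₂ : Y₂ ⊆ B) (p q : ℕ) :
    pairWeight p q (X₁ ∪ X₂) (Y₁ ∪ Y₂) = pairWeight p q X₁ Y₁ + pairWeight p q X₂ Y₂ := by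
  simp only [pairWeight, union_sdiff_union h hX₁ hX₂ hY₁ hY₂, union_sdiff_union h hY₁ hY₂ hX₁ hX₂]
  ring

theorem pairCost_union (h : Disjoint A B) (hX₁ : X₁ ⊆ A) (hX₂ : X₂ ⊆ B) (hY₁ : Y₁ ⊆ A)
    (hY₂ : Y₂ ⊆ B) (C c : ℕ → ℝ) :
    pairCost C c (X₁ ∪ X₂) (Y₁ ∪ Y₂) = pairCost C c X₁ Y₁ + pairCost C c X₂ Y₂ := by
  simp only [pairCost, Finset.sum_union (h.mono hX₁ hX₂), Finset.sum_union (h.mono hY₁ hY₂)]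
  ring

end

/-- The cell for the node `j`, the mode `α` and the budget `l`. -/
def addr (k j α l : ℕ) : ℕ := (4 * j + α) * (k + 1) + l

/-- The table: whether a cell has a value, its value, and the two cells that it is composed of. In
the cells of an arc, the latter two entries tell whether the arc belongs to the two paths. -/
structure Cells where
  flag : ℕ → ℕ
  val : ℕ → ℝ
  bp : ℕ → ℕ
  bq : ℕ → ℕ

/-- The cell `x` holds the best combination of two cells in `S`. -/
structure Cells.Best (T : Cells) (x : ℕ) (S : Set (ℕ × ℕ)) : Prop where
  mem : T.flag x ≠ 0 → (T.bp x, T.bq x) ∈ S ∧ T.flag (T.bp x) ≠ 0 ∧ T.flag (T.bq x) ≠ 0 ∧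
    T.val x = T.val (T.bp x) + T.val (T.bq x)
  le : ∀ z ∈ S, T.flag z.1 ≠ 0 → T.flag z.2 ≠ 0 → T.flag x ≠ 0 ∧ T.val x ≤ T.val z.1 + T.val z.2

/-- The pairs of cells that may be combined into the cell for the mode `α` and the budget `l` of a
node with the parts `a` and `b`. -/
def combos (k a b : ℕ) (rules : List (ℕ × ℕ × ℕ)) (α l : ℕ) : Set (ℕ × ℕ) :=
  {z | ∃ α₁ α₂ i, (α, α₁, α₂) ∈ rules ∧ i ≤ l ∧ z = (addr k a α₁ i, addr k b α₂ (l - i))}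

/-- The cells of the arc `e` are filled. -/
def Cells.LeafRow (T : Cells) (k p q : ℕ) (C c : ℕ → ℝ) (e : ℕ) : Prop :=
  ∀ α < 4, ∀ l ≤ k,
    (T.flag (addr k e α l) ≠ 0 ↔ (l = 0 → (α = 1 → p = 0) ∧ (α = 2 → q = 0))) ∧
    T.val (addr k e α l) = (if α % 2 = 1 then C e else 0) + (if α / 2 = 1 then c e else 0) ∧
    T.bp (addr k e α l) = α % 2 ∧ T.bq (addr k e α l) = α / 2

/-- The table is filled. -/
structure Cells.Filled (T : Cells) (m next k p q : ℕ) (L R ty : ℕ → ℕ) (C c : ℕ → ℝ) : Prop where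
  leaf : ∀ e < m, T.LeafRow k p q C c e
  node : ∀ j, m ≤ j → j < next → ∀ α < 4, ∀ l ≤ k,
    T.Best (addr k j α l) (combos k (L j) (R j) (rulesOf (ty j)) α l)

theorem isPart_leaf {e β : ℕ} (hβ : β < 2) {X : Finset ℕ} :
    IsPart (.leaf e) β X ↔ X = if β = 1 then {e} else ∅ := by
  interval_cases β
  · rfl
  · rfl

section

variable {T : Cells} {m next k p q : ℕ} {D : ℕ → SPTree ℕ} {L R ty : ℕ → ℕ} {C c : ℕ → ℝ}
  {F : Multiset Edge}

theorem Ops.disjoint (h : Ops m next D L R ty F) {j : ℕ} (hj : m ≤ j) (hj' : j < next) :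
    Disjoint (D (L j)).edges.toFinset (D (R j)).edges.toFinset := by
  have h1 := h.nodup j hj'
  have h2 : (D j).edges = (D (L j)).edges + (D (R j)).edges := by
    rw [(h.node j hj hj').2.2]
    split_ifs <;> rfl
  rw [h2, Multiset.nodup_add] at h1
  rw [Multiset.disjoint_toFinset]
  exact h1.2.2

/-- Values in the table are lower bounds. -/
theorem Cells.Filled.le_cost (hT : T.Filled m next k p q L R ty C c) (h : Ops m next D L R ty F)
    (hp : p ≤ 1) (hq : q ≤ 1)
    {j : ℕ} (hj : j < next) {α l : ℕ} (hα : α < 4) (hl : l ≤ k) {X Y : Finset ℕ}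
    (hs : IsSol (D j) α X Y) (hw : pairWeight p q X Y ≤ l) :
    T.flag (addr k j α l) ≠ 0 ∧ T.val (addr k j α l) ≤ pairCost C c X Y := by
  induction j using Nat.strong_induction_on generalizing α l X Y with
  | _ j ih =>
    by_cases hjm : j < m
    · rw [h.leaf j hjm] at hs
      obtain ⟨h1, h2, -⟩ := hT.leaf j hjm α hα l hl
      obtain ⟨hX, hY⟩ := hs
      rw [isPart_leaf (by omega)] at hX hY
      rw [h1, h2]
      interval_cases α <;> simp at hX hY <;> subst hX <;> subst hY <;>
        simp [pairWeight, pairCost] at hw ⊢ <;> omega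
    · have hmj : m ≤ j := not_lt.1 hjm
      obtain ⟨hL, hR, hD⟩ := h.node j hmj hj
      rw [hD, isSol_iff hα] at hs
      obtain ⟨α₁, α₂, hr, X₁, X₂, Y₁, Y₂, h1, h2, rfl, rfl⟩ := hs
      obtain ⟨-, hα₁, hα₂⟩ := rulesOf_lt _ hr
      have hd := h.disjoint hmj hj
      rw [pairWeight_union hd h1.1.subset h2.1.subset h1.2.subset h2.2.subset] at hw
      rw [pairCost_union hd h1.1.subset h2.1.subset h1.2.subset h2.2.subset]
      -- The left part receives exactly the weight that its pair uses, the right part the rest of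
      -- the budget.
      obtain ⟨f1, c1⟩ := ih (L j) hL (hL.trans hj) hα₁ (l := pairWeight p q X₁ Y₁) (by omega) h1
        le_rfl
      obtain ⟨f2, c2⟩ := ih (R j) hR (hR.trans hj) hα₂ (l := l - pairWeight p q X₁ Y₁) (by omega) h2
        (by omega)
      obtain ⟨f3, c3⟩ := (hT.node j hmj hj α hα l hl).le _
        ⟨α₁, α₂, pairWeight p q X₁ Y₁, hr, by omega, rfl⟩ f1 f2
      exact ⟨f3, c3.trans (add_le_add c1 c2)⟩

/-- If `f` selects a cell for each node, such that the cells of the parts of a node are those that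
its cell is composed of, the selected cells determine a solution. -/
theorem Cells.Filled.solution (hT : T.Filled m next k p q L R ty C c) (h : Ops m next D L R ty F)
    (hp : p ≤ 1) (hq : q ≤ 1) {f : ℕ → ℕ}
    (hf : ∀ j, m ≤ j → j < next → f (L j) = T.bp (f j) ∧ f (R j) = T.bq (f j))
    {j : ℕ} (hj : j < next) {α l : ℕ} (hα : α < 4) (hl : l ≤ k) (hfj : f j = addr k j α l)
    (hflag : T.flag (f j) ≠ 0) :
    IsSol (D j) α ((D j).edges.toFinset.filter fun e => T.bp (f e) = 1)
      ((D j).edges.toFinset.filter fun e => T.bq (f e) = 1) ∧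
    pairWeight p q ((D j).edges.toFinset.filter fun e => T.bp (f e) = 1)
      ((D j).edges.toFinset.filter fun e => T.bq (f e) = 1) ≤ l ∧
    T.val (f j) = pairCost C c ((D j).edges.toFinset.filter fun e => T.bp (f e) = 1)
      ((D j).edges.toFinset.filter fun e => T.bq (f e) = 1) ∧
    ∀ e ∈ (D j).edges, T.bp (f e) < 2 ∧ T.bq (f e) < 2 := by
  induction j using Nat.strong_induction_on generalizing α l with
  | _ j ih =>
    by_cases hjm : j < m
    · obtain ⟨h1, h2, h3, h4⟩ := hT.leaf j hjm α hα l hl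
      rw [hfj] at hflag
      rw [h1] at hflag
      have hX : (D j).edges.toFinset.filter (fun e => T.bp (f e) = 1) =
          if α % 2 = 1 then {j} else ∅ := by
        rw [h.leaf j hjm, SPTree.edges, Multiset.toFinset_singleton, Finset.filter_singleton, hfj,
          h3]
      have hY : (D j).edges.toFinset.filter (fun e => T.bq (f e) = 1) =
          if α / 2 = 1 then {j} else ∅ := by
        rw [h.leaf j hjm, SPTree.edges, Multiset.toFinset_singleton, Finset.filter_singleton, hfj,
          h4]
      rw [hX, hY, hfj, h2, h.leaf j hjm]
      refine ⟨⟨(isPart_leaf (by omega)).2 rfl, (isPart_leaf (by omega)).2 rfl⟩, ?_, ?_, ?_⟩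
      · interval_cases α <;> simp [pairWeight] at hflag ⊢ <;> omega
      · interval_cases α <;> simp [pairCost]
      · intro e he
        obtain rfl : e = j := by simpa [SPTree.edges] using he
        rw [hfj, h3, h4]
        omega
    · have hmj : m ≤ j := not_lt.1 hjm
      obtain ⟨hL, hR, hD⟩ := h.node j hmj hj
      have hE : (D j).edges = (D (L j)).edges + (D (R j)).edges := by
        rw [hD]
        split_ifs <;> rfl
      obtain ⟨fL, fR⟩ := hf j hmj hj
      -- The back pointers name two cells for modes allowed by a rule and budgets `i` and `l - i`,
      -- so the induction hypothesis applies to both parts.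
      obtain ⟨⟨α₁, α₂, i, hr, hi, hz⟩, b2, b3, b4⟩ :=
        (hT.node j hmj hj α hα l hl).mem (hfj ▸ hflag)
      rw [← hfj, ← fL, ← fR] at hz b4
      rw [← hfj, ← fL] at b2
      rw [← hfj, ← fR] at b3
      rw [Prod.mk.injEq] at hz
      obtain ⟨-, hα₁, hα₂⟩ := rulesOf_lt _ hr
      obtain ⟨s1, w1, c1, l1⟩ := ih (L j) hL (hL.trans hj) hα₁ (by omega) hz.1 b2
      obtain ⟨s2, w2, c2, l2⟩ := ih (R j) hR (hR.trans hj) hα₂ (by omega) hz.2 b3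
      have hd := h.disjoint hmj hj
      rw [hE, Multiset.toFinset_add, Finset.filter_union, Finset.filter_union,
        pairWeight_union hd s1.1.subset s2.1.subset s1.2.subset s2.2.subset,
        pairCost_union hd s1.1.subset s2.1.subset s1.2.subset s2.2.subset, b4, c1, c2]
      refine ⟨?_, by omega, rfl, fun e he => ?_⟩
      · rw [hD, isSol_iff hα]
        exact ⟨α₁, α₂, hr, _, _, _, _, s1, s2, rfl, rfl⟩
      · rcases Multiset.mem_add.1 he with he | he
        exacts [l1 e he, l2 e he]

end

end RecSP

namespace RecSP

theorem addr_add (k j α l : ℕ) : addr k j α 0 + l = addr k j α l := by simp [addr]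

theorem addr_row (k j α : ℕ) : addr k j α 0 + (k + 1) = addr k j (α + 1) 0 := by
  simp only [addr]; ring

theorem addr_node (k j : ℕ) : addr k j 4 0 = addr k (j + 1) 0 0 := by
  simp only [addr]; ring

/-- Rows of length `k + 1` follow one another in the order of `4 * j + α`. As parts precede the
nodes made from them, a cell depends only on cells at smaller addresses. -/
theorem addr_lt_of_lt {k j α j' α' l l' : ℕ} (h : 4 * j + α < 4 * j' + α') (hl : l ≤ k) :
    addr k j α l < addr k j' α' l' := by
  have : (4 * j + α + 1) * (k + 1) ≤ (4 * j' + α') * (k + 1) := Nat.mul_le_mul_right _ h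
  have h2 : (4 * j + α + 1) * (k + 1) = (4 * j + α) * (k + 1) + (k + 1) := by ring
  unfold addr
  omega

/-! ### The rows of the table -/

/-- Store the address of the next row in the integer array `16 + α`. -/
def baseRow (α : ℕ) : Prog :=
  .seq (.block [.istore (16 + α) 32 33, .iconst 34 0]) <|
    .loop (.ilt 34 31) <| .block [.incr 33, .incr 34]

/-- The integer array `16 + α` becomes the list of the addresses of the rows for the mode `α`. -/
def bases : Prog :=
  .seq (.block [.icopy 31 2, .incr 31, .iconst 32 0, .iconst 33 0]) <|
    .loop (.ilt 32 21) <|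
      .seq (baseRow 0) <| .seq (baseRow 1) <| .seq (baseRow 2) <| .seq (baseRow 3) <|
        .block [.incr 32]

/-- The machine cannot multiply, so row addresses are obtained by counting. This costs O(k) per row
and O(mk) in total, and later each address is a single array access. -/
theorem baseRow_runs {α K : ℕ} {M : Mem} (h31 : M.ireg 31 = K) :
    Runs (baseRow α) M (3 * K + 3) fun M' => M'.ireg 33 = M.ireg 33 + K ∧
      M'.iarr = Function.update M.iarr (16 + α)
        (Function.update (M.iarr (16 + α)) (M.ireg 32) (M.ireg 33)) := by
  refine .seq (n₁ := 2) (n₂ := 3 * K + 1) (R := fun M' => M'.ireg 34 = 0 ∧ M'.ireg 31 = K ∧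
      M'.ireg 33 = M.ireg 33 ∧ M'.iarr = Function.update M.iarr (16 + α)
        (Function.update (M.iarr (16 + α)) (M.ireg 32) (M.ireg 33))) ?_ ?_ (by omega)
  · refine .block (by simp) ?_
    simp [Instr.run, h31]
  rintro M₁ ⟨h1, h2, h3, h4⟩
  refine (Runs.count (c := 2) (N := K) (fun i M' => M'.ireg 34 = i ∧ M'.ireg 31 = K ∧
    M'.ireg 33 = M.ireg 33 + i ∧ M'.iarr = M₁.iarr) (fun i M h => ⟨h.1, h.2.1⟩) ?_
    (Nat.zero_le K) ⟨h1, h2, h3, rfl⟩).mono (by omega) ?_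
  · rintro i M' hi ⟨e1, e2, e3, e4⟩
    refine .block (by simp) ?_
    simp only [List.foldl, Instr.run]
    refine ⟨by simp [e1], by simp [e2], by simp [e3, add_assoc], e4⟩
  · rintro M' ⟨-, -, e3, e4⟩
    exact ⟨e3, e4.trans h4⟩

/-- The addresses of the rows of the nodes `0, …, J - 1` are known. -/
def HasBases (k J : ℕ) (M : Mem) : Prop :=
  ∀ j < J, ∀ α < 4, M.iarr (16 + α) j = addr k j α 0

theorem bases_runs {k next : ℕ} {M : Mem} (h2 : M.ireg 2 = k) (h21 : M.ireg 21 = next) :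
    Runs bases M ((12 * k + 26) * next + 5) fun M' => M'.ireg 31 = k + 1 ∧ HasBases k next M' := by
  refine .seq (n₁ := 4) (n₂ := (12 * k + 26) * next + 1) (R := fun M' => M'.ireg 31 = k + 1 ∧
      M'.ireg 32 = 0 ∧ M'.ireg 33 = 0 ∧ M'.ireg 21 = next) ?_ ?_ (by omega)
  · refine .block (by simp) ?_
    simp [Instr.run, h2, h21]
  rintro M₁ ⟨e1, e2, e3, e4⟩
  refine (Runs.count (c := 12 * k + 25) (N := next) (fun J M => M.ireg 32 = J ∧ M.ireg 21 = next ∧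
    M.ireg 31 = k + 1 ∧ M.ireg 33 = addr k J 0 0 ∧ HasBases k J M) (fun i M h => ⟨h.1, h.2.1⟩) ?_
    (Nat.zero_le _) ⟨e2, e4, e1, by simp [e3, addr], fun j hj => by omega⟩).mono (by simp)
    fun M h => ⟨h.2.2.1, h.2.2.2.2⟩
  rintro J M hJ ⟨h1, h2, h3, h4, h5⟩
  have step : ∀ {α M}, α < 4 → (M.ireg 32 = J ∧ M.ireg 21 = next ∧ M.ireg 31 = k + 1 ∧
      M.ireg 33 = addr k J α 0 ∧ HasBases k J M ∧ ∀ β < α, M.iarr (16 + β) J = addr k J β 0) →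
      Runs (baseRow α) M (3 * (k + 1) + 3) fun M => M.ireg 32 = J ∧ M.ireg 21 = next ∧
        M.ireg 31 = k + 1 ∧ M.ireg 33 = addr k J (α + 1) 0 ∧ HasBases k J M ∧
        ∀ β < α + 1, M.iarr (16 + β) J = addr k J β 0 := by
    rintro α M hα ⟨h1, h2, h3, h4, h5, h6⟩
    refine (baseRow_runs h3).frame.mono le_rfl ?_
    rintro M' ⟨⟨g1, g2⟩, hF⟩
    have hr : ∀ x, x ≠ 33 → x ≠ 34 → M'.ireg x = M.ireg x := fun x hx hx' => hF.ireg x (by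
      simp [baseRow, Prog.block, Prog.collect, Instr.iregs, hx, hx'])
    refine ⟨by rw [hr _ (by decide) (by decide), h1], by rw [hr _ (by decide) (by decide), h2],
      by rw [hr _ (by decide) (by decide), h3], by rw [g1, h4, addr_row], fun j hj β hβ => ?_,
      fun β hβ => ?_⟩
    · rw [g2, h1]
      by_cases hαβ : β = α
      · subst hαβ
        rw [Function.update_self, Function.update_of_ne hj.ne]
        exact h5 j hj β hβ
      · rw [Function.update_of_ne (by omega)]
        exact h5 j hj β hβ
    · rw [g2, h1]
      by_cases hαβ : β = α
      · subst hαβ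
        rw [Function.update_self, Function.update_self, h4]
      · rw [Function.update_of_ne (by omega)]
        exact h6 β (by omega)
  refine .seq (step (by decide) ⟨h1, h2, h3, h4, h5, by simp⟩) (fun M h => ?_)
    (n₂ := 9 * (k + 1) + 10) (by omega)
  refine .seq (step (by decide) h) (fun M h => ?_) (n₂ := 6 * (k + 1) + 7) (by omega)
  refine .seq (step (by decide) h) (fun M h => ?_) (n₂ := 3 * (k + 1) + 4) (by omega)
  refine .seq (step (by decide) h) (fun M h => ?_) (n₂ := 1) (by omega)
  refine .block (by simp) ?_
  simp only [List.foldl, Instr.run]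
  obtain ⟨h1, h2, h3, h4, h5, h6⟩ := h
  refine ⟨by simp [h1], by simp [h2], by simp [h3], by simpa [addr_node] using h4,
    fun j hj β hβ => ?_⟩
  rcases Nat.lt_succ_iff_lt_or_eq.1 hj with hj | rfl
  exacts [h5 j hj β hβ, h6 β hβ]

/-- The table in the memory. -/
def Mem.cells (M : Mem) : Cells := ⟨M.iarr 20, M.rarr 2, M.iarr 21, M.iarr 22⟩

/-- The tables agree in the cell `y`. -/
def Cells.EqAt (T T' : Cells) (y : ℕ) : Prop :=
  T'.flag y = T.flag y ∧ T'.val y = T.val y ∧ T'.bp y = T.bp y ∧ T'.bq y = T.bq y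

theorem Cells.EqAt.refl (T : Cells) (y : ℕ) : T.EqAt T y := ⟨rfl, rfl, rfl, rfl⟩

theorem Cells.EqAt.trans {T T' T'' : Cells} {y : ℕ} (h : T.EqAt T' y) (h' : T'.EqAt T'' y) :
    T.EqAt T'' y :=
  ⟨h'.1.trans h.1, h'.2.1.trans h.2.1, h'.2.2.1.trans h.2.2.1, h'.2.2.2.trans h.2.2.2⟩

theorem Cells.LeafRow.congr {T T' : Cells} {k p q : ℕ} {C c : ℕ → ℝ} {e : ℕ}
    (h : T.LeafRow k p q C c e) (heq : ∀ α < 4, ∀ l ≤ k, T.EqAt T' (addr k e α l)) :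
    T'.LeafRow k p q C c e := by
  intro α hα l hl
  obtain ⟨h1, h2, h3, h4⟩ := heq α hα l hl
  rw [h1, h2, h3, h4]
  exact h α hα l hl

theorem Cells.Best.congr {T T' : Cells} {x : ℕ} {S : Set (ℕ × ℕ)} (h : T.Best x S)
    (hx : T.EqAt T' x) (hS : ∀ z ∈ S, T.EqAt T' z.1 ∧ T.EqAt T' z.2) : T'.Best x S := by
  constructor
  · intro hf
    rw [hx.1] at hf
    obtain ⟨h1, h2, h3, h4⟩ := h.mem hf
    have h5 := hS _ h1
    rw [hx.2.1, hx.2.2.1, hx.2.2.2, h5.1.1, h5.2.1, h5.1.2.1, h5.2.2.1]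
    exact ⟨h1, h2, h3, h4⟩
  · intro z hz
    rw [(hS z hz).1.1, (hS z hz).2.1, (hS z hz).1.2.1, (hS z hz).2.2.1, hx.1, hx.2.1]
    exact h.le z hz

/-- Fill the row of an arc for the mode `α`, where `f` is the first flag, and the real register
`α + 1` holds the value. -/
def leafRow (α f : ℕ) : Prog :=
  .seq (.block [.iload 36 (16 + α) 35, .iconst 37 f, .iconst 38 (α % 2), .iconst 39 (α / 2),
    .iconst 34 0]) <|
  .loop (.ilt 34 31) <| .block [.istore 20 36 37, .rstore 2 36 (α + 1), .istore 21 36 38,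
    .istore 22 36 39, .incr 36, .incr 34, .iconst 37 1]

/-- Fill the rows of all arcs. -/
def leaves (p q : ℕ) : Prog :=
  .seq (.block [.iconst 35 0]) <|
  .loop (.ilt 35 1) <|
    .seq (.block [.rload 2 0 35, .rload 3 1 35, .radd 4 2 3]) <|
    .seq (leafRow 0 1) <| .seq (leafRow 1 (1 - p)) <| .seq (leafRow 2 (1 - q)) <|
    .seq (leafRow 3 1) <| .block [.incr 35]

theorem leafRow_runs {α f k x : ℕ} {M : Mem} (h31 : M.ireg 31 = k + 1)
    (hx : M.iarr (16 + α) (M.ireg 35) = x) :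
    Runs (leafRow α f) M (8 * (k + 1) + 6) fun M' =>
      (∀ l ≤ k, M'.cells.flag (x + l) = (if l = 0 then f else 1) ∧
        M'.cells.val (x + l) = M.rreg (α + 1) ∧ M'.cells.bp (x + l) = α % 2 ∧
        M'.cells.bq (x + l) = α / 2) ∧
      ∀ y, (y < x ∨ x + (k + 1) ≤ y) → M.cells.EqAt M'.cells y := by
  refine .seq (n₁ := 5) (n₂ := 8 * (k + 1) + 1) (R := fun M' => M'.ireg 36 = x ∧ M'.ireg 37 = f ∧
    M'.ireg 38 = α % 2 ∧ M'.ireg 39 = α / 2 ∧ M'.ireg 34 = 0 ∧ M'.ireg 31 = k + 1 ∧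
    M'.rreg = M.rreg ∧ M'.cells = M.cells) ?_ ?_ (by omega)
  · refine .block (by simp) ?_
    simp [Instr.run, h31, hx, Mem.cells]
  rintro M₁ ⟨a1, a2, a3, a4, a5, a6, a7, a8⟩
  rw [← a7, ← a8]
  refine (Runs.count (c := 7) (N := k + 1) (fun i M' => M'.ireg 34 = i ∧ M'.ireg 31 = k + 1 ∧
    M'.ireg 36 = x + i ∧ M'.ireg 37 = (if i = 0 then f else 1) ∧ M'.ireg 38 = α % 2 ∧
    M'.ireg 39 = α / 2 ∧ M'.rreg = M₁.rreg ∧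
    (∀ l < i, M'.cells.flag (x + l) = (if l = 0 then f else 1) ∧
        M'.cells.val (x + l) = M₁.rreg (α + 1) ∧ M'.cells.bp (x + l) = α % 2 ∧
        M'.cells.bq (x + l) = α / 2) ∧
    ∀ y, (y < x ∨ x + i ≤ y) → M₁.cells.EqAt M'.cells y) (fun i M h => ⟨h.1, h.2.1⟩) ?_
    (Nat.zero_le _) ⟨a5, a6, a1, a2, a3, a4, rfl, by simp, fun y _ => .refl _ y⟩).mono (by omega)
    fun M' h => ⟨fun l hl => h.2.2.2.2.2.2.2.1 l (by omega), h.2.2.2.2.2.2.2.2⟩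
  rintro i M hi ⟨b1, b2, b3, b4, b5, b6, b7, b8, b9⟩
  refine .block (by simp) ?_
  simp only [List.foldl, Instr.run]
  refine ⟨by simp [b1], by simp [b2], by simp [b3, add_assoc], by simp, by simp [b5], by simp [b6],
    b7, fun l hl => ?_, fun y hy => ?_⟩
  · rcases Nat.lt_succ_iff_lt_or_eq.1 hl with hl | rfl
    · have := b8 l hl
      have hne : l ≠ i := hl.ne
      simpa [Mem.cells, b3, hne] using this
    · simp [Mem.cells, b3, b4, b5, b6, b7]
  · refine (b9 y (by omega)).trans ?_
    have hne : y ≠ x + i := by omega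
    simp [Cells.EqAt, Mem.cells, b3, hne]

/-- Memory for the dynamic program. -/
structure TableMem (m next k p q J : ℕ) (L R ty : ℕ → ℕ) (C c : ℕ → ℝ) (M : Mem) : Prop where
  r1 : M.ireg 1 = m
  r5 : M.ireg 5 = 0
  r21 : M.ireg 21 = next
  r24 : M.ireg 24 = 1
  r31 : M.ireg 31 = k + 1
  a13 : M.iarr 13 = L
  a14 : M.iarr 14 = R
  a15 : M.iarr 15 = ty
  bases : HasBases k next M
  leaf : ∀ e < m, e < J → M.cells.LeafRow k p q C c e
  node : ∀ j, m ≤ j → j < J → ∀ α < 4, ∀ l ≤ k,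
    M.cells.Best (addr k j α l) (combos k (L j) (R j) (rulesOf (ty j)) α l)
  -- Unflagged cells play the role of infinite values, so a fresh row is correct for an empty set of
  -- combinations.
  empty : ∀ y, addr k J 0 0 ≤ y → M.cells.flag y = 0

theorem leaves_runs {m next k p q : ℕ} {L R ty : ℕ → ℕ} {C c : ℕ → ℝ} {M : Mem} (hp : p ≤ 1)
    (hq : q ≤ 1) (hm : m ≤ next)
    (h : TableMem m next k p q 0 L R ty C c M) (hC : M.rarr 0 = C) (hc : M.rarr 1 = c)
    (h1 : M.rreg 1 = 0) :
    Runs (leaves p q) M ((32 * k + 61) * m + 2) (TableMem m next k p q m L R ty C c) := by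
  refine .seq (n₁ := 1) (n₂ := (32 * k + 61) * m + 1) (R := fun M =>
    TableMem m next k p q 0 L R ty C c M ∧ M.ireg 35 = 0 ∧ M.rarr 0 = C ∧ M.rarr 1 = c ∧
      M.rreg 1 = 0) ?_ ?_ (by omega)
  · refine .block (by simp) ?_
    simp only [List.foldl, Instr.run]
    obtain ⟨g1, g2, g3, g4, g5, g6, g7, g8, g9, g10, g11, g12⟩ := h
    exact ⟨⟨by simp [g1], by simp [g2], by simp [g3], by simp [g4], by simp [g5], g6, g7, g8, g9,
      g10, g11, g12⟩, by simp, hC, hc, h1⟩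
  clear h hC hc h1 M
  rintro M ⟨h, h35, hC, hc, h1⟩
  refine (Runs.count (c := 32 * k + 60) (N := m) (fun J M =>
    TableMem m next k p q J L R ty C c M ∧ M.ireg 35 = J ∧ M.rarr 0 = C ∧ M.rarr 1 = c ∧
      M.rreg 1 = 0) (fun i M h => ⟨h.2.1, h.1.r1⟩) ?_ (Nat.zero_le m) ⟨h, h35, hC, hc, h1⟩).mono
      (by simp) fun M h => h.1
  clear h h35 hC hc h1 M
  rintro J M hJ ⟨h, h35, hC, hc, h1⟩
  -- One row of the arc `J`: `M₀` is the memory before its four rows, `M₁` the memory after the rows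
  -- for the modes below `α`. For budget 0 the flag is `1 - p` or `1 - q` in the modes 1 and 2,
  -- since an arc in only one path has weight `p` or `q`.
  have step : ∀ {α f : ℕ} {M₀ M₁ : Mem}, α < 4 → (∀ x, x < 34 → M₁.ireg x = M₀.ireg x) →
      M₁.ireg 35 = J → (∀ x, x < 20 → M₁.iarr x = M₀.iarr x) → M₁.rreg = M₀.rreg →
      (∀ x, x < 2 → M₁.rarr x = M₀.rarr x) → M₀.ireg 31 = k + 1 → HasBases k next M₀ →
      (∀ β < α, ∀ l ≤ k, M₁.cells.flag (addr k J β l) =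
        (if l = 0 then (if β = 1 then 1 - p else if β = 2 then 1 - q else 1) else 1) ∧
        M₁.cells.val (addr k J β l) = M₀.rreg (β + 1) ∧ M₁.cells.bp (addr k J β l) = β % 2 ∧
        M₁.cells.bq (addr k J β l) = β / 2) →
      (∀ y, (y < addr k J 0 0 ∨ addr k J α 0 ≤ y) → M₀.cells.EqAt M₁.cells y) →
      f = (if α = 1 then 1 - p else if α = 2 then 1 - q else 1) →
      Runs (leafRow α f) M₁ (8 * (k + 1) + 6) fun M₁ => (∀ x, x < 34 → M₁.ireg x = M₀.ireg x) ∧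
      M₁.ireg 35 = J ∧ (∀ x, x < 20 → M₁.iarr x = M₀.iarr x) ∧ M₁.rreg = M₀.rreg ∧
      (∀ x, x < 2 → M₁.rarr x = M₀.rarr x) ∧
      (∀ β < α + 1, ∀ l ≤ k, M₁.cells.flag (addr k J β l) =
        (if l = 0 then (if β = 1 then 1 - p else if β = 2 then 1 - q else 1) else 1) ∧
        M₁.cells.val (addr k J β l) = M₀.rreg (β + 1) ∧ M₁.cells.bp (addr k J β l) = β % 2 ∧
        M₁.cells.bq (addr k J β l) = β / 2) ∧
      (∀ y, (y < addr k J 0 0 ∨ addr k J (α + 1) 0 ≤ y) → M₀.cells.EqAt M₁.cells y) := by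
    rintro α f M₀ M₁ hα c1 c2 c3 c4 c5 c6 c7 c8 c9 rfl
    have hx : M₁.iarr (16 + α) (M₁.ireg 35) = addr k J α 0 := by
      rw [c2, c3 _ (by omega)]
      exact c7 J (by omega) α hα
    refine (leafRow_runs (k := k) ((c1 31 (by decide)).trans c6) hx).frame.mono le_rfl ?_
    rintro M₂ ⟨⟨d1, d2⟩, hF⟩
    have hr : ∀ x, x < 34 ∨ x = 35 → M₂.ireg x = M₁.ireg x := fun x hx => hF.ireg x (by
      simp [leafRow, Prog.block, Prog.collect, Instr.iregs]; omega)
    have ha : ∀ x, x < 20 → M₂.iarr x = M₁.iarr x := fun x hx => hF.iarr x (by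
      simp [leafRow, Prog.block, Prog.collect, Instr.iarrs]; omega)
    have hrr : M₂.rreg = M₁.rreg := funext fun x => hF.rreg x (by
      simp [leafRow, Prog.block, Prog.collect, Instr.rregs])
    have hra : ∀ x, x < 2 → M₂.rarr x = M₁.rarr x := fun x hx => hF.rarr x (by
      simp [leafRow, Prog.block, Prog.collect, Instr.rarrs]; omega)
    refine ⟨fun x hx => (hr x (.inl hx)).trans (c1 x hx), (hr 35 (.inr rfl)).trans c2,
      fun x hx => (ha x hx).trans (c3 x hx), hrr.trans c4,
      fun x hx => (hra x hx).trans (c5 x hx), fun β hβ l hl => ?_, fun y hy => ?_⟩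
    · rcases Nat.lt_succ_iff_lt_or_eq.1 hβ with hβ | rfl
      · have hlt : addr k J β l < addr k J α 0 := addr_lt_of_lt (by omega) hl
        obtain ⟨e1, e2, e3, e4⟩ := d2 _ (.inl hlt)
        rw [e1, e2, e3, e4]
        exact c8 β hβ l hl
      · have := d1 l hl
        rwa [addr_add, c4] at this
    · rw [← addr_row] at hy
      have hle : addr k J 0 0 ≤ addr k J α 0 := by
        rcases Nat.eq_zero_or_pos α with rfl | hα
        · exact le_rfl
        · exact (addr_lt_of_lt (by omega) (Nat.zero_le k)).le
      exact (c9 y (by omega)).trans (d2 y (by omega))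
  refine .seq (n₁ := 3) (n₂ := 32 * k + 57) (R := fun M' => (∀ x, M'.ireg x = M.ireg x) ∧
    (∀ x, M'.iarr x = M.iarr x) ∧ (∀ x, M'.rarr x = M.rarr x) ∧ M'.rreg 1 = 0 ∧
    M'.rreg 2 = C J ∧ M'.rreg 3 = c J ∧ M'.rreg 4 = C J + c J) ?_ ?_ (by omega)
  · refine .block (by simp) ?_
    simp [Instr.run, h1, hC, hc, h35]
  rintro M₀ ⟨s1, s2, s3, s4, s5, s6, s7⟩
  obtain ⟨g1, g2, g3, g4, g5, g6, g7, g8, g9, g10, g11, g12⟩ := h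
  have hcells : M₀.cells = M.cells := by simp [Mem.cells, s2, s3]
  have b0 : M₀.ireg 31 = k + 1 := (s1 31).trans g5
  have b1 : HasBases k next M₀ := fun j hj α hα => by rw [s2]; exact g9 j hj α hα
  refine .seq (step (M₀ := M₀) (M₁ := M₀) (by decide) (fun _ _ => rfl) ((s1 35).trans h35)
    (fun _ _ => rfl) rfl (fun _ _ => rfl) b0 b1 (by simp) (fun y _ => .refl _ y) (by simp))
    ?_ (n₂ := 24 * k + 43) (by omega)
  rintro M₁ ⟨t1, t2, t3, t4, t5, t6, t7⟩
  refine .seq (step (M₀ := M₀) (by decide) t1 t2 t3 t4 t5 b0 b1 t6 t7 (by simp))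
    ?_ (n₂ := 16 * k + 29) (by omega)
  clear t1 t2 t3 t4 t5 t6 t7 M₁
  rintro M₁ ⟨t1, t2, t3, t4, t5, t6, t7⟩
  refine .seq (step (M₀ := M₀) (by decide) t1 t2 t3 t4 t5 b0 b1 t6 t7 (by simp))
    ?_ (n₂ := 8 * k + 15) (by omega)
  clear t1 t2 t3 t4 t5 t6 t7 M₁
  rintro M₁ ⟨t1, t2, t3, t4, t5, t6, t7⟩
  refine .seq (step (M₀ := M₀) (by decide) t1 t2 t3 t4 t5 b0 b1 t6 t7 (by simp))
    ?_ (n₂ := 1) (by omega)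
  clear t1 t2 t3 t4 t5 t6 t7 M₁
  rintro M₁ ⟨t1, t2, t3, t4, t5, t6, t7⟩
  rw [hcells] at t7
  have u1 : ∀ x, x < 34 → M₁.ireg x = M.ireg x := fun x hx => (t1 x hx).trans (s1 x)
  have u3 : ∀ x, x < 20 → M₁.iarr x = M.iarr x := fun x hx => (t3 x hx).trans (s2 x)
  refine .block (by simp) ?_
  simp only [List.foldl, Instr.run]
  refine ⟨⟨?_, ?_, ?_, ?_, ?_, ?_, ?_, ?_, ?_, ?_, ?_, ?_⟩, by simp [t2], ?_, ?_, ?_⟩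
  · simpa using (u1 _ (by decide)).trans g1
  · simpa using (u1 _ (by decide)).trans g2
  · simpa using (u1 _ (by decide)).trans g3
  · simpa using (u1 _ (by decide)).trans g4
  · simpa using (u1 _ (by decide)).trans g5
  · exact (u3 _ (by decide)).trans g6
  · exact (u3 _ (by decide)).trans g7
  · exact (u3 _ (by decide)).trans g8
  · intro j hj α hα
    exact (congrFun (u3 (16 + α) (by omega)) j).trans (g9 j hj α hα)
  · intro e he heJ
    change M₁.cells.LeafRow k p q C c e
    rcases Nat.lt_succ_iff_lt_or_eq.1 heJ with heJ | rfl
    · exact (g10 e he heJ).congr fun α hα l hl => t7 _ (.inl (addr_lt_of_lt (by omega) hl))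
    · intro α hα l hl
      obtain ⟨f1, f2, f3, f4⟩ := t6 α hα l hl
      refine ⟨?_, ?_, f3, f4⟩
      · rw [f1]
        by_cases hl0 : l = 0 <;> interval_cases α <;> simp [hl0] <;> omega
      · rw [f2]
        interval_cases α
        · simp [s4]
        · simp [s5]
        · simp [s6]
        · simp [s7]
  · intro j hj hj'
    omega
  · intro y hy
    change M₁.cells.flag y = 0
    rw [← addr_node] at hy
    rw [(t7 y (.inr hy)).1]
    refine g12 y (le_trans ?_ hy)
    exact (addr_lt_of_lt (by omega) (Nat.zero_le k)).le
  · exact (t5 0 (by decide)).trans ((s3 0).trans hC)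
  · exact (t5 1 (by decide)).trans ((s3 1).trans hc)
  · exact (congrFun t4 1).trans s4

end RecSP

namespace RecSP

/-! ### The convolutions -/

/-- Store the sum in the real register `7` into the cell in register `43`. -/
def storeCell : Prog :=
  .block [.rstore 2 43 7, .istore 20 43 24, .istore 21 43 47, .istore 22 43 48]

/-- Improve the cell in register `43` by the sum of the cells in the registers `47` and `48`. -/
def relaxCell : Prog :=
  .seq (.block [.iload 51 20 47, .iload 52 20 48]) <|
  .ite (.ine 51 5)
    (.ite (.ine 52 5)
      (.seq (.block [.rload 5 2 47, .rload 6 2 48, .radd 7 5 6, .iload 53 20 43]) <|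
        .ite (.ine 53 5)
          (.seq (.block [.rload 8 2 43]) (.ite (.rle 8 7) .skip storeCell))
          storeCell)
      .skip)
    .skip

/-- The cell `x` is not among the cells being combined, so the sums to compare are unaffected by the
store; the new sum is at most the old minimum and hence bounds all combinations in `S`. -/
theorem storeCell_runs {M : Mem} {x y z : ℕ} (h43 : M.ireg 43 = x) (h47 : M.ireg 47 = y)
    (h48 : M.ireg 48 = z) (h24 : M.ireg 24 = 1) (hy : y ≠ x) (hz : z ≠ x) {S : Set (ℕ × ℕ)}
    (hS : ∀ z ∈ S, z.1 ≠ x ∧ z.2 ≠ x) (hB : M.cells.Best x S) (fy : M.cells.flag y ≠ 0)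
    (fz : M.cells.flag z ≠ 0) (h7 : M.rreg 7 = M.cells.val y + M.cells.val z)
    (hle : M.cells.flag x ≠ 0 → M.cells.val y + M.cells.val z ≤ M.cells.val x) :
    Runs storeCell M 4 fun M' => M'.cells.Best x (insert (y, z) S) ∧
      ∀ a, a ≠ x → M.cells.EqAt M'.cells a := by
  refine .block (by simp) ?_
  simp only [List.foldl, Instr.run]
  refine ⟨⟨fun _ => ⟨.inl ?_, ?_, ?_, ?_⟩, ?_⟩, fun a ha => ?_⟩
  · simp [Mem.cells, h43, h47, h48]
  · simpa [Mem.cells, h43, h47, h48, hy] using fy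
  · simpa [Mem.cells, h43, h47, h48, hz] using fz
  · simpa [Mem.cells, h43, h47, h48, hy, hz] using h7
  · rintro ⟨z₁, z₂⟩ hzS f1 f2
    have hne : z₁ ≠ x ∧ z₂ ≠ x := by
      rcases hzS with hzS | hzS
      · rw [Prod.mk.injEq] at hzS
        exact ⟨hzS.1 ▸ hy, hzS.2 ▸ hz⟩
      · exact hS _ hzS
    refine ⟨by simp [Mem.cells, h43, h24], ?_⟩
    simp [Mem.cells, h43, hne] at f1 f2 ⊢
    rw [h7]
    rcases hzS with hzS | hzS
    · rw [Prod.mk.injEq] at hzS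
      rw [hzS.1, hzS.2]
      rfl
    · obtain ⟨g1, g2⟩ := hB.le _ hzS f1 f2
      exact (hle g1).trans g2
  · simp [Cells.EqAt, Mem.cells, h43, ha]

theorem relaxCell_runs {M : Mem} {x y z : ℕ} (h43 : M.ireg 43 = x) (h47 : M.ireg 47 = y)
    (h48 : M.ireg 48 = z) (h24 : M.ireg 24 = 1) (h5 : M.ireg 5 = 0) (hy : y ≠ x) (hz : z ≠ x)
    {S : Set (ℕ × ℕ)} (hS : ∀ z ∈ S, z.1 ≠ x ∧ z.2 ≠ x) (hB : M.cells.Best x S) :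
    Runs relaxCell M 15 fun M' => M'.cells.Best x (insert (y, z) S) ∧
      ∀ a, a ≠ x → M.cells.EqAt M'.cells a := by
  -- Nothing needs to be stored when a summand is missing or the cell is already at least as good.
  have noop : ∀ M' : Mem, M'.cells = M.cells → (M.cells.flag y ≠ 0 → M.cells.flag z ≠ 0 →
      M.cells.flag x ≠ 0 ∧ M.cells.val x ≤ M.cells.val y + M.cells.val z) →
      M'.cells.Best x (insert (y, z) S) ∧ ∀ a, a ≠ x → M.cells.EqAt M'.cells a := by
    intro M' h hle
    rw [h]
    refine ⟨⟨fun hf => ?_, ?_⟩, fun a _ => .refl _ a⟩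
    · obtain ⟨g1, g2⟩ := hB.mem hf
      exact ⟨.inr g1, g2⟩
    · rintro z' (rfl | hz') f1 f2
      exacts [hle f1 f2, hB.le z' hz' f1 f2]
  refine .seq (n₁ := 2) (n₂ := 13) (R := fun M' => M'.cells = M.cells ∧ M'.ireg 43 = x ∧
    M'.ireg 47 = y ∧ M'.ireg 48 = z ∧ M'.ireg 24 = 1 ∧ M'.ireg 5 = 0 ∧
    M'.ireg 51 = M.cells.flag y ∧ M'.ireg 52 = M.cells.flag z) ?_ ?_ le_rfl
  · refine .block (by simp) ?_
    simp [Instr.run, Mem.cells, h43, h47, h48, h24, h5]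
  rintro M₁ ⟨a1, a2, a3, a4, a5, a6, a7, a8⟩
  refine .ite (n := 12) (fun hb => .ite (n := 11) (fun hb' => ?_) fun hb' => .skip ?_)
    fun hb => .skip ?_
  · simp only [Test.Holds, a6, a7, a8] at hb hb'
    refine .seq (n₁ := 4) (n₂ := 7) (R := fun M' => M'.cells = M.cells ∧ M'.ireg 43 = x ∧
      M'.ireg 47 = y ∧ M'.ireg 48 = z ∧ M'.ireg 24 = 1 ∧ M'.ireg 5 = 0 ∧
      M'.ireg 53 = M.cells.flag x ∧ M'.rreg 7 = M.cells.val y + M.cells.val z) ?_ ?_ le_rfl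
    · refine .block (by simp) ?_
      have v1 : M₁.rarr 2 = M.rarr 2 := congrArg Cells.val a1
      have v2 : M₁.iarr 20 = M.iarr 20 := congrArg Cells.flag a1
      refine ⟨a1, ?_⟩
      simp [Instr.run, Mem.cells, a2, a3, a4, a5, a6, v1, v2]
    rintro M₂ ⟨b1, b2, b3, b4, b5, b6, b7, b8⟩
    have store : ∀ M₃ : Mem, M₃.cells = M₂.cells → M₃.ireg = M₂.ireg → M₃.rreg 7 = M₂.rreg 7 →
        (M.cells.flag x ≠ 0 → M.cells.val y + M.cells.val z ≤ M.cells.val x) →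
        Runs storeCell M₃ 4 fun M' => M'.cells.Best x (insert (y, z) S) ∧
          ∀ a, a ≠ x → M.cells.EqAt M'.cells a := by
      intro M₃ c1 c2 c3 c4
      rw [← b1, ← c1] at hB hb hb' c4 b8 ⊢
      rw [← c2] at b2 b3 b4 b5
      exact storeCell_runs b2 b3 b4 b5 hy hz hS hB hb hb' (c3.trans b8) c4
    refine .ite (n := 6) (fun hc => ?_) fun hc => ?_
    · simp only [Test.Holds, b6, b7] at hc
      refine .seq (n₁ := 1) (n₂ := 5) (R := fun M' => M'.cells = M₂.cells ∧ M'.ireg = M₂.ireg ∧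
        M'.rreg 7 = M₂.rreg 7 ∧ M'.rreg 8 = M.cells.val x) ?_ ?_ le_rfl
      · refine .block (by simp) ?_
        have v1 : M₂.rarr 2 = M.rarr 2 := congrArg Cells.val b1
        simp [Instr.run, Mem.cells, b2, v1]
      rintro M₃ ⟨c1, c2, c3, c4⟩
      refine .ite (n := 4) (fun hd => .skip (noop M₃ (c1.trans b1) fun _ _ => ⟨hc, ?_⟩))
        fun hd => store M₃ c1 c2 c3 fun _ => ?_
      · simpa only [Test.Holds, c3, c4, b8] using hd
      · simp only [Test.Holds, c3, c4, b8, not_le] at hd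
        exact hd.le
    · simp only [Test.Holds, b6, b7, not_not] at hc
      exact (store M₂ rfl rfl rfl fun h => absurd hc h).mono (by omega) fun _ h => h
  · simp only [Test.Holds, a6, a8, not_not] at hb'
    exact noop M₁ a1 fun _ h => absurd hb' h
  · simp only [Test.Holds, a6, a7, not_not] at hb
    exact noop M₁ a1 fun h _ => absurd hb h

/-- Improve the row of the node in register `40` for the mode `α` by the sums of the cells of its
parts, in the registers `41` and `42`, for the modes `α₁` and `α₂`. -/
def relaxRow (α α₁ α₂ : ℕ) : Prog :=
  .seq (.block [.iload 43 (16 + α) 40, .iload 44 (16 + α₁) 41, .iload 45 (16 + α₂) 42,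
    .iconst 46 0]) <|
  .loop (.ilt 46 31) <|
    .seq (.block [.icopy 47 44, .icopy 48 45, .iconst 49 0, .icopy 50 46, .incr 50]) <|
    .seq (.loop (.ilt 49 50) <| .seq relaxCell (.block [.incr 47, .decr 48, .incr 49])) <|
    .block [.incr 46, .incr 43, .incr 45]

theorem relaxCells_runs {M : Mem} {x y z l : ℕ} (h43 : M.ireg 43 = x) (h47 : M.ireg 47 = y)
    (h48 : M.ireg 48 = z + l) (h49 : M.ireg 49 = 0) (h50 : M.ireg 50 = l + 1)
    (h24 : M.ireg 24 = 1) (h5 : M.ireg 5 = 0) (hy : y + l < x) (hz : z + l < x)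
    {S : Set (ℕ × ℕ)} (hS : ∀ z ∈ S, z.1 ≠ x ∧ z.2 ≠ x) (hB : M.cells.Best x S) :
    Runs (.loop (.ilt 49 50) <| .seq relaxCell (.block [.incr 47, .decr 48, .incr 49])) M
      (19 * (l + 1) + 1) fun M' =>
        M'.cells.Best x (S ∪ {w | ∃ i ≤ l, w = (y + i, z + (l - i))}) ∧
          ∀ a, a ≠ x → M.cells.EqAt M'.cells a := by
  -- The two registers run through the cells in opposite directions, keeping the budgets summed to
  -- `l`. The value of register 48 is claimed only for `i ≤ l`: the decrement of the last round
  -- leaves the row, or is truncated at 0.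
  refine (Runs.count (c := 18) (N := l + 1) (fun i M' => M'.ireg 49 = i ∧ M'.ireg 50 = l + 1 ∧
    M'.ireg 43 = x ∧ M'.ireg 47 = y + i ∧ (i ≤ l → M'.ireg 48 = z + (l - i)) ∧ M'.ireg 24 = 1 ∧
    M'.ireg 5 = 0 ∧ M'.cells.Best x (S ∪ {w | ∃ i' < i, w = (y + i', z + (l - i'))}) ∧
    ∀ a, a ≠ x → M.cells.EqAt M'.cells a) (fun i M h => ⟨h.1, h.2.1⟩) ?_ (Nat.zero_le _)
    ⟨h49, h50, h43, h47, fun _ => h48, h24, h5, by simpa using hB, fun a _ => .refl _ a⟩).mono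
      (by omega) fun M' h => ⟨by simpa only [Nat.lt_succ_iff] using h.2.2.2.2.2.2.2.1,
        h.2.2.2.2.2.2.2.2⟩
  rintro i M₁ hi ⟨a1, a2, a3, a4, a5, a6, a7, a8, a9⟩
  have a5 := a5 (by omega)
  refine .seq (n₁ := 15) (n₂ := 3) ((relaxCell_runs a3 a4 a5 a6 a7 (by omega) (by omega)
    ?_ a8).frame) ?_ le_rfl
  · rintro w (hw | ⟨i', hi', rfl⟩)
    · exact hS w hw
    · simp only
      omega
  rintro M₂ ⟨⟨b1, b2⟩, hF⟩
  have hr : ∀ r, r < 51 → M₂.ireg r = M₁.ireg r := fun r hr => hF.ireg r (by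
    simp [relaxCell, storeCell, Prog.block, Prog.collect, Instr.iregs]; omega)
  refine .block (by simp) ?_
  simp only [List.foldl, Instr.run]
  refine ⟨by simp [hr, a1], by simp [hr, a2], by simp [hr, a3], by simp [hr, a4, add_assoc],
    fun hi => ?_, by simp [hr, a6], by simp [hr, a7], ?_, fun a ha => ?_⟩
  · simp only [Function.update_self, Function.update_of_ne (show (48 : ℕ) ≠ 49 by decide),
      Function.update_of_ne (show (48 : ℕ) ≠ 47 by decide), hr 48 (by decide), a5]
    omega
  · change M₂.cells.Best x _
    convert b1 using 1
    ext w
    simp only [Set.mem_union, Set.mem_ofPred_eq, Set.mem_insert_iff, Nat.lt_succ_iff_lt_or_eq]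
    constructor
    · rintro (h | ⟨i', h | rfl, rfl⟩)
      exacts [.inr (.inl h), .inr (.inr ⟨i', h, rfl⟩), .inl rfl]
    · rintro (rfl | h | ⟨i', h, rfl⟩)
      exacts [.inr ⟨i, .inr rfl, rfl⟩, .inl h, .inr ⟨i', .inl h, rfl⟩]
  · exact (a9 a ha).trans (b2 a ha)

/-- All cells that are read lie below the row being written. Thus improving one cell neither
invalidates the finished cells of the row nor changes the sums for the later ones. -/
theorem relaxRow_runs {M : Mem} {α α₁ α₂ x y z k : ℕ} (hx : M.iarr (16 + α) (M.ireg 40) = x)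
    (hy : M.iarr (16 + α₁) (M.ireg 41) = y) (hz : M.iarr (16 + α₂) (M.ireg 42) = z)
    (h31 : M.ireg 31 = k + 1) (h24 : M.ireg 24 = 1) (h5 : M.ireg 5 = 0) (hyx : y + k < x)
    (hzx : z + k < x) {S : ℕ → Set (ℕ × ℕ)} (hS : ∀ l ≤ k, ∀ w ∈ S l, w.1 < x ∧ w.2 < x)
    (hB : ∀ l ≤ k, M.cells.Best (x + l) (S l)) :
    Runs (relaxRow α α₁ α₂) M ((19 * (k + 1) + 10) * (k + 1) + 5) fun M' =>
      (∀ l ≤ k, M'.cells.Best (x + l) (S l ∪ {w | ∃ i ≤ l, w = (y + i, z + (l - i))})) ∧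
        ∀ a, (a < x ∨ x + k < a) → M.cells.EqAt M'.cells a := by
  refine .seq (n₁ := 4) (n₂ := (19 * (k + 1) + 10) * (k + 1) + 1) (R := fun M' =>
    M'.ireg 43 = x ∧ M'.ireg 44 = y ∧ M'.ireg 45 = z ∧ M'.ireg 46 = 0 ∧ M'.ireg 31 = k + 1 ∧
    M'.ireg 24 = 1 ∧ M'.ireg 5 = 0 ∧ M'.cells = M.cells) ?_ ?_ (by omega)
  · refine .block (by simp) ?_
    simp [Instr.run, Mem.cells, hx, hy, hz, h31, h24, h5]
  rintro M₁ ⟨a1, a2, a3, a4, a5, a6, a7, a8⟩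
  rw [← a8] at hB ⊢
  refine (Runs.count (c := 19 * (k + 1) + 9) (N := k + 1) (fun l M' => M'.ireg 46 = l ∧
    M'.ireg 31 = k + 1 ∧ M'.ireg 43 = x + l ∧ M'.ireg 44 = y ∧ M'.ireg 45 = z + l ∧
    M'.ireg 24 = 1 ∧ M'.ireg 5 = 0 ∧
    (∀ l' < l, M'.cells.Best (x + l') (S l' ∪ {w | ∃ i ≤ l', w = (y + i, z + (l' - i))})) ∧
    (∀ l', l ≤ l' → l' ≤ k → M'.cells.Best (x + l') (S l')) ∧
    ∀ a, (a < x ∨ x + k < a) → M₁.cells.EqAt M'.cells a) (fun i M h => ⟨h.1, h.2.1⟩) ?_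
    (Nat.zero_le _) ⟨a4, a5, a1, a2, a3, a6, a7, by simp, fun l' _ => hB l',
      fun a _ => .refl _ a⟩).mono (by simp) fun M' h =>
        ⟨fun l hl => h.2.2.2.2.2.2.2.1 l (by omega), h.2.2.2.2.2.2.2.2.2⟩
  clear a1 a2 a3 a4 a5 a6 a7 a8 h31 h24 h5 hx hy hz
  rintro l M₂ hl ⟨b1, b2, b3, b4, b5, b6, b7, b8, b9, b10⟩
  refine .seq (n₁ := 5) (n₂ := 19 * (k + 1) + 4) (R := fun M' => M'.ireg 43 = x + l ∧
    M'.ireg 47 = y ∧ M'.ireg 48 = z + l ∧ M'.ireg 49 = 0 ∧ M'.ireg 50 = l + 1 ∧ M'.ireg 24 = 1 ∧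
    M'.ireg 5 = 0 ∧ M'.cells = M₂.cells ∧ M'.ireg 46 = l ∧ M'.ireg 31 = k + 1 ∧
    M'.ireg 44 = y ∧ M'.ireg 45 = z + l) ?_ ?_ (by omega)
  · refine .block (by simp) ?_
    simp [Instr.run, Mem.cells, b1, b2, b3, b4, b5, b6, b7]
  rintro M₃ ⟨c1, c2, c3, c4, c5, c6, c7, c8, c9, c10, c11, c12⟩
  have hB' := b9 l le_rfl (by omega)
  rw [← c8] at hB'
  refine .seq (n₁ := 19 * (k + 1) + 1) (n₂ := 3) ((relaxCells_runs c1 c2 c3 c4 c5 c6 c7 (by omega)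
    (by omega) (fun w hw => ?_) hB').frame.mono (by omega) fun _ h => h) ?_ (by omega)
  · have := hS l (by omega) w hw
    omega
  rintro M₄ ⟨⟨d1, d2⟩, hF⟩
  rw [c8] at d2
  have hr : ∀ r, r < 47 → M₄.ireg r = M₃.ireg r := fun r hr => hF.ireg r (by
    simp [relaxCell, storeCell, Prog.block, Prog.collect, Instr.iregs]; omega)
  refine .block (by simp) ?_
  simp only [List.foldl, Instr.run]
  refine ⟨by simp [hr, c9], by simp [hr, c10], by simp [hr, c1, add_assoc], by simp [hr, c11],
    by simp [hr, c12, add_assoc], by simp [hr, c6], by simp [hr, c7], fun l' hl' => ?_,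
    fun l' hl' hk => ?_, fun a ha => ?_⟩
  · change M₄.cells.Best _ _
    rcases Nat.lt_succ_iff_lt_or_eq.1 hl' with hl' | rfl
    · refine (b8 l' hl').congr (d2 _ (by omega)) ?_
      rintro w (hw | ⟨i, hi, rfl⟩)
      · have := hS l' (by omega) w hw
        exact ⟨d2 _ (by omega), d2 _ (by omega)⟩
      · exact ⟨d2 _ (by simp only; omega), d2 _ (by simp only; omega)⟩
    · exact d1
  · change M₄.cells.Best _ _
    refine (b9 l' (by omega) hk).congr (d2 _ (by omega)) fun w hw => ?_
    have := hS l' hk w hw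
    exact ⟨d2 _ (by omega), d2 _ (by omega)⟩
  · exact (b10 a ha).trans (d2 a (by omega))

/-- Improve the rows of the node in register `40` by all given rules. -/
def relaxAll : List (ℕ × ℕ × ℕ) → Prog
  | [] => .skip
  | r :: rs => .seq (relaxRow r.1 r.2.1 r.2.2) (relaxAll rs)

theorem Frame.relaxRow {α α₁ α₂ : ℕ} {M M' : Mem} (h : Frame (relaxRow α α₁ α₂) M M') :
    (∀ r, r < 43 → M'.ireg r = M.ireg r) ∧ ∀ a, a < 20 → M'.iarr a = M.iarr a := by
  constructor
  · intro r hr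
    refine h.ireg r ?_
    simp [RecSP.relaxRow, relaxCell, storeCell, Prog.block, Prog.collect, Instr.iregs]; omega
  · intro r hr
    refine h.iarr r ?_
    simp [RecSP.relaxRow, relaxCell, storeCell, Prog.block, Prog.collect, Instr.iarrs]; omega

theorem combos_append (k a b : ℕ) (rules : List (ℕ × ℕ × ℕ)) (r : ℕ × ℕ × ℕ) (α l : ℕ) :
    combos k a b (rules ++ [r]) α l = combos k a b rules α l ∪
      {w | α = r.1 ∧ ∃ i ≤ l, w = (addr k a r.2.1 i, addr k b r.2.2 (l - i))} := by
  obtain ⟨r₁, r₂, r₃⟩ := r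
  ext w
  simp only [combos, List.mem_append, List.mem_singleton, Set.mem_ofPred_eq, Set.mem_union,
    Prod.mk.injEq]
  constructor
  · rintro ⟨α₁, α₂, i, h | ⟨rfl, rfl, rfl⟩, hi, rfl⟩
    exacts [.inl ⟨α₁, α₂, i, h, hi, rfl⟩, .inr ⟨rfl, i, hi, rfl⟩]
  · rintro (⟨α₁, α₂, i, h, hi, rfl⟩ | ⟨rfl, i, hi, rfl⟩)
    exacts [⟨α₁, α₂, i, .inl h, hi, rfl⟩, ⟨_, _, i, .inr ⟨rfl, rfl, rfl⟩, hi, rfl⟩]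

theorem combos_lt {k a b j α l : ℕ} {rules : List (ℕ × ℕ × ℕ)} (ha : a < j) (hb : b < j)
    (hr : ∀ r ∈ rules, r.2.1 < 4 ∧ r.2.2 < 4) (hl : l ≤ k) {w : ℕ × ℕ}
    (hw : w ∈ combos k a b rules α l) : w.1 < addr k j 0 0 ∧ w.2 < addr k j 0 0 := by
  obtain ⟨α₁, α₂, i, h, hi, rfl⟩ := hw
  have := hr _ h
  exact ⟨addr_lt_of_lt (by simp only at this; omega) (by omega),
    addr_lt_of_lt (by simp only at this; omega) (by omega)⟩

/-- The rules in `done` have been applied. A further rule affects only the row of its own mode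
`r.1`, where it enlarges the set of combinations minimized over. -/
theorem relaxAll_runs {k next j a b : ℕ} {rest done : List (ℕ × ℕ × ℕ)} {M : Mem}
    (hbase : HasBases k next M) (h40 : M.ireg 40 = j) (h41 : M.ireg 41 = a) (h42 : M.ireg 42 = b)
    (ha : a < j) (hb : b < j) (hj : j < next) (h31 : M.ireg 31 = k + 1) (h24 : M.ireg 24 = 1)
    (h5 : M.ireg 5 = 0) (hd : ∀ r ∈ done, r.2.1 < 4 ∧ r.2.2 < 4)
    (hr : ∀ r ∈ rest, r.1 < 4 ∧ r.2.1 < 4 ∧ r.2.2 < 4)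
    (hB : ∀ α < 4, ∀ l ≤ k, M.cells.Best (addr k j α l) (combos k a b done α l)) :
    Runs (relaxAll rest) M (((19 * (k + 1) + 10) * (k + 1) + 5) * rest.length) fun M' =>
      (∀ α < 4, ∀ l ≤ k, M'.cells.Best (addr k j α l) (combos k a b (done ++ rest) α l)) ∧
        (∀ y, (y < addr k j 0 0 ∨ addr k (j + 1) 0 0 ≤ y) → M.cells.EqAt M'.cells y) ∧
        (∀ r, r < 43 → M'.ireg r = M.ireg r) ∧ ∀ a, a < 20 → M'.iarr a = M.iarr a := by
  induction rest generalizing M done with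
  | nil =>
    exact .skip ⟨by simpa using hB, fun y _ => .refl _ y, fun _ _ => rfl, fun _ _ => rfl⟩
  | cons r rest ih =>
    obtain ⟨r1, r2, r3⟩ := hr r (by simp)
    have lt : ∀ {i β}, i < j → β < 4 → addr k i β 0 + k < addr k j r.1 0 := by
      intro i β hi hβ
      rw [addr_add]
      exact addr_lt_of_lt (by omega) le_rfl
    have hle : addr k j 0 0 ≤ addr k j r.1 0 :=
      Nat.add_le_add_right (Nat.mul_le_mul_right _ (by omega)) _
    have hlt : addr k j r.1 0 + k < addr k (j + 1) 0 0 := by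
      rw [addr_add]
      exact addr_lt_of_lt (by omega) le_rfl
    refine .seq ((relaxRow_runs (x := addr k j r.1 0) (y := addr k a r.2.1 0)
      (z := addr k b r.2.2 0) (by rw [h40]; exact hbase j hj _ r1)
      (by rw [h41]; exact hbase a (by omega) _ r2) (by rw [h42]; exact hbase b (by omega) _ r3)
      h31 h24 h5 (lt ha r2) (lt hb r3) (S := combos k a b done r.1) (fun l hl w hw => ?_)
      (fun l hl => ?_)).frame) ?_ (n₂ := ((19 * (k + 1) + 10) * (k + 1) + 5) * rest.length) ?_
    · have := combos_lt ha hb hd hl hw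
      omega
    · rw [addr_add]
      exact hB _ r1 l hl
    swap
    · rw [List.length_cons]
      linarith
    rintro M₁ ⟨⟨e1, e2⟩, hF⟩
    obtain ⟨f1, f2⟩ := hF.relaxRow
    refine (ih (M := M₁) (done := done ++ [r]) ?_ ?_ ?_ ?_ ?_ ?_ ?_ ?_ ?_ ?_).mono le_rfl ?_
    · intro i hi α hα
      rw [f2 _ (by omega)]
      exact hbase i hi α hα
    · exact (f1 _ (by decide)).trans h40
    · exact (f1 _ (by decide)).trans h41
    · exact (f1 _ (by decide)).trans h42
    · exact (f1 _ (by decide)).trans h31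
    · exact (f1 _ (by decide)).trans h24
    · exact (f1 _ (by decide)).trans h5
    · intro r' hr'
      rcases List.mem_append.1 hr' with hr' | hr'
      · exact hd r' hr'
      · obtain rfl := List.mem_singleton.1 hr'
        exact ⟨r2, r3⟩
    · exact fun r' hr' => hr r' (by simp [hr'])
    · intro α hα l hl
      rw [combos_append]
      by_cases hαr : α = r.1
      · subst hαr
        have := e1 l hl
        simp only [addr_add] at this
        simpa using this
      · have hne : ∀ l ≤ k, M.cells.EqAt M₁.cells (addr k j α l) := by
          intro l hl
          refine e2 _ ?_
          rcases Nat.lt_or_gt_of_ne hαr with h | h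
          · exact .inl (addr_lt_of_lt (by omega) hl)
          · right
            rw [addr_add]
            exact addr_lt_of_lt (by omega) le_rfl
        simp only [hαr, false_and, Set.ofPred_false, Set.union_empty]
        refine (hB α hα l hl).congr (hne l hl) fun w hw => ?_
        have := combos_lt ha hb hd hl hw
        exact ⟨e2 _ (by omega), e2 _ (by omega)⟩
    · rintro M₂ ⟨g1, g2, g3, g4⟩
      refine ⟨by simpa using g1, fun y hy => (e2 y (by omega)).trans (g2 y hy),
        fun r hr => (g3 r hr).trans (f1 r hr), fun r hr => (g4 r hr).trans (f2 r hr)⟩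

/-- Fill the rows of all nodes that are not arcs. -/
def convolutions : Prog :=
  .seq (.block [.icopy 40 1]) <|
  .loop (.ilt 40 21) <|
    .seq (.block [.iload 41 13 40, .iload 42 14 40, .iload 51 15 40]) <|
    .seq (.ite (.ieq 51 5) (relaxAll serRules) (relaxAll parRules)) <|
    .block [.incr 40]

theorem convolutions_runs {m next k p q : ℕ} {D : ℕ → SPTree ℕ} {L R ty : ℕ → ℕ} {C c : ℕ → ℝ}
    {F : Multiset Edge} {M : Mem} (hO : Ops m next D L R ty F)
    (h : TableMem m next k p q m L R ty C c M) :
    Runs convolutions M ((((19 * (k + 1) + 10) * (k + 1) + 5) * 9 + 6) * (next - m) + 2)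
      (TableMem m next k p q next L R ty C c) := by
  refine .seq (n₁ := 1) (n₂ := (((19 * (k + 1) + 10) * (k + 1) + 5) * 9 + 6) * (next - m) + 1)
    (R := fun M => TableMem m next k p q m L R ty C c M ∧ M.ireg 40 = m) ?_ ?_ (by omega)
  · refine .block (by simp) ?_
    simp only [List.foldl, Instr.run]
    obtain ⟨g1, g2, g3, g4, g5, g6, g7, g8, g9, g10, g11, g12⟩ := h
    exact ⟨⟨by simp [g1], by simp [g2], by simp [g3], by simp [g4], by simp [g5], g6, g7, g8, g9,
      g10, g11, g12⟩, by simp [g1]⟩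
  clear h M
  rintro M ⟨h, h40⟩
  refine (Runs.count (c := ((19 * (k + 1) + 10) * (k + 1) + 5) * 9 + 5) (N := next) (fun J M =>
    m ≤ J ∧ TableMem m next k p q J L R ty C c M ∧ M.ireg 40 = J)
    (fun i M h => ⟨h.2.2, h.2.1.r21⟩) ?_ hO.le ⟨le_rfl, h, h40⟩).mono le_rfl fun M h => h.2.1
  clear h h40 M
  rintro J M hJ ⟨hmJ, h, h40⟩
  obtain ⟨hL, hR, -⟩ := hO.node J hmJ hJ
  refine .seq (n₁ := 3) (n₂ := ((19 * (k + 1) + 10) * (k + 1) + 5) * 9 + 2) (R := fun M =>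
    TableMem m next k p q J L R ty C c M ∧ M.ireg 40 = J ∧ M.ireg 41 = L J ∧ M.ireg 42 = R J ∧
      M.ireg 51 = ty J) ?_ ?_ (by omega)
  · refine .block (by simp) ?_
    simp only [List.foldl, Instr.run]
    obtain ⟨g1, g2, g3, g4, g5, g6, g7, g8, g9, g10, g11, g12⟩ := h
    exact ⟨⟨by simp [g1], by simp [g2], by simp [g3], by simp [g4], by simp [g5], g6, g7, g8, g9,
      g10, g11, g12⟩, by simp [h40], by simp [h40, g6], by simp [h40, g7], by simp [h40, g8]⟩
  clear h h40 M
  rintro M ⟨h, h40, h41, h42, h51⟩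
  obtain ⟨g1, g2, g3, g4, g5, g6, g7, g8, g9, g10, g11, g12⟩ := h
  have run : ∀ rules, (∀ r ∈ rules, r.1 < 4 ∧ r.2.1 < 4 ∧ r.2.2 < 4) → rules.length ≤ 9 →
      Runs (relaxAll rules) M (((19 * (k + 1) + 10) * (k + 1) + 5) * 9) fun M' =>
      (∀ α < 4, ∀ l ≤ k, M'.cells.Best (addr k J α l) (combos k (L J) (R J) rules α l)) ∧
        (∀ y, (y < addr k J 0 0 ∨ addr k (J + 1) 0 0 ≤ y) → M.cells.EqAt M'.cells y) ∧
        (∀ r, r < 43 → M'.ireg r = M.ireg r) ∧ ∀ a, a < 20 → M'.iarr a = M.iarr a := by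
    intro rules hr hlen
    refine (relaxAll_runs (done := []) g9 h40 h41 h42 hL hR hJ g5 g4 g2 (by simp) hr
      fun α hα l hl => ?_).mono (Nat.mul_le_mul_left _ hlen) fun _ h => h
    -- Without rules there are no combinations, and an unflagged cell is a best one among none.
    have : M.cells.flag (addr k J α l) = 0 :=
      g12 _ (Nat.add_le_add (Nat.mul_le_mul_right _ (by omega)) (Nat.zero_le l))
    refine ⟨fun h => absurd this h, ?_⟩
    rintro z ⟨_, _, _, hz, -⟩
    simp at hz
  have run' : Runs (.ite (.ieq 51 5) (relaxAll serRules) (relaxAll parRules)) M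
      (((19 * (k + 1) + 10) * (k + 1) + 5) * 9 + 1) fun M' =>
      (∀ α < 4, ∀ l ≤ k, M'.cells.Best (addr k J α l)
        (combos k (L J) (R J) (rulesOf (ty J)) α l)) ∧
        (∀ y, (y < addr k J 0 0 ∨ addr k (J + 1) 0 0 ≤ y) → M.cells.EqAt M'.cells y) ∧
        (∀ r, r < 43 → M'.ireg r = M.ireg r) ∧ ∀ a, a < 20 → M'.iarr a = M.iarr a := by
    refine .ite (fun hb => ?_) fun hb => ?_
    · simp only [Test.Holds, h51, g2] at hb
      rw [rulesOf, if_pos hb]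
      exact run serRules (by decide) (by decide)
    · simp only [Test.Holds, h51, g2] at hb
      rw [rulesOf, if_neg hb]
      exact run parRules (by decide) (by decide)
  refine .seq run' ?_ (n₂ := 1) (by omega)
  rintro M' ⟨e1, e2, e3, e4⟩
  refine .block (by simp) ?_
  simp only [List.foldl, Instr.run]
  have lt_of : ∀ {e α l}, e < J → α < 4 → l ≤ k → addr k e α l < addr k J 0 0 :=
    fun he hα hl => addr_lt_of_lt (by omega) hl
  refine ⟨by omega, ⟨?_, ?_, ?_, ?_, ?_, ?_, ?_, ?_, ?_, ?_, ?_, ?_⟩, ?_⟩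
  · simpa using (e3 _ (by decide)).trans g1
  · simpa using (e3 _ (by decide)).trans g2
  · simpa using (e3 _ (by decide)).trans g3
  · simpa using (e3 _ (by decide)).trans g4
  · simpa using (e3 _ (by decide)).trans g5
  · exact (e4 _ (by decide)).trans g6
  · exact (e4 _ (by decide)).trans g7
  · exact (e4 _ (by decide)).trans g8
  · intro j hj α hα
    exact (congrFun (e4 (16 + α) (by omega)) j).trans (g9 j hj α hα)
  · intro e he _
    change M'.cells.LeafRow k p q C c e
    exact (g10 e he (by omega)).congr fun α hα l hl => e2 _ (.inl (lt_of (by omega) hα hl))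
  · intro j hj hj' α hα l hl
    change M'.cells.Best _ _
    rcases Nat.lt_succ_iff_lt_or_eq.1 hj' with hj' | rfl
    · obtain ⟨hL', hR', -⟩ := hO.node j hj (by omega)
      refine (g11 j hj hj' α hα l hl).congr (e2 _ (.inl (lt_of hj' hα hl))) fun w hw => ?_
      have := combos_lt hL' hR' (fun r hr => (rulesOf_lt r hr).2) hl hw
      have := lt_of hj' (show 0 < 4 by decide) (Nat.zero_le k)
      exact ⟨e2 _ (by omega), e2 _ (by omega)⟩
    · exact e1 α hα l hl
  · intro y hy
    change M'.cells.flag y = 0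
    rw [(e2 y (.inr hy)).1]
    refine g12 y (le_trans ?_ hy)
    exact (addr_lt_of_lt (by omega) (Nat.zero_le k)).le
  · simpa [h40] using e3 40 (by decide)

end RecSP

namespace RecSP

/-! ### Reading off the solution -/

/-- The integer array `23` becomes the list of the cells that the nodes contribute to the optimal
solution. -/
def traceback : Prog :=
  .seq (.block [.iload 60 7 4, .decr 60, .iload 61 19 60, .iconst 34 0]) <|
  .seq (.loop (.ilt 34 2) <| .block [.incr 61, .incr 34]) <|
  .seq (.block [.istore 23 60 61, .rload 0 2 61, .icopy 62 21]) <|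
  .loop (.ilt 1 62) <| .block [.decr 62, .iload 61 23 62, .iload 63 13 62, .iload 64 14 62,
    .iload 65 21 61, .iload 66 22 61, .istore 23 63 65, .istore 23 64 66]

/-- The integer arrays `2` and `3` become the characteristic vectors of the two paths. -/
def readout : Prog :=
  .seq (.block [.iconst 35 0]) <|
  .loop (.ilt 35 1) <| .block [.iload 61 23 35, .iload 65 21 61, .iload 66 22 61, .istore 2 35 65,
    .istore 3 35 66, .incr 35]

/-- Going down from the highest node, every node passes the cells named by its back pointers to its
parts. A node is a part of at most one other node and parts have smaller numbers, so an entry is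
neither overwritten nor changed after it has been used. -/
theorem traceback_runs {m next k t root : ℕ} {D : ℕ → SPTree ℕ} {L R ty : ℕ → ℕ} {E : Edge}
    {M : Mem} (hO : Ops m next D L R ty {E}) (hE : E.id = root) (hbase : HasBases k next M)
    (h1 : M.ireg 1 = m) (h2 : M.ireg 2 = k) (h4 : M.ireg 4 = t) (h21 : M.ireg 21 = next)
    (h13 : M.iarr 13 = L) (h14 : M.iarr 14 = R) (h7 : M.iarr 7 t = root + 1) :
    Runs traceback M (3 * k + 9 * next + 9) fun M' => M'.ireg 1 = m ∧ M'.cells = M.cells ∧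
      M'.rreg 0 = M.cells.val (M'.iarr 23 root) ∧ M'.iarr 23 root = addr k root 3 k ∧
      ∀ j, m ≤ j → j < next → M'.iarr 23 (L j) = M.cells.bp (M'.iarr 23 j) ∧
        M'.iarr 23 (R j) = M.cells.bq (M'.iarr 23 j) := by
  have hroot : root < next := hE ▸ hO.lt E (by simp)
  refine .seq (n₁ := 4) (n₂ := 3 * k + 9 * next + 5) (R := fun M' => M'.ireg 60 = root ∧
    M'.ireg 61 = addr k root 3 0 ∧ M'.ireg 34 = 0 ∧ M'.ireg 1 = m ∧ M'.ireg 2 = k ∧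
    M'.ireg 21 = next ∧ M'.iarr = M.iarr ∧ M'.rarr = M.rarr) ?_ ?_ (by omega)
  · refine .block (by simp) ?_
    have := hbase root hroot 3 (by decide)
    simp [Instr.run, h1, h2, h4, h21, h7, this]
  rintro M₁ ⟨a1, a2, a3, a4, a5, a6, a7, a8⟩
  refine .seq (n₁ := 3 * k + 1) (n₂ := 9 * next + 4) (R := fun M' => M'.ireg 60 = root ∧
    M'.ireg 61 = addr k root 3 k ∧ M'.ireg 1 = m ∧ M'.ireg 21 = next ∧ M'.iarr = M.iarr ∧
    M'.rarr = M.rarr) ?_ ?_ (by omega)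
  · refine (Runs.count (c := 2) (N := k) (fun i M' => M'.ireg 34 = i ∧ M'.ireg 2 = k ∧
      M'.ireg 60 = root ∧ M'.ireg 61 = addr k root 3 0 + i ∧ M'.ireg 1 = m ∧ M'.ireg 21 = next ∧
      M'.iarr = M.iarr ∧ M'.rarr = M.rarr) (fun i M h => ⟨h.1, h.2.1⟩) ?_ (Nat.zero_le k)
      ⟨a3, a5, a1, a2, a4, a6, a7, a8⟩).mono (by omega) ?_
    · rintro i M' hi ⟨b1, b2, b3, b4, b5, b6, b7, b8⟩
      refine .block (by simp) ?_
      simp [Instr.run, b1, b2, b3, b4, b5, b6, b7, b8, add_assoc]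
    · rintro M' ⟨b1, b2, b3, b4, b5, b6, b7, b8⟩
      exact ⟨b3, by rw [b4, addr_add], b5, b6, b7, b8⟩
  clear a1 a2 a3 a4 a5 a6 a7 a8 M₁
  rintro M₁ ⟨a1, a2, a3, a4, a5, a6⟩
  refine .seq (n₁ := 3) (n₂ := 9 * next + 1) (R := fun M' => M'.ireg 62 = next ∧ M'.ireg 1 = m ∧
    M'.cells = M.cells ∧ M'.rreg 0 = M.cells.val (addr k root 3 k) ∧
    M'.iarr 23 root = addr k root 3 k ∧ M'.iarr 13 = L ∧ M'.iarr 14 = R) ?_ ?_ (by omega)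
  · refine .block (by simp) ?_
    simp [Instr.run, Mem.cells, a1, a2, a3, a4, a5, a6, h13, h14]
  clear a1 a2 a3 a4 a5 a6 M₁
  rintro M₁ ⟨a1, a2, a3, a4, a5, a6, a7⟩
  refine (Runs.loop (c := 8) (j := next) (fun J M' => J ≤ next ∧ M'.ireg 62 = J ∧ M'.ireg 1 = m ∧
    M'.cells = M.cells ∧ M'.rreg 0 = M.cells.val (addr k root 3 k) ∧
    M'.iarr 23 root = addr k root 3 k ∧ M'.iarr 13 = L ∧ M'.iarr 14 = R ∧
    ∀ j, m ≤ j → J ≤ j → j < next → M'.iarr 23 (L j) = M.cells.bp (M'.iarr 23 j) ∧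
        M'.iarr 23 (R j) = M.cells.bq (M'.iarr 23 j)) ?_
    ⟨le_rfl, a1, a2, a3, a4, a5, a6, a7, fun j _ _ _ => by omega⟩).mono (by omega) ?_
  · rintro J M' ⟨b0, b1, b2, b3, b4, b5, b6, b7, b8⟩ hb
    simp only [Test.Holds, b1, b2] at hb
    obtain ⟨J, rfl⟩ : ∃ i, J = i + 1 := ⟨J - 1, by omega⟩
    refine .block (by simp) ⟨J, by omega, ?_⟩
    simp only [List.foldl, Instr.run]
    obtain ⟨lL, lR, -⟩ := hO.node J (by omega) (by omega)
    -- The root is a part of no node, so its entry stays the cell of mode 3 with the full budget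
    -- `k`.
    have hu := hO.used J (by omega) (by omega) E (by simp)
    rw [hE] at hu
    have v1 : M'.iarr 21 = M.cells.bp := congrArg Cells.bp b3
    have v2 : M'.iarr 22 = M.cells.bq := congrArg Cells.bq b3
    refine ⟨by omega, by simp [b1], by simp [b2], ?_, b4, ?_, by simpa using b6, by simpa using b7,
      fun j hm hj hj' => ?_⟩
    · rw [← b3]
      simp [Mem.cells]
    · simp [b1, b6, b7, hu.1.symm, hu.2.symm, b5]
    · rcases Nat.eq_or_lt_of_le hj with rfl | hj
      · have := hO.disj J J (by omega) (by omega) (by omega) (by omega)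
        simp [b1, b6, b7, v1, v2, lL.ne', lR.ne', this]
      · have := b8 j hm hj hj'
        have e1 : L j ≠ L J := fun h => by
          have := hO.injL j J (by omega) (by omega) (by omega) (by omega) h
          omega
        have e2 : R j ≠ R J := fun h => by
          have := hO.injR j J (by omega) (by omega) (by omega) (by omega) h
          omega
        have e3 := hO.disj j J (by omega) (by omega) (by omega) (by omega)
        have e4 := (hO.disj J j (by omega) (by omega) (by omega) (by omega)).symm
        have e5 : j ≠ L J := by omega
        have e6 : j ≠ R J := by omega
        simp [b1, b6, b7, e1, e2, e3, e4, e5, e6, this]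
  · rintro M' ⟨⟨J, b0, b1, b2, b3, b4, b5, b6, b7, b8⟩, hb⟩
    simp only [Test.Holds, b1, b2] at hb
    exact ⟨b2, b3, by rw [b4, b5], b5, fun j hm hj => b8 j hm (by omega) hj⟩

theorem readout_runs {m : ℕ} {M : Mem} (h1 : M.ireg 1 = m) :
    Runs readout M (7 * m + 2) fun M' => ∀ e < m,
      M'.iarr 2 e = M.cells.bp (M.iarr 23 e) ∧ M'.iarr 3 e = M.cells.bq (M.iarr 23 e) := by
  refine .seq (n₁ := 1) (n₂ := 7 * m + 1) (R := fun M' => M'.ireg 35 = 0 ∧ M'.ireg 1 = m ∧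
    M'.iarr = M.iarr) ?_ ?_ (by omega)
  · refine .block (by simp) ?_
    simp [Instr.run, h1]
  rintro M₁ ⟨a1, a2, a3⟩
  refine (Runs.count (c := 6) (N := m) (fun i M' => M'.ireg 35 = i ∧ M'.ireg 1 = m ∧
    M'.iarr 21 = M.iarr 21 ∧ M'.iarr 22 = M.iarr 22 ∧ M'.iarr 23 = M.iarr 23 ∧ ∀ e < i,
      M'.iarr 2 e = M.cells.bp (M.iarr 23 e) ∧ M'.iarr 3 e = M.cells.bq (M.iarr 23 e))
    (fun i M h => ⟨h.1, h.2.1⟩) ?_ (Nat.zero_le m) ⟨a1, a2, by rw [a3], by rw [a3], by rw [a3],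
      fun e he => by omega⟩).mono (by omega) fun M' h => h.2.2.2.2.2
  rintro i M' hi ⟨b1, b2, b3, b4, b5, b6⟩
  refine .block (by simp) ?_
  simp only [List.foldl, Instr.run]
  refine ⟨by simp [b1], by simp [b2], by simp [b3], by simp [b4], by simp [b5], fun e he => ?_⟩
  rcases Nat.lt_succ_iff_lt_or_eq.1 he with he | rfl
  · have := b6 e he
    simp [b1, he.ne, this]
  · simp [b1, b3, b4, b5, Mem.cells]

/-! ### The algorithm -/

/-- The algorithm, with the weights `p` of `X \ Y` and `q` of `Y \ X`. -/
def recSP (p q : ℕ) : Prog :=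
  .seq (.seq adjacency decompose) <| .seq bases <| .seq (leaves p q) <| .seq convolutions <|
    .seq traceback readout

/-- The weights of the set differences in the definition of a neighborhood. -/
def NeighborhoodKind.weights : NeighborhoodKind → ℕ × ℕ
  | .incl => (0, 1)
  | .excl => (1, 0)
  | .sym => (1, 1)

/-- The sets of arc numbers of the paths. -/
def Instance.paths (I : Instance) : Set (Finset ℕ) :=
  (Finset.map Fin.valEmbedding) '' I.G.simplePaths I.s I.t

theorem toArray_val {α : Type} [Zero α] {m : ℕ} (f : Fin m → α) (e : Fin m) :
    toArray f e = f e := by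
  simp [toArray]

theorem Instance.exists_tree {I : Instance} (h : IsASP I.G I.s I.t) :
    ∃ T : SPTree ℕ, T.WF (toArray fun e => (I.G.tail e : ℕ)) (toArray fun e => (I.G.head e : ℕ)) ∧
      T.src (toArray fun e => (I.G.tail e : ℕ)) = I.s ∧
      T.tgt (toArray fun e => (I.G.head e : ℕ)) = I.t ∧ T.edges = Multiset.range I.m ∧
      T.lang (fun a => {{a}}) = I.paths := by
  obtain ⟨T, wf, src, tgt, nd, all⟩ := h.exists_tree
  have hu : ∀ e : Fin I.m, toArray (fun e => (I.G.tail e : ℕ)) (e : ℕ) = (I.G.tail e : ℕ) :=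
    toArray_val _
  have hw : ∀ e : Fin I.m, toArray (fun e => (I.G.head e : ℕ)) (e : ℕ) = (I.G.head e : ℕ) :=
    toArray_val _
  refine ⟨T.map Fin.val, wf.map (φ := Fin.val) hu hw Fin.val_injective,
    (SPTree.src_map (φ := Fin.val) hu T).trans (by rw [src]),
    (SPTree.tgt_map (φ := Fin.val) hw T).trans (by rw [tgt]), ?_, ?_⟩
  · rw [SPTree.edges_map]
    refine (Multiset.Nodup.ext (nd.map Fin.val_injective) (Multiset.nodup_range _)).2 fun a => ?_
    simp only [Multiset.mem_map, Multiset.mem_range]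
    exact ⟨fun ⟨e, _, he⟩ => he ▸ e.2, fun ha => ⟨⟨a, ha⟩, all _, rfl⟩⟩
  · have := Multidigraph.simplePaths_eq_lang wf all
    rw [Instance.paths, ← src, ← tgt, this, SPTree.lang_map, ← SPTree.lang_image]
    simp [Finset.map_singleton]

/-- For the symmetric difference the two set differences are disjoint, so their cardinalities add up
to weights `p = q = 1`. -/
theorem Instance.feasible_iff (I : Instance) (N : NeighborhoodKind) (X Y : Finset (Fin I.m)) :
    I.Feasible N X Y ↔ X ∈ I.G.simplePaths I.s I.t ∧ Y ∈ I.G.simplePaths I.s I.t ∧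
      pairWeight N.weights.1 N.weights.2 (X.map Fin.valEmbedding) (Y.map Fin.valEmbedding) ≤
        I.k := by
  have hcard : (Y \ X ∪ X \ Y).card = (X \ Y).card + (Y \ X).card := by
    rw [Finset.card_union_of_disjoint disjoint_sdiff_sdiff, add_comm]
  simp only [pairWeight, ← Finset.map_sdiff, Finset.card_map]
  cases N
  · simp [Instance.Feasible, Multidigraph.neighborhood, NeighborhoodKind.weights]
  · simp [Instance.Feasible, Multidigraph.neighborhood, NeighborhoodKind.weights]
  · simp [Instance.Feasible, Multidigraph.neighborhood, NeighborhoodKind.weights, hcard]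

theorem Instance.cost_eq (I : Instance) (X Y : Finset (Fin I.m)) :
    I.cost X Y = pairCost (toArray I.C) (toArray I.c) (X.map Fin.valEmbedding)
      (Y.map Fin.valEmbedding) := by
  simp [Instance.cost, pairCost, toArray_val]

theorem NeighborhoodKind.weights_le (N : NeighborhoodKind) : N.weights.1 ≤ 1 ∧ N.weights.2 ≤ 1 := by
  cases N <;> decide

theorem isSol_three {D : SPTree ℕ} {X Y : Finset ℕ} :
    IsSol D 3 X Y ↔ (X ∈ D.lang fun a => {{a}}) ∧ Y ∈ D.lang fun a => {{a}} := by
  simp [IsSol, IsPart]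

/-- The traced solution is optimal. -/
theorem Instance.isAnswer_of_filled (I : Instance) (N : NeighborhoodKind) {next root : ℕ}
    {D : ℕ → SPTree ℕ} {L R ty f : ℕ → ℕ} {E : Edge} {T : Cells} {M : Mem}
    (hT : T.Filled I.m next I.k N.weights.1 N.weights.2 L R ty (toArray I.C) (toArray I.c))
    (hO : Ops I.m next D L R ty {E}) (hE : E.id = root)
    (paths : (D root).lang (fun a => {{a}}) = I.paths)
    (hroot : f root = addr I.k root 3 I.k)
    (hf : ∀ j, I.m ≤ j → j < next → f (L j) = T.bp (f j) ∧ f (R j) = T.bq (f j))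
    (h2 : ∀ e < I.m, M.iarr 2 e = T.bp (f e)) (h3 : ∀ e < I.m, M.iarr 3 e = T.bq (f e))
    (h0 : M.rreg 0 = T.val (f root)) : I.IsAnswer N M := by
  obtain ⟨hp, hq⟩ := N.weights_le
  have hlt : root < next := hE ▸ hO.lt E (by simp)
  have hedges : (D root).edges = Multiset.range I.m := by
    have h1 := hO.ex E (by simp)
    have h2 := hO.arcs
    rw [Multiset.singleton_bind, ← h1, hE] at h2
    exact h2
  have hle : ∀ {X Y : Finset (Fin I.m)}, I.Feasible N X Y →
      T.flag (f root) ≠ 0 ∧ T.val (f root) ≤ I.cost X Y := fun {X Y} h => by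
    obtain ⟨hX, hY, hw⟩ := (I.feasible_iff N X Y).1 h
    rw [I.cost_eq, hroot]
    exact hT.le_cost hO hp hq hlt (by decide) le_rfl
      (isSol_three.2 ⟨paths ▸ ⟨X, hX, rfl⟩, paths ▸ ⟨Y, hY, rfl⟩⟩) hw
  -- A path paired with itself has weight 0, so the root cell is not empty.
  have hflag : T.flag (f root) ≠ 0 := by
    obtain ⟨X, hX⟩ := (D root).lang_nonempty
    rw [paths] at hX
    obtain ⟨X, hX, -⟩ := hX
    exact (hle ((I.feasible_iff N X X).2 ⟨hX, hX, by simp [pairWeight]⟩)).1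
  obtain ⟨hs, hw, hv, hb⟩ := hT.solution hO hp hq hf hlt (by decide) le_rfl hroot hflag
  rw [hedges] at hs hw hv hb
  obtain ⟨hX, hY⟩ := isSol_three.1 hs
  rw [paths] at hX hY
  obtain ⟨X, hX, hXe⟩ := hX
  obtain ⟨Y, hY, hYe⟩ := hY
  rw [← hXe, ← hYe] at hw hv
  rw [← I.cost_eq] at hv
  have hF := (I.feasible_iff N X Y).2 ⟨hX, hY, hw⟩
  refine ⟨X, Y, ⟨hF, fun X' Y' h => hv ▸ (hle h).2⟩, fun e => ?_, fun e => ?_, h0.trans hv⟩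
  · have h1 := (hb e (by simp)).1
    have h4 : e ∈ X ↔ T.bp (f e) = 1 := by
      have := Finset.ext_iff.1 hXe e
      simpa [Fin.val_inj] using this
    rw [h2 e e.2]
    split_ifs with h <;> rw [h4] at h <;> omega
  · have h1 := (hb e (by simp)).2
    have h4 : e ∈ Y ↔ T.bq (f e) = 1 := by
      have := Finset.ext_iff.1 hYe e
      simpa [Fin.val_inj] using this
    rw [h3 e e.2]
    split_ifs with h <;> rw [h4] at h <;> omega

theorem Instance.adjInv_input (I : Instance) :
    AdjInv (toArray fun e => (I.G.tail e : ℕ)) (toArray fun e => (I.G.head e : ℕ)) I.m 0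
      I.input := by
  refine ⟨rfl, rfl, rfl, rfl, fun v => ⟨[], rfl, by simp⟩, fun v => ?_⟩
  simp [Instance.input]

/-- The decomposition in time `O(m)`. -/
theorem Instance.decompose_runs (I : Instance) (h : IsASP I.G I.s I.t) :
    Runs (.seq adjacency decompose) I.input (130 * I.m + 65) fun M => ∃ next root D,
      Ops I.m next D (M.iarr 13) (M.iarr 14) (M.iarr 15) {⟨root, D root, I.s, I.t⟩} ∧
      (D root).lang (fun a => {{a}}) = I.paths ∧ M.iarr 7 I.t = root + 1 ∧ M.ireg 21 = next ∧
      M.ireg 24 = 1 := by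
  obtain ⟨T, wf, src, tgt, edges, lang⟩ := Instance.exists_tree h
  refine .seq (adjacency_runs I.adjInv_input).frame ?_ (n₂ := 120 * I.m + 64) (by omega)
  rintro M ⟨hM, fr⟩
  have hlt : ∀ e < I.m, toArray (fun e => (I.G.tail e : ℕ)) e < I.n ∧
      toArray (fun e => (I.G.head e : ℕ)) e < I.n := fun e he => by
    simp [toArray, he]
  have hr : ∀ x < 6, M.ireg x = I.input.ireg x := fun x hx => by
    refine fr.ireg x ?_
    interval_cases x <;> decide
  exact (RecSP.decompose_runs (p := ⟨I.n, I.m, I.s, I.t, _, _, I.paths⟩) hM wf src tgt edges lang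
    hlt (hr 0 (by decide)) (hr 3 (by decide)) (hr 4 (by decide)) (hr 5 (by decide))
    fun x => congrFun (fr.iarr 7 (by decide)) x).mono le_rfl
      fun M' ⟨next, root, D, hD⟩ => ⟨next, root, D, hD.ops, hD.paths, hD.top, hD.r21, hD.r24⟩

/-- The leading coefficient 171 = 9 · 19 comes from at most nine rules per node and 19 steps per
combination of two cells. As m, k ≥ 1, all lower terms are bounded by multiples of m k². -/
theorem time_bound {m k next : ℕ} (hm : 1 ≤ m) (hk : 1 ≤ k) (hn : next ≤ 2 * m) :
    (130 * m + 65) + (((12 * k + 26) * next + 5) + (((32 * k + 61) * m + 2) +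
      (((((19 * (k + 1) + 10) * (k + 1) + 5) * 9 + 6) * (next - m) + 2) +
        ((3 * k + 9 * next + 9) + (7 * m + 2))))) ≤ 2000 * (m * k ^ 2) := by
  have h1 : (12 * k + 26) * next ≤ (12 * k + 26) * (2 * m) := Nat.mul_le_mul_left _ hn
  have h2 := Nat.mul_le_mul_left (((19 * (k + 1) + 10) * (k + 1) + 5) * 9 + 6)
    (show next - m ≤ m by omega)
  have h3 : m * k ≤ m * k ^ 2 := Nat.mul_le_mul_left _ (Nat.le_self_pow two_ne_zero k)
  have h4 : m ≤ m * k := Nat.le_mul_of_pos_right m hk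
  have h5 : k ≤ m * k := Nat.le_mul_of_pos_left k hm
  have h6 : (12 * k + 26) * (2 * m) = 24 * (m * k) + 52 * m := by ring
  have h7 : (((19 * (k + 1) + 10) * (k + 1) + 5) * 9 + 6) * m =
    171 * (m * k ^ 2) + 432 * (m * k) + 312 * m := by ring
  have h8 : (32 * k + 61) * m = 32 * (m * k) + 61 * m := by ring
  omega

/-- The algorithm is correct and runs in time `O(m k ^ 2)`. -/
theorem recSP_runs (I : Instance) (N : NeighborhoodKind) (h : IsASP I.G I.s I.t) (hk : 1 ≤ I.k) :
    Runs (recSP N.weights.1 N.weights.2) I.input (2000 * (I.m * I.k ^ 2)) (I.IsAnswer N) := by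
  obtain ⟨hp, hq⟩ := N.weights_le
  obtain ⟨T₁, M₁, e₁, t₁, ⟨next, root, D, hO, paths, top, r21, r24⟩, fr⟩ :=
    (I.decompose_runs h).frame
  -- Each contraction trades one edge for one new node, so `next` plus the number of edges is always
  -- 2m; one edge is left at the end.
  have hn : next + 1 = 2 * I.m := hO.card
  refine .seq (R := (M₁ = ·)) ⟨T₁, M₁, e₁, t₁, rfl⟩ ?_
    (time_bound (next := next) (by omega) hk (by omega))
  rintro _ rfl
  have i1 : M₁.ireg 1 = I.m := fr.ireg 1 (by decide)
  have i2 : M₁.ireg 2 = I.k := fr.ireg 2 (by decide)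
  have i4 : M₁.ireg 4 = I.t := fr.ireg 4 (by decide)
  have i5 : M₁.ireg 5 = 0 := fr.ireg 5 (by decide)
  have a20 : ∀ y, M₁.iarr 20 y = 0 := fun y => congrFun (fr.iarr 20 (by decide)) y
  have x0 : M₁.rarr 0 = toArray I.C := fr.rarr 0 (by decide)
  have x1 : M₁.rarr 1 = toArray I.c := fr.rarr 1 (by decide)
  have y1 : M₁.rreg 1 = 0 := fr.rreg 1 (by decide)
  refine .seq (bases_runs i2 r21).frame ?_ le_rfl
  rintro M₂ ⟨⟨r31, hbase⟩, fr₂⟩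
  have hT : TableMem I.m next I.k N.weights.1 N.weights.2 0 (M₁.iarr 13) (M₁.iarr 14) (M₁.iarr 15)
      (toArray I.C) (toArray I.c) M₂ :=
    ⟨(fr₂.ireg 1 (by decide)).trans i1, (fr₂.ireg 5 (by decide)).trans i5,
      (fr₂.ireg 21 (by decide)).trans r21, (fr₂.ireg 24 (by decide)).trans r24, r31,
      fr₂.iarr 13 (by decide), fr₂.iarr 14 (by decide), fr₂.iarr 15 (by decide), hbase,
      fun _ _ h => absurd h (Nat.not_lt_zero _), fun _ _ h => absurd h (Nat.not_lt_zero _),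
      fun y _ => (congrFun (fr₂.iarr 20 (by decide)) y).trans (a20 y)⟩
  refine .seq (leaves_runs hp hq hO.le hT ((fr₂.rarr 0 (by decide)).trans x0)
    ((fr₂.rarr 1 (by decide)).trans x1) ((fr₂.rreg 1 (by decide)).trans y1)).frame ?_ le_rfl
  rintro M₃ ⟨hT₃, fr₃⟩
  refine .seq (convolutions_runs hO hT₃).frame ?_ le_rfl
  rintro M₄ ⟨hT₄, fr₄⟩
  have hreg : ∀ x ∈ [2, 4], M₄.ireg x = M₁.ireg x := fun x hx => by
    refine (fr₄.ireg x ?_).trans ((fr₃.ireg x ?_).trans (fr₂.ireg x ?_)) <;> revert x hx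
    · decide
    · simp [leaves, leafRow, Prog.block, Prog.collect, Instr.iregs]
    · decide
  have harr : M₄.iarr 7 = M₁.iarr 7 := by
    refine (fr₄.iarr 7 ?_).trans ((fr₃.iarr 7 ?_).trans (fr₂.iarr 7 ?_))
    · decide
    · simp [leaves, leafRow, Prog.block, Prog.collect, Instr.iarrs]
    · decide
  refine .seq (traceback_runs hO rfl hT₄.bases hT₄.r1 ((hreg 2 (by simp)).trans i2)
    ((hreg 4 (by simp)).trans i4) hT₄.r21 hT₄.a13 hT₄.a14 (by rw [harr, top])) ?_ le_rfl
  rintro M₅ ⟨b1, b2, b3, b4, b5⟩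
  refine (readout_runs b1).frame.mono le_rfl ?_
  rintro M₆ ⟨c1, fr₆⟩
  rw [b2] at c1
  exact I.isAnswer_of_filled N ⟨fun e he => hT₄.leaf e he (he.trans_le hO.le), hT₄.node⟩ hO rfl
    paths b4 b5 (fun e he => (c1 e he).1) (fun e he => (c1 e he).2)
    ((fr₆.rreg 0 (by decide)).trans b3)

end RecSP

theorem mainTheorem3 (N : RecSP.NeighborhoodKind) :
    ∃ (p : RecSP.Prog) (K : ℕ), ∀ I : RecSP.Instance,
      RecSP.IsASP I.G I.s I.t → 1 ≤ I.k → (∀ e, 0 ≤ I.C e) → (∀ e, 0 ≤ I.c e) →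
        ∃ (T : ℕ) (M : RecSP.Mem), RecSP.Exec p I.input T M ∧
          I.IsAnswer N M ∧ T ≤ K * (I.m * I.k ^ 2) := by
  refine ⟨RecSP.recSP N.weights.1 N.weights.2, 2000, fun I h hk _ _ => ?_⟩
  obtain ⟨T, M, h1, h2, h3⟩ := RecSP.recSP_runs I N h hk
  exact ⟨T, M, h1, h3, h2⟩
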